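/- Let $K=L^2(0,\infty;dt)$ (complex-valued functions), with cosine transform $\mathcal F_+(f)(u)=2\int_0^\infty\cos(2\pi tu)f(t)\,dt$ (extended to $L^2$ by continuity). For $a>0$ let $K_a\subset K$ be the closed subspace of those $f$ such that $f$ and $\mathcal F_+(f)$ vanish almost everywhere on $(0,a)$. For each $f\in K_a$ the function $\pi^{-s/2}\Gamma(\tfrac s2)\int_0^\infty f(t)t^{-s}\,dt$, $\Re(s)>\frac12$, continues to an entire function $M(f)$, and for each $w\in\mathbb C$ and $k\ge 0$ there is a unique vector $Z^a_{w,k}\in K_a$ (an evaluator) with $\int_0^\infty f(t)Z^a_{w,k}(t)\,dt=M(f)^{(k)}(w)$ for all $f\in K_a$. An indexed family of vectors in a Hilbert space is called complete if its linear span is dense, and minimal if none of its vectors lies in the closed linear span of the others. Let $\mathcal Z$ be a non-empty multiset of complex numbers (countably many numbers $\rho$, each with a finite multiplicity $m_\rho\geq1$). The evaluators associated to $\mathcal Z$ in $K_a$ are the $Z^a_{\rho,k}$, $\rho\in\mathcal Z$, $0\le k<m_\rho$. Let $a_1(\mathcal Z)\in[0,\infty]$ be the supremum of the $b>0$ such that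 the evaluators associated to $\mathcal Z$ are minimal in $K_b$ ($0$ if there is none), and $a_2(\mathcal Z)\in[0,\infty]$ the infimum of the $b>0$ such that they are complete in $K_b$ ($\infty$ if there is none). Let $a(\mathcal Z)$ denote either of $a_1(\mathcal Z)$, $a_2(\mathcal Z)$ (the two always coincide, and the theorem is asserted for each of them). **Theorem.** If $a(\mathcal Z)<a<\infty$, then the evaluators associated to $\mathcal Z$ in $K_a$ remain complete, and not minimal, after omitting any finitely many of them. -/

import Mathlib

open MeasureTheory Set
open scoped ENNReal FourierTransform

namespace Sonine

/-- Lebesgue measure `dt` on the half-line `(0, ∞)`. -/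
noncomputable abbrev halfLine : Measure ℝ := volume.restrict (Ioi (0 : ℝ))

/-- The Hilbert space `K = L²(0, ∞; dt)` of complex-valued functions. -/
abbrev K : Type := Lp ℂ 2 halfLine

theorem map_abs_volume :
    Measure.map (fun x : ℝ => |x|) volume = (2 : ℝ≥0∞) • halfLine := by
  have hm : Measurable (fun x : ℝ => |x|) := measurable_id.abs
  ext s hs
  rw [Measure.map_apply hm hs, Measure.smul_apply, Measure.restrict_apply hs, smul_eq_mul, two_mul]
  have hpos : (fun x : ℝ => |x|) ⁻¹' s ∩ Ioi 0 = s ∩ Ioi 0 := by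
    ext x
    simp only [mem_inter_iff, mem_preimage, mem_Ioi]
    constructor
    · rintro ⟨h, hx⟩
      rw [abs_of_pos hx] at h
      exact ⟨h, hx⟩
    · rintro ⟨h, hx⟩
      rw [abs_of_pos hx]
      exact ⟨h, hx⟩
  have hneg : (fun x : ℝ => |x|) ⁻¹' s ∩ Iio 0 = (fun x : ℝ => -x) ⁻¹' (s ∩ Ioi 0) := by
    ext x
    simp only [mem_inter_iff, mem_preimage, mem_Iio, mem_Ioi, Left.neg_pos_iff]
    constructor
    · rintro ⟨h, hx⟩
      rw [abs_of_neg hx] at h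
      exact ⟨h, hx⟩
    · rintro ⟨h, hx⟩
      rw [abs_of_neg hx]
      exact ⟨h, hx⟩
  rw [← measure_inter_add_sdiff ((fun x : ℝ => |x|) ⁻¹' s) (measurableSet_Ioi (a := (0 : ℝ))), hpos]
  congr 1
  have hd : ((fun x : ℝ => |x|) ⁻¹' s) \ Ioi 0 = (fun x : ℝ => |x|) ⁻¹' s ∩ Iic 0 := by
    rw [sdiff_eq, compl_Ioi]
  rw [hd, measure_congr ((ae_eq_refl _).inter (Iio_ae_eq_Iic (a := (0 : ℝ)))).symm, hneg]
  exact Measure.measure_preimage_neg _ _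

theorem quasiMeasurePreserving_abs :
    Measure.QuasiMeasurePreserving (fun x : ℝ => |x|) volume halfLine :=
  ⟨measurable_id.abs, by
    rw [map_abs_volume]
    exact Measure.smul_absolutelyContinuous⟩

theorem memLp_comp_abs (f : K) : MemLp (fun x : ℝ => f |x|) 2 volume := by
  have h : MemLp f 2 (Measure.map (fun x : ℝ => |x|) volume) := by
    rw [map_abs_volume]
    exact (Lp.memLp f).smul_measure (by simp)
  exact h.comp_of_map measurable_id.abs.aemeasurable

/-- The even extension `x ↦ f |x|` of `f ∈ L²(0, ∞)` to an element of `L²(ℝ)`. -/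
noncomputable def evenExt : K →ₗ[ℂ] Lp ℂ 2 (volume : Measure ℝ) where
  toFun f := (memLp_comp_abs f).toLp (fun x : ℝ => f |x|)
  map_add' f g := by
    rw [← MemLp.toLp_add]
    apply MemLp.toLp_congr
    exact quasiMeasurePreserving_abs.ae (Lp.coeFn_add f g)
  map_smul' c f := by
    rw [RingHom.id_apply, ← MemLp.toLp_const_smul]
    apply MemLp.toLp_congr
    exact quasiMeasurePreserving_abs.ae (Lp.coeFn_smul c f)

/-- The cosine transform `f ↦ (u ↦ 2 ∫₀^∞ cos(2πtu) f(t) dt)` on `L²(0, ∞)`, as the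
(Plancherel) Fourier transform on `L²(ℝ)` of the even extension, restricted to `(0, ∞)`. -/
noncomputable def cosineTransform : K →ₗ[ℂ] K :=
  (LpToLpRestrictCLM ℝ ℂ ℂ volume 2 (Ioi (0 : ℝ))).toLinearMap ∘ₗ
    (Lp.fourierTransformₗᵢ ℝ ℂ).toLinearEquiv.toLinearMap ∘ₗ evenExt

/-- The subspace of the functions in `L²(0, ∞)` that vanish (almost everywhere) on `(0, a)`. -/
def vanishing (a : ℝ) : Submodule ℂ K where
  carrier := {f | ∀ᵐ t ∂halfLine, t < a → f t = 0}
  zero_mem' := by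
    filter_upwards [Lp.coeFn_zero ℂ 2 halfLine] with t ht _
    rw [ht]
    rfl
  add_mem' {f g} hf hg := by
    filter_upwards [hf, hg, Lp.coeFn_add f g] with t h1 h2 h3 hlt
    rw [h3, Pi.add_apply, h1 hlt, h2 hlt, add_zero]
  smul_mem' c f hf := by
    filter_upwards [hf, Lp.coeFn_smul c f] with t h1 h2 hlt
    rw [h2, Pi.smul_apply, h1 hlt, smul_zero]

/-- The Sonine space `K_a`: the functions in `L²(0, ∞)` vanishing on `(0, a)` together with
their cosine transform. -/
noncomputable def sonineSpace (a : ℝ) : Submodule ℂ K :=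
  vanishing a ⊓ (vanishing a).comap cosineTransform

/-- The right Mellin transform `∫₀^∞ f(t) t^{-s} dt`. For `f` in a Sonine space `K_a`, `a > 0`,
the integral converges absolutely for `Re s > 1/2`. -/
noncomputable def rightMellin (f : K) (s : ℂ) : ℂ :=
  ∫ t in Ioi (0 : ℝ), f t * (t : ℂ) ^ (-s)

/-- `F` is the completed right Mellin transform `M(f)` of `f`: the entire function which is
the continuation of `π^{-s/2} Γ(s/2) ∫₀^∞ f(t) t^{-s} dt` from the half-plane `Re s > 1/2`. -/
def IsCompletedMellin (f : K) (F : ℂ → ℂ) : Prop :=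
  Differentiable ℂ F ∧
    ∀ s : ℂ, 1 / 2 < s.re →
      F s = (Real.pi : ℂ) ^ (-s / 2) * Complex.Gamma (s / 2) * rightMellin f s

/-- `Z` is the evaluator `Z^a_{w,k}` of `K_a`: every `f ∈ K_a` has an entire completed Mellin
transform `M(f)`, and `∫₀^∞ f(t) Z(t) dt = M(f)^{(k)}(w)`. -/
def IsEvaluator (a : ℝ) (w : ℂ) (k : ℕ) (Z : sonineSpace a) : Prop :=
  ∀ f ∈ sonineSpace a, ∃ F : ℂ → ℂ, IsCompletedMellin f F ∧
    ∫ t in Ioi (0 : ℝ), f t * (Z : K) t = iteratedDeriv k F w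

open Classical in
/-- The evaluator `Z^a_{w,k} ∈ K_a` (with the value `0` if there were none). -/
noncomputable def evaluator (a : ℝ) (w : ℂ) (k : ℕ) : sonineSpace a :=
  if h : ∃ Z : sonineSpace a, IsEvaluator a w k Z then h.choose else 0

/-- An indexed family of vectors is complete if its linear span is dense. -/
def IsCompleteSystem {ι E : Type*} [NormedAddCommGroup E] [NormedSpace ℂ E] (u : ι → E) : Prop :=
  Dense (Submodule.span ℂ (range u) : Set E)

/-- An indexed family of vectors is minimal if none of them lies in the closure of the linear
span of the others. -/
def IsMinimalSystem {ι E : Type*} [NormedAddCommGroup E] [NormedSpace ℂ E] (u : ι → E) : Prop :=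
  ∀ i, u i ∉ closure (Submodule.span ℂ (u '' {j | j ≠ i}) : Set E)

/-- The family of the evaluators `Z^a_{w,k}` in `K_a`, for `(w, k) ∈ I`. -/
noncomputable def evaluators (a : ℝ) (I : Set (ℂ × ℕ)) : I → sonineSpace a :=
  fun p => evaluator a p.1.1 p.1.2

/-- The pairs `(ρ, k)` with `0 ≤ k < m(ρ)` attached to the multiset of complex numbers in which
`ρ` has multiplicity `m ρ`. -/
def multisetIndex (m : ℂ → ℕ) : Set (ℂ × ℕ) := {p | p.2 < m p.1}

/-- The index `a₁ ∈ [0, ∞]` of a multiset: the associated evaluators are minimal in `K_b` for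
`b < a₁` and not minimal for `b > a₁`. -/
noncomputable def minimalityIndex (m : ℂ → ℕ) : ℝ≥0∞ :=
  sSup {x | ∃ b : ℝ, 0 < b ∧ IsMinimalSystem (evaluators b (multisetIndex m)) ∧
    x = ENNReal.ofReal b}

/-- The index `a₂ ∈ [0, ∞]` of a multiset: the associated evaluators are complete in `K_b` for
`b > a₂` and not complete for `b < a₂`. -/
noncomputable def completenessIndex (m : ℂ → ℕ) : ℝ≥0∞ :=
  sInf {x | ∃ b : ℝ, 0 < b ∧ IsCompleteSystem (evaluators b (multisetIndex m)) ∧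
    x = ENNReal.ofReal b}

end Sonine

namespace Sonine

open Complex Filter Topology SchwartzMap

/-! Orthogonality in the Hilbert space `sonineSpace a` turns completeness into uniqueness: the
evaluators attached to `I` are complete iff no nonzero `f ∈ K_a` has all the jets of `M(f)` indexed
by `I` equal to zero (`isCompleteSystem_evaluators_iff`).

The theorem then rests on trading room for zeros. If `c > 1` and `f ∈ K_a`, then `t ↦ f(ct)` lies in
`K_{a/c}` and its completed Mellin transform is `c^{s-1} M(f)(s)`. Hence `(c^{s-1} - c^{w-1})
M(f)(s)` is the transform of a nonzero element of `K_{a/c}` as soon as `f ≠ 0`, and it has one more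
zero at `w`. Any drop from `a` to `b < a` can be split into finitely many such steps, so finitely
many omitted conditions can be restored at the cost of an arbitrarily small drop. If the full system
is complete in some `K_b` with `b < a`, the reduced one is therefore complete in `K_a`
(`isCompleteSystem_sdiff_of_lt`). Omitting one vector more keeps completeness, so that vector is in
the closed span of the others and minimality fails; there is a vector left to omit because `K_a ≠
0`.

For `a₂` such a `b` comes from the infimum. For `a₁` one needs that non-minimal implies complete
(`isCompleteSystem_of_not_isMinimalSystem`), which uses that a zero of `M(f)` can be divided out
inside `K_a` (`exists_sub_mul_completedMellin_eq`).

The analysis goes through the Gaussian transform `G(x) = ∫ f(t) e^{-πt²x²} dt`. It is injective, the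
cosine transform acts on it by `G(x) ↦ x⁻¹ G(x⁻¹)`, vanishing of `f` on `(0, a)` corresponds to
decay of `G` like `e^{-πa²x²}`, and `M(f)` is twice the Mellin transform of `G`. Continuation,
functional equation, boundedness of evaluators and membership in `K_a` can all be read off from `G`.
-/

/-! ### The Fourier transform on L²(ℝ) and unitarity of the cosine transform. -/

theorem integral_fourier_mul_schwartz (h : Lp ℂ 2 (volume : Measure ℝ)) (η : 𝓢(ℝ, ℂ)) :
    ∫ x, η x * (𝓕 h : Lp ℂ 2 (volume : Measure ℝ)) x = ∫ x, (𝓕 η : 𝓢(ℝ, ℂ)) x * h x := by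
  have := congrArg (fun T => T η) (Lp.fourier_toTemperedDistribution_eq h)
  simpa [TemperedDistribution.fourier_apply, Lp.toTemperedDistribution_apply] using this.symm

theorem integral_fourier_smul_eq_of_integrable {u h : ℝ → ℂ} (hu : Integrable u)
    (hh : Integrable h) : ∫ x, 𝓕 u x • h x = ∫ x, u x • 𝓕 h x := by
  simpa using! VectorFourier.integral_fourierIntegral_smul_eq_flip (L := innerₗ ℝ)
    Real.continuous_fourierChar continuous_inner hu hh

theorem continuous_fourier_of_integrable {h : ℝ → ℂ} (hh : Integrable h) : Continuous (𝓕 h) :=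
  VectorFourier.fourierIntegral_continuous (L := innerₗ ℝ) Real.continuous_fourierChar
    continuous_inner hh

/-- Both functions have the same integral against every test function: the L² transform by duality
of tempered distributions, the integral transform by Fubini. -/
theorem fourier_toLp_ae_eq {h : ℝ → ℂ} (h1 : Integrable h) (h2 : MemLp h 2) :
    ((𝓕 (h2.toLp h) : Lp ℂ 2 (volume : Measure ℝ)) : ℝ → ℂ) =ᵐ[volume] 𝓕 h := by
  have hl : LocallyIntegrable (𝓕 (h2.toLp h) : Lp ℂ 2 (volume : Measure ℝ)) volume :=
    (Lp.memLp (𝓕 (h2.toLp h) : Lp ℂ 2 (volume : Measure ℝ))).locallyIntegrable (by norm_num)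
  refine ae_eq_of_integral_contDiff_smul_eq hl ?_ ?_
  · exact (continuous_fourier_of_integrable h1).locallyIntegrable
  · intro g hg hgc
    have hgc' : HasCompactSupport (Complex.ofRealCLM ∘ g) := hgc.comp_left rfl
    have hg' : ContDiff ℝ (⊤ : ℕ∞) (Complex.ofRealCLM ∘ g) := by fun_prop
    let η : 𝓢(ℝ, ℂ) := hgc'.toSchwartzMap hg'
    have hη : ∀ x, η x = (g x : ℂ) := fun x => rfl
    have e := integral_fourier_mul_schwartz (h2.toLp h) η
    simp only [Complex.real_smul, ← hη]
    rw [e]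
    have e2 := integral_fourier_smul_eq_of_integrable η.integrable h1
    calc _ = ∫ x, (𝓕 η : 𝓢(ℝ, ℂ)) x * h x := by
          refine integral_congr_ae ?_
          filter_upwards [h2.coeFn_toLp] with x hx
          rw [hx]
      _ = _ := by
          simp only [SchwartzMap.fourier_coe]
          exact e2

theorem eq_of_forall_schwartz {u v : Lp ℂ 2 (volume : Measure ℝ)}
    (h : ∀ η : 𝓢(ℝ, ℂ), ∫ x, η x * u x = ∫ x, η x * v x) : u = v := by
  have hk := Lp.ker_toTemperedDistributionCLM_eq_bot (F := ℂ) (p := 2) (μ := (volume : Measure ℝ))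
  rw [LinearMap.ker_eq_bot] at hk
  apply hk
  ext η
  simpa [Lp.toTemperedDistribution_apply] using h η

/-- Reflection `x ↦ -x` on `L²(ℝ)`. -/
noncomputable def reflect (u : Lp ℂ 2 (volume : Measure ℝ)) : Lp ℂ 2 (volume : Measure ℝ) :=
  Lp.compMeasurePreserving Neg.neg (Measure.measurePreserving_neg volume) u

theorem reflect_coe (u : Lp ℂ 2 (volume : Measure ℝ)) : reflect u =ᵐ[volume] fun x => u (-x) :=
  Lp.coeFn_compMeasurePreserving u (Measure.measurePreserving_neg volume)

theorem integral_mul_reflect (η : ℝ → ℂ) (u : Lp ℂ 2 (volume : Measure ℝ)) :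
    ∫ x, η x * reflect u x = ∫ x, η (-x) * u x := by
  rw [← integral_neg_eq_self]
  refine integral_congr_ae ?_
  have := (Measure.measurePreserving_neg (volume : Measure ℝ)).quasiMeasurePreserving.ae
    (reflect_coe u)
  filter_upwards [this] with x hx
  rw [hx, neg_neg]

theorem fourier_reflect (u : Lp ℂ 2 (volume : Measure ℝ)) : 𝓕 (reflect u) = reflect (𝓕 u) := by
  refine eq_of_forall_schwartz fun η => ?_
  let η' : 𝓢(ℝ, ℂ) := SchwartzMap.compCLMOfContinuousLinearEquiv ℂ
    (ContinuousLinearEquiv.neg ℝ (M := ℝ)) η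
  have h' : ∀ x, η' x = η (-x) := fun x => rfl
  rw [integral_fourier_mul_schwartz, integral_mul_reflect, integral_mul_reflect]
  simp only [← h']
  rw [integral_fourier_mul_schwartz]
  congr 1
  ext x
  congr 1
  simp only [SchwartzMap.fourier_coe]
  rw [Real.fourier_eq, Real.fourier_eq, ← integral_neg_eq_self]
  simp [h']

theorem evenExt_coe (f : K) : evenExt f =ᵐ[volume] fun x : ℝ => f |x| :=
  (memLp_comp_abs f).coeFn_toLp

theorem reflect_evenExt (f : K) : reflect (evenExt f) = evenExt f := by
  refine Lp.ext ?_
  have := (Measure.measurePreserving_neg (volume : Measure ℝ)).quasiMeasurePreserving.ae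
    (evenExt_coe f)
  filter_upwards [reflect_coe (evenExt f), evenExt_coe f, this] with x h1 h2 h3
  rw [h1, h2, h3, abs_neg]

theorem cosineTransform_coe (f : K) :
    cosineTransform f =ᵐ[halfLine] (𝓕 (evenExt f) : Lp ℂ 2 (volume : Measure ℝ)) :=
  LpToLpRestrictCLM_coeFn ℂ (Ioi (0 : ℝ)) _

/-- The Fourier transform commutes with reflection, so it keeps even functions even and the
restriction to the half-line loses nothing. Unitarity on the line thus descends to
`cosineTransform`. -/
theorem fourier_evenExt (f : K) : 𝓕 (evenExt f) = evenExt (cosineTransform f) := by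
  have hr : reflect (𝓕 (evenExt f)) = 𝓕 (evenExt f) := by
    rw [← fourier_reflect, reflect_evenExt]
  refine Lp.ext ?_
  have h0 := reflect_coe (𝓕 (evenExt f))
  rw [hr] at h0
  filter_upwards [evenExt_coe (cosineTransform f), h0,
    quasiMeasurePreserving_abs.ae (cosineTransform_coe f)] with x h1 h2 h3
  rw [h1, h3]
  rcases abs_choice x with h | h
  · rw [h]
  · rw [h, h2]

theorem inner_eq_integral (f g : K) :
    inner ℂ f g = ∫ t in Ioi (0 : ℝ), g t * (starRingEnd ℂ) (f t) := by
  rw [L2.inner_def]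
  rfl

theorem integral_comp_abs_halfLine {φ : ℝ → ℂ} (h : AEStronglyMeasurable φ halfLine) :
    ∫ x : ℝ, φ |x| = 2 * ∫ t in Ioi (0 : ℝ), φ t := by
  have := integral_map (μ := (volume : Measure ℝ)) (φ := fun x : ℝ => |x|)
    (measurable_id.abs.aemeasurable) (f := φ) ?_
  · rw [← this, map_abs_volume, integral_smul_measure]
    simp
  · rw [map_abs_volume]
    exact h.smul_measure _

theorem inner_evenExt (f g : K) : inner ℂ (evenExt f) (evenExt g) = 2 * inner ℂ f g := by
  rw [inner_eq_integral, L2.inner_def]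
  have : ∫ x, inner ℂ (evenExt f x) (evenExt g x) = ∫ x : ℝ,
      (fun t : ℝ => g t * (starRingEnd ℂ) (f t)) |x| := by
    refine integral_congr_ae ?_
    filter_upwards [evenExt_coe f, evenExt_coe g] with x h1 h2
    rw [h1, h2]
    rfl
  rw [this]
  exact integral_comp_abs_halfLine
    ((Lp.memLp g).1.mul (continuous_star.comp_aestronglyMeasurable (Lp.memLp f).1))

theorem inner_cosineTransform (f g : K) :
    inner ℂ (cosineTransform f) (cosineTransform g) = inner ℂ f g := by
  have h := Lp.inner_fourier_eq (evenExt f) (evenExt g)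
  rw [fourier_evenExt, fourier_evenExt, inner_evenExt, inner_evenExt] at h
  exact mul_left_cancel₀ two_ne_zero h

theorem norm_cosineTransform (f : K) : ‖cosineTransform f‖ = ‖f‖ := by
  have h := inner_cosineTransform f f
  rw [inner_self_eq_norm_sq_to_K, inner_self_eq_norm_sq_to_K] at h
  have h2 : ‖cosineTransform f‖ ^ 2 = ‖f‖ ^ 2 := by exact_mod_cast h
  exact (pow_left_inj₀ (norm_nonneg _) (norm_nonneg _) two_ne_zero).1 h2

/-- The cosine transform of an integrable function. -/
noncomputable def cosInt (ψ : ℝ → ℂ) (t : ℝ) : ℂ :=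
  2 * ∫ u in Ioi (0 : ℝ), Real.cos (2 * Real.pi * t * u) * ψ u

theorem fourier_comp_abs {ψ : ℝ → ℂ} (hψ : AEStronglyMeasurable ψ halfLine)
    (h : Integrable (fun x : ℝ => ψ |x|)) (t : ℝ) :
    𝓕 (fun x : ℝ => ψ |x|) t = cosInt ψ t := by
  have e1 : 𝓕 (fun x : ℝ => ψ |x|) t = ∫ u : ℝ, cexp (-(2 * Real.pi * t * u * I)) * ψ |u| := by
    rw [Real.fourier_eq']
    congr 1
    ext u
    rw [smul_eq_mul]
    congr 2
    simp
    ring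
  have e2 : 𝓕 (fun x : ℝ => ψ |x|) t = ∫ u : ℝ, cexp (2 * Real.pi * t * u * I) * ψ |u| := by
    rw [e1, ← integral_neg_eq_self]
    simp
  have i1 : Integrable (fun u : ℝ => cexp (-(2 * Real.pi * t * u * I)) * ψ |u|) := by
    refine h.bdd_mul (c := 1) (by fun_prop) (ae_of_all _ fun u => ?_)
    rw [Complex.norm_exp]
    simp
  have i2 : Integrable (fun u : ℝ => cexp (2 * Real.pi * t * u * I) * ψ |u|) := by
    refine h.bdd_mul (c := 1) (by fun_prop) (ae_of_all _ fun u => ?_)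
    rw [Complex.norm_exp]
    simp
  -- Averaging the integral with its image under `u ↦ -u` replaces the exponential by a cosine.
  have e3 : 2 * 𝓕 (fun x : ℝ => ψ |x|) t
      = ∫ u : ℝ, (fun v : ℝ => 2 * (Real.cos (2 * Real.pi * t * v) * ψ v)) |u| := by
    rw [two_mul]
    nth_rewrite 1 [e1]
    rw [e2, ← integral_add i1 i2]
    congr 1
    ext u
    have : Real.cos (2 * Real.pi * t * |u|) = Real.cos (2 * Real.pi * t * u) := by
      rcases abs_choice u with h | h <;> simp [h]
    simp only [this, Complex.ofReal_cos, Complex.cos]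
    push_cast
    ring_nf
  rw [cosInt]
  apply mul_left_cancel₀ (two_ne_zero (α := ℂ))
  refine e3.trans ((integral_comp_abs_halfLine
    (φ := fun v : ℝ => 2 * (Real.cos (2 * Real.pi * t * v) * ψ v)) ?_).trans ?_)
  · exact (Continuous.aestronglyMeasurable (by fun_prop)).mul hψ |>.const_mul 2
  · rw [integral_const_mul]

theorem cosineTransform_toLp {ψ : ℝ → ℂ} (h1 : Integrable ψ halfLine) (h2 : MemLp ψ 2 halfLine) :
    cosineTransform (h2.toLp ψ) =ᵐ[halfLine] cosInt ψ := by
  have hm : Measurable (fun x : ℝ => |x|) := measurable_id.abs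
  have g1 : Integrable (fun x : ℝ => ψ |x|) := by
    have h : Integrable ψ (Measure.map (fun x : ℝ => |x|) volume) := by
      rw [map_abs_volume]
      exact h1.smul_measure (by simp)
    exact h.comp_measurable hm
  have g2 : MemLp (fun x : ℝ => ψ |x|) 2 := by
    have h : MemLp ψ 2 (Measure.map (fun x : ℝ => |x|) volume) := by
      rw [map_abs_volume]
      exact h2.smul_measure (by simp)
    exact h.comp_of_map hm.aemeasurable
  have e : evenExt (h2.toLp ψ) = g2.toLp _ := by
    refine Lp.ext ?_
    filter_upwards [evenExt_coe (h2.toLp ψ), g2.coeFn_toLp,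
      quasiMeasurePreserving_abs.ae h2.coeFn_toLp] with x h1 h2 h3
    rw [h1, h2, h3]
  have h3 := ae_restrict_of_ae (s := Ioi (0 : ℝ)) (fourier_toLp_ae_eq g1 g2)
  filter_upwards [cosineTransform_coe (h2.toLp ψ), h3] with t ht h3
  rw [ht, e, h3, fourier_comp_abs h1.1 g1]

theorem cosInt_conj (ψ : ℝ → ℂ) (t : ℝ) :
    cosInt (fun u => (starRingEnd ℂ) (ψ u)) t = (starRingEnd ℂ) (cosInt ψ t) := by
  rw [cosInt, cosInt, map_mul, ← integral_conj]
  simp only [map_mul, Complex.conj_ofReal, map_ofNat]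

/-- Parseval's formula against an integrable and square integrable function. -/
theorem integral_mul_eq_integral_cosineTransform_mul (f : K) {ψ : ℝ → ℂ}
    (h1 : Integrable ψ halfLine) (h2 : MemLp ψ 2 halfLine) :
    ∫ t in Ioi (0 : ℝ), f t * ψ t = ∫ t in Ioi (0 : ℝ), cosineTransform f t * cosInt ψ t := by
  -- The inner product is conjugate-linear in its first argument, so unitarity is applied to the
  -- conjugate of `ψ`.
  have c1 : Integrable (fun u => (starRingEnd ℂ) (ψ u)) halfLine := by
    have := (Complex.conjCLE : ℂ →L[ℝ] ℂ).integrable_comp h1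
    exact this
  have c2 : MemLp (fun u => (starRingEnd ℂ) (ψ u)) 2 halfLine := h2.star
  have h := inner_cosineTransform (c2.toLp _) f
  rw [inner_eq_integral, inner_eq_integral] at h
  calc _ = ∫ t in Ioi (0 : ℝ), f t * (starRingEnd ℂ) ((c2.toLp _) t) := by
        refine integral_congr_ae ?_
        filter_upwards [c2.coeFn_toLp] with t ht
        rw [ht, Complex.conj_conj]
    _ = _ := h.symm
    _ = _ := by
        refine integral_congr_ae ?_
        filter_upwards [cosineTransform_toLp c1 c2] with t ht
        rw [ht, cosInt_conj, Complex.conj_conj]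

/-! ### The Gaussian transform: functional equation and injectivity. -/

/-- The Gaussian `t ↦ exp (-π t² x²)`. -/
noncomputable def gauss (x t : ℝ) : ℝ := Real.exp (-Real.pi * t ^ 2 * x ^ 2)

theorem gauss_pos (x t : ℝ) : 0 < gauss x t := Real.exp_pos _

theorem gauss_le_one (x t : ℝ) : gauss x t ≤ 1 := by
  rw [gauss, Real.exp_le_one_iff]
  have := Real.pi_pos
  have : 0 ≤ Real.pi * t ^ 2 * x ^ 2 := by positivity
  linarith

theorem gauss_comm (x t : ℝ) : gauss x t = gauss t x := by
  simp only [gauss]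
  ring_nf

theorem continuous_gauss (x : ℝ) : Continuous (gauss x) := by
  unfold gauss
  fun_prop

theorem gauss_mul (x c t : ℝ) : gauss x (c * t) = gauss (x * c) t := by
  simp only [gauss]
  ring_nf

theorem integrable_gauss {x : ℝ} (hx : 0 < x) : Integrable (gauss x) := by
  have := integrable_exp_neg_mul_sq (b := Real.pi * x ^ 2) (by positivity)
  refine this.congr (ae_of_all _ fun t => ?_)
  simp only [gauss]
  ring_nf

theorem integrable_gauss_ofReal {x : ℝ} (hx : 0 < x) :
    Integrable (fun t => (gauss x t : ℂ)) halfLine :=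
  (integrable_gauss hx).ofReal.integrableOn

theorem gauss_sq (x t : ℝ) : gauss x t ^ 2 = gauss (Real.sqrt 2 * x) t := by
  rw [gauss, gauss, ← Real.exp_nat_mul, mul_pow, Real.sq_sqrt (by norm_num)]
  push_cast
  ring_nf

theorem memLp_gauss {x : ℝ} (hx : 0 < x) : MemLp (fun t => (gauss x t : ℂ)) 2 halfLine := by
  rw [memLp_two_iff_integrable_sq_norm (integrable_gauss_ofReal hx).1]
  simp only [Complex.norm_real, Real.norm_eq_abs, sq_abs, gauss_sq]
  exact (integrable_gauss (by positivity)).integrableOn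

theorem integrable_mul_gauss (f : K) {x : ℝ} (hx : 0 < x) :
    Integrable (fun t => f t * gauss x t) halfLine :=
  (Lp.memLp f).integrable_mul (memLp_gauss hx)

theorem integral_cos_mul_gauss {x : ℝ} (hx : 0 < x) (t : ℝ) :
    ∫ u in Ioi (0 : ℝ), (Real.cos (2 * Real.pi * t * u) : ℂ) * gauss x u
      = (2 * (x : ℂ))⁻¹ * gauss x⁻¹ t := by
  have hi : Integrable (fun u : ℝ => ((fun v => (gauss x v : ℂ)) |u|)) := by
    have := (integrable_gauss hx).ofReal (𝕜 := ℂ)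
    refine this.congr (ae_of_all _ fun u => ?_)
    simp only [gauss, sq_abs]
    rfl
  have h := fourier_comp_abs (integrable_gauss_ofReal hx).1 hi t
  have h2 := congrFun (fourier_gaussian_pi (b := (x : ℂ) ^ 2)
    (by exact_mod_cast sq_pos_of_pos hx)) t
  have e : (fun u : ℝ => ((fun v => (gauss x v : ℂ)) |u|))
      = fun u : ℝ => cexp (-Real.pi * (x : ℂ) ^ 2 * u ^ 2) := by
    ext u
    simp only [gauss, sq_abs]
    push_cast
    ring_nf
  rw [e, h2, cosInt] at h
  have h3 : ((x : ℂ) ^ 2) ^ (1 / 2 : ℂ) = x := by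
    have : ((x ^ 2 : ℝ) : ℂ) ^ ((1 / 2 : ℝ) : ℂ) = ((x ^ 2) ^ (1 / 2 : ℝ) : ℝ) :=
      (Complex.ofReal_cpow (by positivity) _).symm
    rw [← Real.sqrt_eq_rpow, Real.sqrt_sq hx.le] at this
    push_cast at this
    exact this
  rw [h3] at h
  have hx' : (x : ℂ) ≠ 0 := by exact_mod_cast hx.ne'
  have e4 : (gauss x⁻¹ t : ℂ) = cexp (-Real.pi / (x : ℂ) ^ 2 * t ^ 2) := by
    simp only [gauss]
    push_cast
    congr 1
    field_simp
  rw [e4]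
  apply mul_left_cancel₀ (two_ne_zero (α := ℂ))
  rw [← h]
  field_simp

theorem cosInt_gauss {x : ℝ} (hx : 0 < x) (t : ℝ) :
    cosInt (fun u => (gauss x u : ℂ)) t = (x : ℂ)⁻¹ * gauss x⁻¹ t := by
  rw [cosInt, integral_cos_mul_gauss hx]
  have hx' : (x : ℂ) ≠ 0 := by exact_mod_cast hx.ne'
  field_simp

/-- The Gaussian transform `x ↦ ∫₀^∞ f(t) exp (-π t² x²) dt`. -/
noncomputable def gaussTransform (f : ℝ → ℂ) (x : ℝ) : ℂ := ∫ t in Ioi (0 : ℝ), f t * gauss x t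

theorem gaussTransform_congr {f g : ℝ → ℂ} (h : f =ᵐ[halfLine] g) (x : ℝ) :
    gaussTransform f x = gaussTransform g x := by
  refine integral_congr_ae ?_
  filter_upwards [h] with t ht
  rw [ht]

/-- Parseval's formula against the Gaussian of parameter `x⁻¹`, whose cosine transform is `x` times
that of parameter `x`. This is the source of the symmetry `s ↦ 1 - s`. -/
theorem gaussTransform_cosineTransform (f : K) {x : ℝ} (hx : 0 < x) :
    gaussTransform (cosineTransform f) x = (x : ℂ)⁻¹ * gaussTransform f x⁻¹ := by
  have h := integral_mul_eq_integral_cosineTransform_mul f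
    (integrable_gauss_ofReal (inv_pos.2 hx)) (memLp_gauss (inv_pos.2 hx))
  have hx' : (x : ℂ) ≠ 0 := by exact_mod_cast hx.ne'
  rw [gaussTransform, gaussTransform, h, ← integral_const_mul]
  congr 1
  ext t
  rw [cosInt_gauss (inv_pos.2 hx)]
  push_cast
  rw [inv_inv, inv_inv]
  field_simp

/-- In the variable `v = e^{-πt²} ∈ (0, 1)` the values at `x = √(n+1)` are the moments `∫ F vⁿ` of
`F = f v`. By Weierstrass approximation on `[0, 1]`, `F` then integrates to zero against every test
function. -/
theorem ae_eq_zero_of_gaussTransform_eq_zero {f : ℝ → ℂ}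
    (hf : Integrable (fun t => f t * gauss 1 t) halfLine)
    (h : ∀ x, 0 < x → gaussTransform f x = 0) : f =ᵐ[halfLine] 0 := by
  set F : ℝ → ℂ := fun t => f t * gauss 1 t with hF
  have hpow : ∀ n : ℕ, ∫ t in Ioi (0 : ℝ), F t * ((gauss 1 t) ^ n : ℝ) = 0 := by
    intro n
    rw [← h (Real.sqrt (n + 1)) (by positivity), gaussTransform]
    congr 1
    ext t
    rw [hF]
    simp only
    rw [mul_assoc, ← Complex.ofReal_mul, ← pow_succ', gauss, gauss, ← Real.exp_nat_mul,
      Real.sq_sqrt (by positivity)]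
    push_cast
    ring_nf
  have hbint : ∀ c : ℝ → ℝ, Continuous c → (∃ C, ∀ t, |c t| ≤ C) →
      Integrable (fun t => F t * (c t : ℝ)) halfLine := by
    rintro c hc ⟨C, hC⟩
    refine hf.mul_bdd (c := C) (by fun_prop) (ae_of_all _ fun t => ?_)
    simpa using hC t
  have hpbd : ∀ p : Polynomial ℝ, Integrable (fun t => F t * (p.eval (gauss 1 t) : ℝ)) halfLine := by
    intro p
    refine hbint _ (p.continuous.comp (continuous_gauss 1)) ?_
    obtain ⟨C, hC⟩ := (isCompact_Icc (a := (0 : ℝ)) (b := 1)).exists_bound_of_continuousOn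
      p.continuous.continuousOn
    exact ⟨C, fun t => hC _ ⟨(gauss_pos _ _).le, gauss_le_one _ _⟩⟩
  have hpoly : ∀ p : Polynomial ℝ, ∫ t in Ioi (0 : ℝ), F t * (p.eval (gauss 1 t) : ℝ) = 0 := by
    intro p
    induction p using Polynomial.induction_on' with
    | add p q hp hq =>
      simp only [Polynomial.eval_add, Complex.ofReal_add, mul_add]
      rw [integral_add (hpbd p) (hpbd q), hp, hq, add_zero]
    | monomial n a =>
      simp only [Polynomial.eval_monomial, Complex.ofReal_mul]
      have : ∀ t, F t * ((a : ℂ) * ((gauss 1 t ^ n : ℝ) : ℂ))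
          = a * (F t * ((gauss 1 t ^ n : ℝ) : ℂ)) := fun t => by ring
      simp only [this]
      rw [integral_const_mul, hpow n, mul_zero]
  have key : ∀ᵐ t, t ∈ Ioi (0 : ℝ) → F t = 0 := by
    refine IsOpen.ae_eq_zero_of_integral_contDiff_smul_eq_zero isOpen_Ioi
      (IntegrableOn.locallyIntegrableOn hf) ?_
    intro g hg hgc hgs
    have hgcont : Continuous g := hg.continuous
    have hzero : ∀ t, t ∉ Ioi (0 : ℝ) → g t = 0 := fun t ht =>
      image_eq_zero_of_notMem_tsupport fun h' => ht (hgs h')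
    have e0 : ∫ t, g t • F t = ∫ t in Ioi (0 : ℝ), F t * (g t : ℝ) := by
      rw [← setIntegral_eq_integral_of_forall_compl_eq_zero (s := Ioi (0 : ℝ))]
      · congr 1
        ext t
        rw [Complex.real_smul, mul_comm]
      · intro t ht
        rw [hzero t ht, zero_smul]
    rw [e0]
    obtain ⟨R, hR⟩ := hgc.isBounded.exists_norm_le
    have hR' : ∀ t, R < |t| → g t = 0 := fun t ht =>
      image_eq_zero_of_notMem_tsupport fun h' => absurd (hR t h') (not_le.2 ht)
    -- The test function `g` rewritten in the variable `v`.
    set r : ℝ → ℝ := fun v => g (Real.sqrt (-Real.log v / Real.pi)) with hr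
    have hrg : ∀ t, 0 < t → r (gauss 1 t) = g t := by
      intro t ht
      simp only [hr, gauss, Real.log_exp]
      congr 1
      rw [show -(-Real.pi * t ^ 2 * 1 ^ 2) / Real.pi = t ^ 2 by field_simp]
      exact Real.sqrt_sq ht.le
    have hrc : ContinuousOn r (Icc 0 1) := by
      intro v hv
      rcases eq_or_lt_of_le hv.1 with h0 | h0
      · have hlim : ∀ᶠ u in 𝓝[Icc 0 1] v, r u = r v := by
          rw [← h0]
          -- Here `Real.log 0 = 0` makes `r 0` equal to `g 0`, which vanishes because `g` is
          -- supported in `(0, ∞)`. The limit `v → 0` corresponds to `t → ∞`, where `g` vanishes by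
          -- compactness of its support.
          have hr0 : r 0 = 0 := by
            simp only [hr, Real.log_zero, neg_zero, zero_div, Real.sqrt_zero]
            exact hzero 0 (by simp)
          have : Iio (Real.exp (-Real.pi * (|R| + 1) ^ 2)) ∈ 𝓝[Icc 0 1] (0 : ℝ) :=
            mem_nhdsWithin_of_mem_nhds (Iio_mem_nhds (Real.exp_pos _))
          filter_upwards [this, self_mem_nhdsWithin] with u hu hu'
          rcases eq_or_lt_of_le hu'.1 with h1 | h1
          · rw [h1]
          rw [hr0]
          refine hR' _ ?_
          have hlog : Real.log u < -Real.pi * (|R| + 1) ^ 2 := (Real.log_lt_iff_lt_exp h1).2 hu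
          have : (|R| + 1) ^ 2 < -Real.log u / Real.pi := by
            rw [lt_div_iff₀ Real.pi_pos]
            linarith
          rw [abs_of_nonneg (Real.sqrt_nonneg _)]
          calc R ≤ |R| := le_abs_self R
            _ < |R| + 1 := by linarith
            _ = Real.sqrt ((|R| + 1) ^ 2) := (Real.sqrt_sq (by positivity)).symm
            _ ≤ _ := Real.sqrt_le_sqrt this.le
        exact ContinuousWithinAt.congr_of_eventuallyEq continuousWithinAt_const hlim rfl
      · refine ContinuousAt.continuousWithinAt ?_
        refine hgcont.continuousAt.comp (Real.continuous_sqrt.continuousAt.comp ?_)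
        exact ((Real.continuousAt_log h0.ne').neg).div_const _
    obtain ⟨Cg, hCg⟩ := hgcont.bounded_above_of_compact_support hgc
    by_contra hne
    set N := ∫ t in Ioi (0 : ℝ), ‖F t‖ with hN
    have hN0 : 0 ≤ N := integral_nonneg fun t => norm_nonneg _
    have hpos : 0 < ‖∫ t in Ioi (0 : ℝ), F t * (g t : ℝ)‖ := norm_pos_iff.2 hne
    -- The tolerance has `N + 1` instead of `N` so that it makes sense when `N = 0`.
    obtain ⟨p, hp⟩ := exists_polynomial_near_of_continuousOn 0 1 r hrc
      (‖∫ t in Ioi (0 : ℝ), F t * (g t : ℝ)‖ / (N + 1)) (by positivity)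
    have hgi : Integrable (fun t => F t * (g t : ℝ)) halfLine := hbint g hgcont ⟨Cg, hCg⟩
    have e1 : ∫ t in Ioi (0 : ℝ), F t * (g t : ℝ)
        = ∫ t in Ioi (0 : ℝ), (F t * (g t : ℝ) - F t * (p.eval (gauss 1 t) : ℝ)) := by
      rw [integral_sub hgi (hpbd p), hpoly p, sub_zero]
    have e2 : ‖∫ t in Ioi (0 : ℝ), F t * (g t : ℝ)‖
        ≤ ∫ t in Ioi (0 : ℝ), ‖∫ t in Ioi (0 : ℝ), F t * (g t : ℝ)‖ / (N + 1) * ‖F t‖ := by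
      nth_rewrite 1 [e1]
      refine norm_integral_le_of_norm_le (hf.norm.const_mul _) ?_
      filter_upwards [ae_restrict_mem measurableSet_Ioi] with t ht
      rw [← mul_sub, norm_mul, mul_comm, ← Complex.ofReal_sub, Complex.norm_real, ← hrg t ht]
      gcongr
      rw [Real.norm_eq_abs, abs_sub_comm]
      exact (hp _ ⟨(gauss_pos _ _).le, gauss_le_one _ _⟩).le
    rw [integral_const_mul, ← hN] at e2
    have : ‖∫ t in Ioi (0 : ℝ), F t * (g t : ℝ)‖ / (N + 1) * N
        < ‖∫ t in Ioi (0 : ℝ), F t * (g t : ℝ)‖ := by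
      rw [div_mul_eq_mul_div, div_lt_iff₀ (by positivity)]
      nlinarith
    linarith
  filter_upwards [(ae_restrict_iff' measurableSet_Ioi).2 key] with t ht
  have : (gauss 1 t : ℂ) ≠ 0 := by exact_mod_cast (gauss_pos 1 t).ne'
  exact (mul_eq_zero.1 ht).resolve_right this

/-! ### Cauchy–Schwarz bounds and Gaussian tails. -/

theorem norm_sq_eq_integral (f : K) : ‖f‖ ^ 2 = ∫ t in Ioi (0 : ℝ), ‖f t‖ ^ 2 := by
  have h := inner_eq_integral f f
  rw [inner_self_eq_norm_sq_to_K] at h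
  have e : ∀ t, f t * (starRingEnd ℂ) (f t) = ((‖f t‖ ^ 2 : ℝ) : ℂ) := fun t => by
    rw [Complex.mul_conj, Complex.normSq_eq_norm_sq]
  simp only [e] at h
  have h2 := h.trans (integral_ofReal (𝕜 := ℂ) (f := fun t => ‖f t‖ ^ 2) (μ := halfLine))
  exact_mod_cast h2

theorem integral_norm_mul_norm_le (f : K) {ψ : ℝ → ℂ} (h : MemLp ψ 2 halfLine) :
    ∫ t in Ioi (0 : ℝ), ‖f t‖ * ‖ψ t‖ ≤ ‖f‖ * Real.sqrt (∫ t in Ioi (0 : ℝ), ‖ψ t‖ ^ 2) := by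
  have hf : MemLp f (ENNReal.ofReal 2) halfLine := by simpa using Lp.memLp f
  have hψ : MemLp ψ (ENNReal.ofReal 2) halfLine := by simpa using h
  have := integral_mul_norm_le_Lp_mul_Lq (p := 2) (q := 2)
    (Real.holderConjugate_iff.2 ⟨by norm_num, by norm_num⟩) hf hψ
  simp only [Real.rpow_two, ← Real.sqrt_eq_rpow] at this
  rwa [← norm_sq_eq_integral, Real.sqrt_sq (norm_nonneg _)] at this

theorem norm_setIntegral_mul_le (f : K) {ψ : ℝ → ℂ} {s : Set ℝ} (hs : MeasurableSet s)
    (hs0 : s ⊆ Ioi 0) (h : MemLp ψ 2 (volume.restrict s)) :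
    ∫ t in s, ‖f t‖ * ‖ψ t‖ ≤ ‖f‖ * Real.sqrt (∫ t in s, ‖ψ t‖ ^ 2) := by
  have e : (volume.restrict s) = halfLine.restrict s := by
    rw [Measure.restrict_restrict hs, inter_eq_left.2 hs0]
  have h' : MemLp (s.indicator ψ) 2 halfLine := by
    rw [memLp_indicator_iff_restrict hs, ← e]
    exact h
  have := integral_norm_mul_norm_le f h'
  have e1 : ∀ t, ‖f t‖ * ‖s.indicator ψ t‖ = s.indicator (fun t => ‖f t‖ * ‖ψ t‖) t := fun t => by
    by_cases ht : t ∈ s <;> simp [ht]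
  have e2 : ∀ t, ‖s.indicator ψ t‖ ^ 2 = s.indicator (fun t => ‖ψ t‖ ^ 2) t := fun t => by
    by_cases ht : t ∈ s <;> simp [ht]
  simp only [e1, e2] at this
  rwa [integral_indicator hs, integral_indicator hs, ← e] at this

theorem integrableOn_mul_of_memLp (f : K) {ψ : ℝ → ℂ} {s : Set ℝ}
    (hs0 : s ⊆ Ioi 0) (h : MemLp ψ 2 (volume.restrict s)) :
    IntegrableOn (fun t => f t * ψ t) s :=
  ((Lp.memLp f).mono_measure (Measure.restrict_mono hs0 le_rfl)).integrable_mul h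

theorem norm_setIntegral_le (f : K) {ψ : ℝ → ℂ} {s : Set ℝ} (hs : MeasurableSet s)
    (hs0 : s ⊆ Ioi 0) (h : MemLp ψ 2 (volume.restrict s)) :
    ‖∫ t in s, f t * ψ t‖ ≤ ‖f‖ * Real.sqrt (∫ t in s, ‖ψ t‖ ^ 2) := by
  refine (norm_integral_le_integral_norm _).trans ?_
  simp only [norm_mul]
  exact norm_setIntegral_mul_le f hs hs0 h

/-- For `t ≥ b ≥ 0` one has `t² ≥ b² + (t - b)²`, so `e^{-2πb²x²}` factors out and leaves at most a
full Gaussian integral, equal to `1/(√2 x)`. -/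
theorem integral_gauss_sq_Ioi_le {x b : ℝ} (hx : 0 < x) (hb : 0 ≤ b) :
    ∫ t in Ioi b, gauss x t ^ 2 ≤ gauss x b ^ 2 / x := by
  have hx2 : 0 < Real.sqrt 2 * x := by positivity
  have hi : Integrable (fun t => gauss x b ^ 2 * gauss (Real.sqrt 2 * x) (t - b)) :=
    ((integrable_gauss hx2).comp_sub_right b).const_mul _
  have hi2 : Integrable (fun t => gauss x t ^ 2) := by
    simp only [gauss_sq]
    exact integrable_gauss hx2
  calc ∫ t in Ioi b, gauss x t ^ 2
      ≤ ∫ t in Ioi b, gauss x b ^ 2 * gauss (Real.sqrt 2 * x) (t - b) := by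
        refine setIntegral_mono_on hi2.integrableOn hi.integrableOn measurableSet_Ioi ?_
        intro t ht
        have ht : b < t := ht
        rw [gauss_sq, gauss_sq, gauss, gauss, gauss, ← Real.exp_add, Real.exp_le_exp]
        have : 0 ≤ Real.pi * (Real.sqrt 2 * x) ^ 2 * (2 * b * (t - b)) := by
          have := Real.pi_pos
          have : 0 ≤ t - b := by linarith
          positivity
        nlinarith
    _ ≤ ∫ t, gauss x b ^ 2 * gauss (Real.sqrt 2 * x) (t - b) := by
        refine setIntegral_le_integral hi (ae_of_all _ fun t => ?_)
        exact mul_nonneg (by positivity) (gauss_pos _ _).le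
    _ = gauss x b ^ 2 * ∫ t, gauss (Real.sqrt 2 * x) t := by
        rw [integral_const_mul, integral_sub_right_eq_self]
    _ ≤ gauss x b ^ 2 * (1 / x) := by
        gcongr
        have : ∀ t, gauss (Real.sqrt 2 * x) t = Real.exp (-(2 * Real.pi * x ^ 2) * t ^ 2) := by
          intro t
          rw [gauss, mul_pow, Real.sq_sqrt (by norm_num)]
          ring_nf
        simp only [this]
        rw [integral_gaussian]
        rw [Real.sqrt_le_left (by positivity)]
        have := Real.pi_pos
        rw [div_pow, one_pow, div_le_div_iff₀ (by positivity) (by positivity)]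
        nlinarith [mul_pos this (pow_pos hx 2)]
    _ = _ := by ring

theorem memLp_gauss_Ioi {x b : ℝ} (hx : 0 < x) (hb : 0 ≤ b) :
    MemLp (fun t => (gauss x t : ℂ)) 2 (volume.restrict (Ioi b)) :=
  (memLp_gauss hx).mono_measure (Measure.restrict_mono (Ioi_subset_Ioi hb) le_rfl)

theorem sqrt_integral_gauss_le {x b : ℝ} (hx : 0 < x) (hb : 0 ≤ b) :
    Real.sqrt (∫ t in Ioi b, ‖(gauss x t : ℂ)‖ ^ 2) ≤ gauss x b / Real.sqrt x := by
  simp only [Complex.norm_real, Real.norm_eq_abs, sq_abs]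
  rw [Real.sqrt_le_left (div_nonneg (gauss_pos _ _).le (Real.sqrt_nonneg _)), div_pow,
    Real.sq_sqrt hx.le]
  exact integral_gauss_sq_Ioi_le hx hb

theorem norm_integral_Ioi_mul_gauss_le (f : K) {x b : ℝ} (hx : 0 < x) (hb : 0 ≤ b) :
    ‖∫ t in Ioi b, f t * gauss x t‖ ≤ ‖f‖ * (gauss x b / Real.sqrt x) :=
  (norm_setIntegral_le f measurableSet_Ioi (Ioi_subset_Ioi hb) (memLp_gauss_Ioi hx hb)).trans
    (mul_le_mul_of_nonneg_left (sqrt_integral_gauss_le hx hb) (norm_nonneg _))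

theorem ae_eq_zero_of_mem_vanishing {a : ℝ} {f : K} (h : f ∈ vanishing a) :
    ∀ᵐ t ∂halfLine, t < a → f t = 0 := h

theorem setIntegral_Ioi_eq_of_mem_vanishing {a : ℝ} (ha : 0 ≤ a) {f : K} (h : f ∈ vanishing a)
    (ψ : ℝ → ℂ) : ∫ t in Ioi (0 : ℝ), f t * ψ t = ∫ t in Ioi a, f t * ψ t := by
  have hsub : Ioi a ⊆ Ioi (0 : ℝ) := Ioi_subset_Ioi ha
  refine setIntegral_eq_of_subset_of_ae_sdiff_eq_zero measurableSet_Ioi.nullMeasurableSet hsub ?_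
  have h1 := (ae_restrict_iff' measurableSet_Ioi).1 (ae_eq_zero_of_mem_vanishing h)
  have h2 : ∀ᵐ t : ℝ, t ≠ a := by
    rw [ae_iff]
    simp
  filter_upwards [h1, h2] with t h1 h2 ht
  have h3 : t ≤ a := not_lt.1 ht.2
  rw [h1 ht.1 (lt_of_le_of_ne h3 h2), zero_mul]

/-- The easy half of the correspondence between vanishing near the origin and Gaussian decay; the
converse is `mem_vanishing_of_gaussTransform_le`. -/
theorem norm_gaussTransform_le {a : ℝ} (ha : 0 ≤ a) {f : K} (h : f ∈ vanishing a) {x : ℝ}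
    (hx : 0 < x) : ‖gaussTransform f x‖ ≤ ‖f‖ * (gauss x a / Real.sqrt x) := by
  rw [gaussTransform, setIntegral_Ioi_eq_of_mem_vanishing ha h]
  exact norm_integral_Ioi_mul_gauss_le f hx ha

theorem eq_of_gaussTransform_eq {f g : K}
    (h : ∀ x, 0 < x → gaussTransform f x = gaussTransform g x) : f = g := by
  have h0 : (fun t => f t - g t) =ᵐ[halfLine] 0 := by
    refine ae_eq_zero_of_gaussTransform_eq_zero ?_ ?_
    · simp only [sub_mul]
      exact (integrable_mul_gauss f one_pos).sub (integrable_mul_gauss g one_pos)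
    · intro x hx
      simp only [gaussTransform, sub_mul]
      rw [integral_sub (integrable_mul_gauss f hx) (integrable_mul_gauss g hx)]
      exact sub_eq_zero.2 (h x hx)
  refine Lp.ext ?_
  filter_upwards [h0] with t ht
  exact sub_eq_zero.1 ht

theorem gaussTransform_add (f g : K) {x : ℝ} (hx : 0 < x) :
    gaussTransform (f + g : K) x = gaussTransform f x + gaussTransform g x := by
  rw [gaussTransform_congr (Lp.coeFn_add f g)]
  simp only [gaussTransform, Pi.add_apply, add_mul]
  exact integral_add (integrable_mul_gauss f hx) (integrable_mul_gauss g hx)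

theorem gaussTransform_smul (c : ℂ) (f : K) (x : ℝ) :
    gaussTransform (c • f : K) x = c * gaussTransform f x := by
  rw [gaussTransform_congr (Lp.coeFn_smul c f)]
  simp only [gaussTransform, Pi.smul_apply, smul_eq_mul, mul_assoc]
  exact integral_const_mul _ _

theorem gaussTransform_star (f : K) (x : ℝ) :
    gaussTransform (star f : K) x = (starRingEnd ℂ) (gaussTransform f x) := by
  rw [gaussTransform_congr (Lp.coeFn_star f)]
  simp only [gaussTransform]
  rw [← integral_conj]
  simp

/-! ### Involution, conjugation and dilations on Sonine spaces. -/

/-- Seen through the injective Gaussian transform, the cosine transform is `G(x) ↦ x⁻¹ G(x⁻¹)`, an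
involution. Its behaviour under conjugation and dilation is obtained in the same way. -/
theorem cosineTransform_cosineTransform (f : K) : cosineTransform (cosineTransform f) = f := by
  refine eq_of_gaussTransform_eq fun x hx => ?_
  have hx' : (x : ℂ) ≠ 0 := by exact_mod_cast hx.ne'
  rw [gaussTransform_cosineTransform _ hx, gaussTransform_cosineTransform _ (inv_pos.2 hx), inv_inv]
  push_cast
  field_simp

theorem cosineTransform_star (f : K) : cosineTransform (star f) = star (cosineTransform f) := by
  refine eq_of_gaussTransform_eq fun x hx => ?_
  rw [gaussTransform_cosineTransform _ hx, gaussTransform_star, gaussTransform_star,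
    gaussTransform_cosineTransform _ hx]
  simp

theorem map_mul_left_halfLine {c : ℝ} (hc : 0 < c) :
    Measure.map (fun t => c * t) halfLine = ENNReal.ofReal c⁻¹ • halfLine := by
  have h : halfLine = volume.restrict ((fun t => c * t) ⁻¹' Ioi (0 : ℝ)) := by
    ext t
    simp [hc]
  rw [h, ← Measure.restrict_map (measurable_const_mul c) measurableSet_Ioi,
    Real.map_volume_mul_left hc.ne', Measure.restrict_smul, abs_of_pos (inv_pos.2 hc), ← h]

theorem quasiMeasurePreserving_mul_left {c : ℝ} (hc : 0 < c) :
    Measure.QuasiMeasurePreserving (fun t => c * t) halfLine halfLine :=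
  ⟨measurable_const_mul c, by
    rw [map_mul_left_halfLine hc]
    exact Measure.smul_absolutelyContinuous⟩

theorem memLp_comp_mul_left {c : ℝ} (hc : 0 < c) (f : K) :
    MemLp (fun t => f (c * t)) 2 halfLine := by
  have h : MemLp f 2 (Measure.map (fun t => c * t) halfLine) := by
    rw [map_mul_left_halfLine hc]
    exact (Lp.memLp f).smul_measure (by simp)
  exact h.comp_of_map (measurable_const_mul c).aemeasurable

/-- The dilation `t ↦ f (c t)`. -/
noncomputable def dilation {c : ℝ} (hc : 0 < c) (f : K) : K := (memLp_comp_mul_left hc f).toLp _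

theorem dilation_coe {c : ℝ} (hc : 0 < c) (f : K) :
    dilation hc f =ᵐ[halfLine] fun t => f (c * t) := MemLp.coeFn_toLp _

theorem gaussTransform_dilation {c : ℝ} (hc : 0 < c) (f : K) (x : ℝ) :
    gaussTransform (dilation hc f) x = (c : ℂ)⁻¹ * gaussTransform f (x * c⁻¹) := by
  rw [gaussTransform_congr (dilation_coe hc f)]
  have h := integral_comp_mul_left_Ioi (fun t => f t * gauss (x * c⁻¹) t) 0 hc
  rw [mul_zero] at h
  rw [gaussTransform, gaussTransform]
  have e : ∀ t, (f (c * t) * gauss (x * c⁻¹) (c * t) : ℂ) = f (c * t) * gauss x t := by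
    intro t
    rw [gauss_mul, inv_mul_cancel_right₀ hc.ne']
  simp only [e] at h
  rw [h, Complex.real_smul, Complex.ofReal_inv]

theorem cosineTransform_dilation {c : ℝ} (hc : 0 < c) (f : K) :
    cosineTransform (dilation hc f) = (c : ℂ)⁻¹ • dilation (inv_pos.2 hc) (cosineTransform f) := by
  refine eq_of_gaussTransform_eq fun x hx => ?_
  have hx' : (x : ℂ) ≠ 0 := by exact_mod_cast hx.ne'
  have hc' : (c : ℂ) ≠ 0 := by exact_mod_cast hc.ne'
  rw [gaussTransform_cosineTransform _ hx, gaussTransform_dilation, gaussTransform_smul,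
    gaussTransform_dilation, gaussTransform_cosineTransform _ (by positivity)]
  rw [inv_inv, mul_inv]
  push_cast
  field_simp

theorem dilation_mem_vanishing {c a : ℝ} (hc : 0 < c) {f : K} (h : f ∈ vanishing a) :
    dilation hc f ∈ vanishing (a / c) := by
  have h2 := (quasiMeasurePreserving_mul_left hc).ae (ae_eq_zero_of_mem_vanishing h)
  change ∀ᵐ t ∂halfLine, t < a / c → dilation hc f t = 0
  filter_upwards [h2, dilation_coe hc f] with t h2 h3 ht
  rw [h3, h2]
  rw [lt_div_iff₀ hc] at ht
  linarith

theorem vanishing_anti {a b : ℝ} (h : b ≤ a) : vanishing a ≤ vanishing b := by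
  intro f hf
  have hf := ae_eq_zero_of_mem_vanishing hf
  change ∀ᵐ t ∂halfLine, t < b → f t = 0
  filter_upwards [hf] with t ht hb
  exact ht (hb.trans_le h)

theorem star_mem_vanishing {a : ℝ} {f : K} (h : f ∈ vanishing a) : star f ∈ vanishing a := by
  have hf := ae_eq_zero_of_mem_vanishing h
  change ∀ᵐ t ∂halfLine, t < a → (star f : K) t = 0
  filter_upwards [hf, Lp.coeFn_star f] with t ht hs hta
  rw [hs, Pi.star_apply, ht hta, star_zero]

theorem mem_sonineSpace_iff {a : ℝ} {f : K} :
    f ∈ sonineSpace a ↔ f ∈ vanishing a ∧ cosineTransform f ∈ vanishing a := Iff.rfl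

theorem cosineTransform_mem_sonineSpace {a : ℝ} {f : K} (h : f ∈ sonineSpace a) :
    cosineTransform f ∈ sonineSpace a :=
  mem_sonineSpace_iff.2 ⟨h.2, by rw [cosineTransform_cosineTransform]; exact h.1⟩

theorem star_mem_sonineSpace {a : ℝ} {f : K} (h : f ∈ sonineSpace a) : star f ∈ sonineSpace a :=
  mem_sonineSpace_iff.2
    ⟨star_mem_vanishing h.1, by rw [cosineTransform_star]; exact star_mem_vanishing h.2⟩

theorem sonineSpace_anti {a b : ℝ} (h : b ≤ a) : sonineSpace a ≤ sonineSpace b :=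
  fun _ hf => ⟨vanishing_anti h hf.1, vanishing_anti h hf.2⟩

/-- The dilation shrinks the gap of `f` to `(0, a/c)` but widens that of its cosine transform to
`(0, ac)`, and `ac ≥ a/c`. -/
theorem dilation_mem_sonineSpace {c a : ℝ} (hc : 1 < c) (ha : 0 < a) {f : K}
    (h : f ∈ sonineSpace a) : dilation (one_pos.trans hc) f ∈ sonineSpace (a / c) := by
  have hc0 := one_pos.trans hc
  refine mem_sonineSpace_iff.2 ⟨dilation_mem_vanishing hc0 h.1, ?_⟩
  rw [cosineTransform_dilation]
  refine Submodule.smul_mem _ _ (vanishing_anti ?_ (dilation_mem_vanishing (inv_pos.2 hc0) h.2))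
  rw [div_inv_eq_mul, div_le_iff₀ hc0]
  nlinarith [mul_pos ha hc0]

/-! ### Gaussian decay forces vanishing near the origin. -/

theorem integrableOn_Ioc (f : K) {b c : ℝ} (hb : 0 ≤ b) : IntegrableOn f (Ioc b c) := by
  have hs : Ioc b c ⊆ Ioi (0 : ℝ) := fun t ht => hb.trans_lt ht.1
  have h := (Lp.memLp f).mono_measure (Measure.restrict_mono hs (le_refl volume))
  exact h.integrable (by norm_num)

/-- The entire function `z ↦ ∫₀ᵇ f(t) exp (π (b² - t²) z) dt`. -/
noncomputable def truncLaplace (b : ℝ) (f : ℝ → ℂ) (z : ℂ) : ℂ :=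
  ∫ t in Ioc 0 b, f t * cexp (((Real.pi * (b ^ 2 - t ^ 2) : ℝ) : ℂ) * z)

theorem differentiable_truncLaplace {b : ℝ} {f : ℝ → ℂ} (hf : IntegrableOn f (Ioc 0 b)) :
    Differentiable ℂ (truncLaplace b f) := by
  intro z
  set B : ℝ := Real.pi * b ^ 2 with hB
  have hc : ∀ t ∈ Ioc 0 b, |Real.pi * (b ^ 2 - t ^ 2)| ≤ B := by
    intro t ht
    have h1 : t ^ 2 ≤ b ^ 2 := pow_le_pow_left₀ ht.1.le ht.2 2
    have := Real.pi_pos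
    rw [abs_of_nonneg (by nlinarith [sq_nonneg t])]
    rw [hB]
    nlinarith [sq_nonneg t]
  have hm : ∀ w : ℂ, AEStronglyMeasurable
      (fun t : ℝ => cexp (((Real.pi * (b ^ 2 - t ^ 2) : ℝ) : ℂ) * w)) (volume.restrict (Ioc 0 b)) :=
    fun w => Continuous.aestronglyMeasurable (by fun_prop)
  have hbd : ∀ t ∈ Ioc 0 b, ∀ w ∈ Metric.ball z 1,
      ‖cexp (((Real.pi * (b ^ 2 - t ^ 2) : ℝ) : ℂ) * w)‖ ≤ Real.exp (B * (‖z‖ + 1)) := by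
    intro t ht w hw
    refine (Complex.norm_exp_le_exp_norm _).trans (Real.exp_le_exp.2 ?_)
    rw [norm_mul, Complex.norm_real, Real.norm_eq_abs]
    refine mul_le_mul (hc t ht) ?_ (norm_nonneg _) ((abs_nonneg _).trans (hc t ht))
    have : ‖w - z‖ < 1 := by simpa [dist_eq_norm] using hw
    have := norm_sub_norm_le w z
    linarith
  have h := hasDerivAt_integral_of_dominated_loc_of_deriv_le (𝕜 := ℂ)
    (μ := volume.restrict (Ioc 0 b)) (x₀ := z) (s := Metric.ball z 1)
    (F := fun w t => f t * cexp (((Real.pi * (b ^ 2 - t ^ 2) : ℝ) : ℂ) * w))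
    (F' := fun w t => f t * (cexp (((Real.pi * (b ^ 2 - t ^ 2) : ℝ) : ℂ) * w)
      * ((Real.pi * (b ^ 2 - t ^ 2) : ℝ) : ℂ)))
    (bound := fun t => ‖f t‖ * (Real.exp (B * (‖z‖ + 1)) * B))
    (Metric.ball_mem_nhds z one_pos) ?_ ?_ ?_ ?_ ?_ ?_
  · exact h.2.differentiableAt
  · exact Eventually.of_forall fun w => hf.1.mul (hm w)
  · refine Integrable.mul_bdd (c := Real.exp (B * (‖z‖ + 1))) hf (hm z) ?_
    filter_upwards [ae_restrict_mem measurableSet_Ioc] with t ht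
    exact hbd t ht z (Metric.mem_ball_self one_pos)
  · exact hf.1.mul ((hm z).mul (Continuous.aestronglyMeasurable (by fun_prop)))
  · filter_upwards [ae_restrict_mem measurableSet_Ioc] with t ht w hw
    rw [norm_mul, norm_mul]
    refine mul_le_mul_of_nonneg_left (mul_le_mul (hbd t ht w hw) ?_ (norm_nonneg _)
      (Real.exp_pos _).le) (norm_nonneg _)
    rw [Complex.norm_real]
    exact hc t ht
  · exact hf.norm.mul_const _
  · filter_upwards with t w hw
    have h1 : HasDerivAt (fun w : ℂ => ((Real.pi * (b ^ 2 - t ^ 2) : ℝ) : ℂ) * w)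
        ((Real.pi * (b ^ 2 - t ^ 2) : ℝ) : ℂ) w := by
      simpa only [mul_one] using (hasDerivAt_id' w).const_mul ((Real.pi * (b ^ 2 - t ^ 2) : ℝ) : ℂ)
    exact h1.cexp.const_mul _

theorem norm_truncLaplace_le {b : ℝ} {f : ℝ → ℂ} (hf : IntegrableOn f (Ioc 0 b)) {z : ℂ} {r : ℝ}
    (h0 : 0 ≤ r) (hr : z.re ≤ r) :
    ‖truncLaplace b f z‖ ≤ (∫ t in Ioc 0 b, ‖f t‖) * Real.exp (Real.pi * b ^ 2 * r) := by
  rw [← integral_mul_const]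
  refine norm_integral_le_of_norm_le (hf.norm.mul_const _) ?_
  filter_upwards [ae_restrict_mem measurableSet_Ioc] with t ht
  rw [norm_mul]
  refine mul_le_mul_of_nonneg_left ?_ (norm_nonneg _)
  rw [Complex.norm_exp, Complex.re_ofReal_mul, Real.exp_le_exp]
  have h1 : t ^ 2 ≤ b ^ 2 := pow_le_pow_left₀ ht.1.le ht.2 2
  have h2 : 0 ≤ Real.pi * (b ^ 2 - t ^ 2) := mul_nonneg Real.pi_pos.le (by linarith)
  calc _ ≤ Real.pi * (b ^ 2 - t ^ 2) * r := mul_le_mul_of_nonneg_left hr h2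
    _ ≤ _ := by
      have : 0 ≤ Real.pi * t ^ 2 * r := by have := Real.pi_pos; positivity
      nlinarith

theorem truncLaplace_sq (b x : ℝ) (f : ℝ → ℂ) :
    truncLaplace b f ((x ^ 2 : ℝ) : ℂ) = ((gauss x b)⁻¹ : ℝ) * ∫ t in Ioc 0 b, f t * gauss x t := by
  rw [truncLaplace, ← integral_const_mul]
  congr 1
  ext t
  have : cexp (((Real.pi * (b ^ 2 - t ^ 2) : ℝ) : ℂ) * ((x ^ 2 : ℝ) : ℂ))
      = (((gauss x b)⁻¹ * gauss x t : ℝ) : ℂ) := by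
    rw [gauss, gauss, ← Real.exp_neg, ← Real.exp_add, ← Complex.ofReal_mul, ← Complex.ofReal_exp]
    congr 2
    ring
  rw [this]
  push_cast
  ring

/-- A square integrable function whose Gaussian transform decays like `exp (-π b² x²)` vanishes
on `(0, b)`. -/
theorem mem_vanishing_of_gaussTransform_le (f : K) {b C : ℝ} (hb : 0 < b)
    (h : ∀ x, 1 ≤ x → ‖gaussTransform f x‖ ≤ C * gauss x b) : f ∈ vanishing b := by
  have hf : IntegrableOn f (Ioc 0 b) := integrableOn_Ioc f le_rfl
  set A : ℝ := ∫ t in Ioc 0 b, ‖f t‖ with hA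
  -- The truncated Laplace integral is bounded for `Re z ≤ 0` since `b² - t² ≥ 0`. At `z = x²` it is
  -- `e^{πb²x²}` times the Gaussian transform minus its tail over `(b, ∞)`, and both of these are
  -- `O(e^{-πb²x²})`. Being of exponential type, it is bounded in the right half-plane by
  -- Phragmén–Lindelöf, hence constant by Liouville.
  have hdiff := differentiable_truncLaplace hf
  have hneg : ∀ z : ℂ, z.re ≤ 0 → ‖truncLaplace b f z‖ ≤ A := fun z hz => by
    simpa using norm_truncLaplace_le hf le_rfl hz
  have hreal : ∀ x : ℝ, 1 ≤ x → ‖truncLaplace b f x‖ ≤ C + ‖f‖ := by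
    intro y hy
    obtain ⟨x, hx1, rfl⟩ : ∃ x : ℝ, 1 ≤ x ∧ y = x ^ 2 :=
      ⟨Real.sqrt y, by rwa [Real.one_le_sqrt], (Real.sq_sqrt (by linarith)).symm⟩
    have hx : 0 < x := by linarith
    have hsplit : gaussTransform f x
        = (∫ t in Ioc 0 b, f t * gauss x t) + ∫ t in Ioi b, f t * gauss x t := by
      have hi := integrable_mul_gauss f hx
      rw [gaussTransform, ← Ioc_union_Ioi_eq_Ioi hb.le]
      refine setIntegral_union (Ioc_disjoint_Ioi le_rfl) measurableSet_Ioi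
        (IntegrableOn.mono_set hi Ioc_subset_Ioi_self)
        (IntegrableOn.mono_set hi (Ioi_subset_Ioi hb.le))
    have h1 := h x hx1
    have h2 := norm_integral_Ioi_mul_gauss_le f hx hb.le
    have h3 : gauss x b / Real.sqrt x ≤ gauss x b := by
      rw [div_le_iff₀ (Real.sqrt_pos.2 hx)]
      have : 1 ≤ Real.sqrt x := by rwa [Real.one_le_sqrt]
      nlinarith [gauss_pos x b]
    rw [truncLaplace_sq, norm_mul, Complex.norm_real, Real.norm_eq_abs,
      abs_of_pos (inv_pos.2 (gauss_pos _ _)), ← div_eq_inv_mul, div_le_iff₀ (gauss_pos _ _)]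
    rw [eq_sub_of_add_eq hsplit.symm]
    refine (norm_sub_le _ _).trans ?_
    nlinarith [norm_nonneg f, gauss_pos x b]
  have hpos : ∀ z : ℂ, 0 ≤ z.re → ‖truncLaplace b f z‖ ≤ A := by
    intro z hz
    refine PhragmenLindelof.right_half_plane_of_bounded_on_real hdiff.diffContOnCl ?_ ?_ ?_ hz
    · refine ⟨1, by norm_num, Real.pi * b ^ 2, Asymptotics.IsBigO.of_bound A ?_⟩
      filter_upwards with w
      rw [Real.norm_eq_abs, abs_of_pos (Real.exp_pos _), Real.rpow_one]
      exact norm_truncLaplace_le hf (norm_nonneg _) (Complex.re_le_norm w)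
    · refine ⟨C + ‖f‖, ?_⟩
      rw [eventually_map]
      filter_upwards [eventually_ge_atTop 1] with x hx
      exact hreal x hx
    · intro x
      exact hneg _ (by simp)
  have hbd : Bornology.IsBounded (range (truncLaplace b f)) := by
    refine isBounded_iff_forall_norm_le.2 ⟨A, ?_⟩
    rintro _ ⟨z, rfl⟩
    rcases le_total z.re 0 with hz | hz
    · exact hneg z hz
    · exact hpos z hz
  have hconst := fun z => hdiff.apply_eq_apply_of_bounded hbd z 0
  -- The constant is found along `z = -n`, where the exponential tends to `0` for every `t < b`.
  have hzero : truncLaplace b f 0 = 0 := by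
    have hlim : Tendsto (fun n : ℕ => truncLaplace b f (-(n : ℂ))) atTop (𝓝 0) := by
      have : (0 : ℂ) = ∫ t in Ioc 0 b, (0 : ℂ) := by simp
      rw [this]
      refine tendsto_integral_of_dominated_convergence (fun t => ‖f t‖) ?_ hf.norm ?_ ?_
      · intro n
        exact hf.1.mul (Continuous.aestronglyMeasurable (by fun_prop))
      · intro n
        filter_upwards [ae_restrict_mem measurableSet_Ioc] with t ht
        rw [norm_mul]
        refine mul_le_of_le_one_right (norm_nonneg _) ?_
        rw [Complex.norm_exp, Complex.re_ofReal_mul, Real.exp_le_one_iff]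
        have h1 : t ^ 2 ≤ b ^ 2 := pow_le_pow_left₀ ht.1.le ht.2 2
        have h2 : 0 ≤ Real.pi * (b ^ 2 - t ^ 2) := mul_nonneg Real.pi_pos.le (by linarith)
        simp only [Complex.neg_re, Complex.natCast_re]
        nlinarith [mul_nonneg h2 (Nat.cast_nonneg (α := ℝ) n)]
      · have hne : ∀ᵐ t : ℝ ∂(volume.restrict (Ioc 0 b)), t ≠ b := by
          refine ae_restrict_of_ae ?_
          rw [ae_iff]
          simp
        filter_upwards [ae_restrict_mem measurableSet_Ioc, hne] with t ht hne
        have hlt : t < b := lt_of_le_of_ne ht.2 hne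
        have h1 : t ^ 2 < b ^ 2 := pow_lt_pow_left₀ hlt ht.1.le two_ne_zero
        have h2 : 0 < Real.pi * (b ^ 2 - t ^ 2) := mul_pos Real.pi_pos (by linarith)
        rw [← mul_zero (f t)]
        refine Tendsto.const_mul _ ?_
        rw [tendsto_zero_iff_norm_tendsto_zero]
        simp only [Complex.norm_exp, Complex.re_ofReal_mul, Complex.neg_re, Complex.natCast_re]
        refine Real.tendsto_exp_atBot.comp ?_
        refine Tendsto.const_mul_atBot h2 ?_
        exact tendsto_neg_atTop_atBot.comp tendsto_natCast_atTop_atTop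
    simp only [hconst] at hlim
    exact tendsto_nhds_unique tendsto_const_nhds hlim
  -- The restriction of `f` to `(0, b]` therefore has zero Gaussian transform, and injectivity
  -- applies to it.
  have hall : ∀ x, 0 < x → gaussTransform ((Ioc 0 b).indicator f) x = 0 := by
    intro x hx
    have h1 := truncLaplace_sq b x f
    rw [hconst, hzero] at h1
    have h2 : (((gauss x b)⁻¹ : ℝ) : ℂ) ≠ 0 := by exact_mod_cast (inv_pos.2 (gauss_pos x b)).ne'
    have h3 := (mul_eq_zero.1 h1.symm).resolve_left h2
    rw [gaussTransform, ← h3]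
    have e : ∀ t, (Ioc 0 b).indicator f t * (gauss x t : ℂ)
        = (Ioc 0 b).indicator (fun t => f t * (gauss x t : ℂ)) t := fun t => by
      by_cases ht : t ∈ Ioc 0 b <;> simp [ht]
    simp only [e]
    rw [integral_indicator measurableSet_Ioc, Measure.restrict_restrict measurableSet_Ioc,
      inter_eq_left.2 Ioc_subset_Ioi_self]
  have hi : Integrable (fun t => (Ioc 0 b).indicator f t * (gauss 1 t : ℂ)) halfLine := by
    refine ((integrable_mul_gauss f one_pos).indicator (measurableSet_Ioc (a := 0) (b := b))).congr
      (ae_of_all _ fun t => ?_)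
    by_cases ht : t ∈ Ioc 0 b <;> simp [ht]
  have hfin := ae_eq_zero_of_gaussTransform_eq_zero hi hall
  change ∀ᵐ t ∂halfLine, t < b → f t = 0
  filter_upwards [hfin, ae_restrict_mem measurableSet_Ioi] with t ht ht0 htb
  rw [indicator_of_mem (show t ∈ Ioc 0 b from ⟨ht0, htb.le⟩)] at ht
  exact ht

/-- The decay condition for every exponent below `a` suffices. -/
theorem mem_vanishing_of_forall_lt (f : K) {a : ℝ} (ha : 0 < a)
    (h : ∀ b, 0 < b → b < a → f ∈ vanishing b) : f ∈ vanishing a := by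
  have h1 : ∀ n : ℕ, ∀ᵐ t ∂halfLine, t < a * (1 - 1 / (n + 2)) → f t = 0 := by
    intro n
    have h2 : (1 : ℝ) / (n + 2) < 1 := by
      rw [div_lt_one (by positivity)]
      have : (0 : ℝ) ≤ n := Nat.cast_nonneg n
      linarith
    have h3 : (0 : ℝ) < 1 / (n + 2) := by positivity
    exact h _ (mul_pos ha (by linarith)) (by nlinarith)
  change ∀ᵐ t ∂halfLine, t < a → f t = 0
  filter_upwards [ae_all_iff.2 h1] with t ht hta
  have hlim : Tendsto (fun n : ℕ => a * (1 - 1 / ((n : ℝ) + 2))) atTop (𝓝 (a * (1 - 0))) := by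
    refine Tendsto.const_mul _ (Tendsto.const_sub _ ?_)
    have := (tendsto_one_div_add_atTop_nhds_zero_nat (𝕜 := ℝ)).comp (tendsto_add_atTop_nat 1)
    refine this.congr fun n => ?_
    simp only [Function.comp_apply]
    push_cast
    ring
  rw [sub_zero, mul_one] at hlim
  obtain ⟨n, hn⟩ := (hlim.eventually (lt_mem_nhds hta)).exists
  exact ht n hn

/-! ### The completed Mellin transform as an entire function. -/

theorem continuousOn_gaussTransform (f : K) : ContinuousOn (gaussTransform f) (Ioi 0) := by
  intro x₀ hx₀
  refine ContinuousAt.continuousWithinAt ?_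
  have hx₀ : 0 < x₀ := hx₀
  refine continuousAt_of_dominated (bound := fun t => ‖f t‖ * gauss (x₀ / 2) t) ?_ ?_ ?_ ?_
  · refine Eventually.of_forall fun x => (Lp.memLp f).1.mul ?_
    exact (Complex.continuous_ofReal.comp (continuous_gauss x)).aestronglyMeasurable
  · filter_upwards [lt_mem_nhds (half_lt_self hx₀)] with x hx
    filter_upwards with t
    rw [norm_mul, Complex.norm_real, Real.norm_eq_abs, abs_of_pos (gauss_pos _ _)]
    refine mul_le_mul_of_nonneg_left ?_ (norm_nonneg _)
    rw [gauss, gauss, Real.exp_le_exp]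
    have h1 : (x₀ / 2) ^ 2 ≤ x ^ 2 := pow_le_pow_left₀ (by positivity) hx.le 2
    have := mul_le_mul_of_nonneg_left h1 (mul_nonneg Real.pi_pos.le (sq_nonneg t))
    linarith
  · refine (integrable_mul_gauss f (half_pos hx₀)).norm.congr (ae_of_all _ fun t => ?_)
    simp only [norm_mul, Complex.norm_real, Real.norm_eq_abs, abs_of_pos (gauss_pos _ _)]
  · filter_upwards with t
    refine Continuous.continuousAt ?_
    unfold gauss
    fun_prop

theorem exists_gauss_le_rpow {a : ℝ} (ha : 0 < a) (r : ℝ) :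
    ∃ C, 0 ≤ C ∧ ∀ x, 1 ≤ x → gauss x a ≤ C * x ^ r := by
  -- The single term of index `n ≥ -r` in the exponential series already gives the bound, since
  -- `x^{-2n} ≤ x^r` for `x ≥ 1`.
  obtain ⟨n, hn⟩ := exists_nat_ge (-r)
  refine ⟨n.factorial / (Real.pi * a ^ 2) ^ n, by have := Real.pi_pos; positivity, fun x hx => ?_⟩
  have hx0 : 0 < x := by linarith
  have hB : 0 < Real.pi * a ^ 2 := by have := Real.pi_pos; positivity
  have hy : 0 < Real.pi * a ^ 2 * x ^ 2 := by positivity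
  have h1 := Real.pow_div_factorial_le_exp _ hy.le n
  have h2 : gauss x a = (Real.exp (Real.pi * a ^ 2 * x ^ 2))⁻¹ := by
    rw [← Real.exp_neg, gauss]
    ring_nf
  rw [h2]
  calc _ ≤ ((Real.pi * a ^ 2 * x ^ 2) ^ n / n.factorial)⁻¹ := by gcongr
    _ = n.factorial / (Real.pi * a ^ 2) ^ n * (x ^ (2 * n))⁻¹ := by
      rw [mul_pow, ← pow_mul]
      field_simp
    _ ≤ _ := by
      refine mul_le_mul_of_nonneg_left ?_ (by positivity)
      rw [← Real.rpow_natCast, ← Real.rpow_neg hx0.le]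
      refine Real.rpow_le_rpow_of_exponent_le hx ?_
      push_cast
      have : (0 : ℝ) ≤ n := Nat.cast_nonneg n
      linarith

theorem exists_norm_gaussTransform_le_rpow_of_one_le {a : ℝ} (ha : 0 < a) (r : ℝ) :
    ∃ C, 0 ≤ C ∧ ∀ f ∈ sonineSpace a, ∀ x, 1 ≤ x → ‖gaussTransform f x‖ ≤ C * ‖f‖ * x ^ r := by
  obtain ⟨C, hC, h⟩ := exists_gauss_le_rpow ha r
  refine ⟨C, hC, fun f hf x hx => ?_⟩
  refine (norm_gaussTransform_le ha.le hf.1 (by linarith)).trans ?_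
  rw [mul_comm C, mul_assoc]
  refine mul_le_mul_of_nonneg_left ((div_le_self (gauss_pos _ _).le ?_).trans (h x hx))
    (norm_nonneg _)
  rwa [Real.one_le_sqrt]

theorem gaussTransform_eq_inv (f : K) {x : ℝ} (hx : 0 < x) :
    gaussTransform f x = (x : ℂ)⁻¹ * gaussTransform (cosineTransform f) x⁻¹ := by
  rw [← gaussTransform_cosineTransform _ hx, cosineTransform_cosineTransform]

/-- The functional equation carries the rapid decay at infinity for the cosine transform over to
rapid decay at `0` for `f`. With decay at both ends the Mellin integral converges for every `s`. -/
theorem exists_norm_gaussTransform_le_rpow_of_le_one {a : ℝ} (ha : 0 < a) (r : ℝ) :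
    ∃ C, 0 ≤ C ∧ ∀ f ∈ sonineSpace a, ∀ x, 0 < x → x ≤ 1 →
      ‖gaussTransform f x‖ ≤ C * ‖f‖ * x ^ r := by
  obtain ⟨C, hC, h⟩ := exists_norm_gaussTransform_le_rpow_of_one_le ha (-(r + 1))
  refine ⟨C, hC, fun f hf x hx hx1 => ?_⟩
  rw [gaussTransform_eq_inv f hx, norm_mul, norm_inv, Complex.norm_real, Real.norm_eq_abs,
    abs_of_pos hx]
  have := h _ (cosineTransform_mem_sonineSpace hf) x⁻¹ ((one_le_inv₀ hx).2 hx1)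
  rw [norm_cosineTransform, Real.inv_rpow hx.le, ← Real.rpow_neg hx.le, neg_neg,
    Real.rpow_add hx, Real.rpow_one] at this
  calc _ ≤ x⁻¹ * (C * ‖f‖ * (x ^ r * x)) := mul_le_mul_of_nonneg_left this (by positivity)
    _ = _ := by field_simp

/-- The completed Mellin transform of `f`, as twice the Mellin transform of its Gaussian
transform. -/
noncomputable def completedMellin (f : K) (s : ℂ) : ℂ := 2 * mellin (gaussTransform f) s

theorem isBigO_gaussTransform_atTop {a : ℝ} (ha : 0 < a) {f : K} (hf : f ∈ sonineSpace a) (r : ℝ) :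
    gaussTransform f =O[atTop] (fun x => x ^ (-r)) := by
  obtain ⟨C, -, h⟩ := exists_norm_gaussTransform_le_rpow_of_one_le ha (-r)
  refine Asymptotics.IsBigO.of_bound (C * ‖f‖) ?_
  filter_upwards [eventually_ge_atTop 1] with x hx
  rw [Real.norm_eq_abs, abs_of_pos (Real.rpow_pos_of_pos (by linarith) _)]
  exact h f hf x hx

theorem isBigO_gaussTransform_zero {a : ℝ} (ha : 0 < a) {f : K} (hf : f ∈ sonineSpace a) (r : ℝ) :
    gaussTransform f =O[𝓝[>] 0] (fun x => x ^ (-r)) := by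
  obtain ⟨C, -, h⟩ := exists_norm_gaussTransform_le_rpow_of_le_one ha (-r)
  refine Asymptotics.IsBigO.of_bound (C * ‖f‖) ?_
  filter_upwards [Ioc_mem_nhdsGT one_pos] with x hx
  rw [Real.norm_eq_abs, abs_of_pos (Real.rpow_pos_of_pos hx.1 _)]
  exact h f hf x hx.1 hx.2

theorem mellinConvergent_gaussTransform {a : ℝ} (ha : 0 < a) {f : K} (hf : f ∈ sonineSpace a)
    (s : ℂ) : MellinConvergent (gaussTransform f) s :=
  mellinConvergent_of_isBigO_rpow
    ((continuousOn_gaussTransform f).locallyIntegrableOn measurableSet_Ioi)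
    (isBigO_gaussTransform_atTop ha hf (s.re + 1)) (by linarith)
    (isBigO_gaussTransform_zero ha hf (s.re - 1)) (by linarith)

theorem differentiable_completedMellin {a : ℝ} (ha : 0 < a) {f : K} (hf : f ∈ sonineSpace a) :
    Differentiable ℂ (completedMellin f) := fun s =>
  (mellin_differentiableAt_of_isBigO_rpow
    ((continuousOn_gaussTransform f).locallyIntegrableOn measurableSet_Ioi)
    (isBigO_gaussTransform_atTop ha hf (s.re + 1)) (by linarith)
    (isBigO_gaussTransform_zero ha hf (s.re - 1)) (by linarith)).const_mul 2

theorem completedMellin_add {a : ℝ} (ha : 0 < a) {f g : K} (hf : f ∈ sonineSpace a)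
    (hg : g ∈ sonineSpace a) (s : ℂ) :
    completedMellin (f + g) s = completedMellin f s + completedMellin g s := by
  have h := (hasMellin_add (mellinConvergent_gaussTransform ha hf s)
    (mellinConvergent_gaussTransform ha hg s)).2
  rw [completedMellin, completedMellin, completedMellin, ← mul_add, ← h]
  congr 1
  refine setIntegral_congr_fun measurableSet_Ioi fun x hx => ?_
  simp only [gaussTransform_add f g hx]

theorem completedMellin_smul (c : ℂ) (f : K) (s : ℂ) :
    completedMellin (c • f) s = c * completedMellin f s := by
  have h := mellin_const_smul (gaussTransform f) s c
  rw [smul_eq_mul] at h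
  rw [completedMellin, completedMellin, mul_left_comm, ← h]
  congr 1
  refine setIntegral_congr_fun measurableSet_Ioi fun x hx => ?_
  simp only [gaussTransform_smul, smul_eq_mul]

/-- The substitution `x ↦ x⁻¹` in the Mellin integral, combined with
`gaussTransform_cosineTransform`. -/
theorem completedMellin_cosineTransform (f : K) (s : ℂ) :
    completedMellin (cosineTransform f) s = completedMellin f (1 - s) := by
  have h1 := mellin_cpow_smul (fun x => gaussTransform f x⁻¹) s (-1)
  rw [mellin_comp_inv] at h1
  rw [completedMellin, completedMellin, show 1 - s = -(s + -1) by ring, ← h1]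
  congr 1
  refine setIntegral_congr_fun measurableSet_Ioi fun x hx => ?_
  simp only [gaussTransform_cosineTransform f hx, smul_eq_mul, Complex.cpow_neg_one]

theorem completedMellin_dilation {c : ℝ} (hc : 0 < c) (f : K) (s : ℂ) :
    completedMellin (dilation hc f) s = (c : ℂ) ^ (s - 1) * completedMellin f s := by
  have hc' : (c : ℂ) ≠ 0 := by exact_mod_cast hc.ne'
  have h := mellin_comp_mul_right (gaussTransform f) s (inv_pos.2 hc)
  have h2 := mellin_const_smul (fun x => gaussTransform f (x * c⁻¹)) s (c : ℂ)⁻¹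
  rw [h] at h2
  have h3 : mellin (gaussTransform (dilation hc f)) s
      = mellin (fun x => (c : ℂ)⁻¹ • gaussTransform f (x * c⁻¹)) s := by
    refine setIntegral_congr_fun measurableSet_Ioi fun x hx => ?_
    simp only [gaussTransform_dilation, smul_eq_mul]
  have h4 : (((c⁻¹ : ℝ) : ℂ)) ^ (-s) = (c : ℂ) ^ s := by
    rw [Complex.ofReal_inv, Complex.inv_cpow _ _ (by
      rw [Complex.arg_ofReal_of_nonneg hc.le]; exact Real.pi_pos.ne), Complex.cpow_neg, inv_inv]
  rw [completedMellin, completedMellin, h3, h2, h4, Complex.cpow_sub _ _ hc', Complex.cpow_one,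
    smul_eq_mul, smul_eq_mul]
  field_simp

/-- Uniformity in `f` makes evaluations, and by Cauchy's estimate their derivatives, bounded
functionals. The bounds `x^{R+1}` at `0` and `x^{-R-1}` at infinity beat `|x^{s-1}|` for all `‖s‖ ≤
R` and leave a multiple of `1/(1+x²)`. -/
theorem exists_norm_completedMellin_le {a : ℝ} (ha : 0 < a) (R : ℝ) :
    ∃ C, 0 ≤ C ∧ ∀ f ∈ sonineSpace a, ∀ s : ℂ, ‖s‖ ≤ R → ‖completedMellin f s‖ ≤ C * ‖f‖ := by
  obtain ⟨C1, h10, h1⟩ := exists_norm_gaussTransform_le_rpow_of_one_le ha (-R - 1)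
  obtain ⟨C0, h00, h0⟩ := exists_norm_gaussTransform_le_rpow_of_le_one ha (R + 1)
  have hint : ∀ c : ℝ, IntegrableOn (fun x : ℝ => c * (1 + x ^ 2)⁻¹) (Ioi 0) := fun c =>
    (integrable_inv_one_add_sq.const_mul c).integrableOn
  refine ⟨2 * ∫ x in Ioi (0 : ℝ), 2 * (C1 + C0) * (1 + x ^ 2)⁻¹, ?_, fun f hf s hs => ?_⟩
  · exact mul_nonneg zero_le_two (integral_nonneg fun x => by positivity)
  rw [completedMellin, norm_mul, Complex.norm_ofNat, mul_assoc]
  refine mul_le_mul_of_nonneg_left ?_ zero_le_two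
  rw [← integral_mul_const, mellin]
  refine norm_integral_le_of_norm_le ((hint _).mul_const _) ?_
  have hre := abs_le.1 ((Complex.abs_re_le_norm s).trans hs)
  filter_upwards [ae_restrict_mem measurableSet_Ioi] with x hx
  have hx : 0 < x := hx
  rw [norm_smul, Complex.norm_cpow_eq_rpow_re_of_pos hx, Complex.sub_re, Complex.one_re]
  have hn := norm_nonneg f
  rcases le_total x 1 with hx1 | hx1
  · calc x ^ (s.re - 1) * ‖gaussTransform f x‖ ≤ x ^ (s.re - 1) * (C0 * ‖f‖ * x ^ (R + 1)) := by
          gcongr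
          exact h0 f hf x hx hx1
      _ = C0 * ‖f‖ * x ^ (s.re + R) := by
          rw [mul_left_comm, ← Real.rpow_add hx]
          ring_nf
      _ ≤ C0 * ‖f‖ * 1 := by
          gcongr
          exact Real.rpow_le_one hx.le hx1 (by linarith)
      _ ≤ C0 * ‖f‖ * (2 * (1 + x ^ 2)⁻¹) := by
          gcongr
          rw [← div_eq_mul_inv, one_le_div (by positivity)]
          nlinarith
      _ ≤ _ := by
          rw [show 2 * (C1 + C0) * (1 + x ^ 2)⁻¹ * ‖f‖ = C0 * ‖f‖ * (2 * (1 + x ^ 2)⁻¹)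
            + C1 * ‖f‖ * (2 * (1 + x ^ 2)⁻¹) by ring]
          have : 0 ≤ C1 * ‖f‖ * (2 * (1 + x ^ 2)⁻¹) := by positivity
          linarith
  · calc x ^ (s.re - 1) * ‖gaussTransform f x‖ ≤ x ^ (s.re - 1) * (C1 * ‖f‖ * x ^ (-R - 1)) := by
          gcongr
          exact h1 f hf x hx1
      _ = C1 * ‖f‖ * x ^ (s.re - R - 2) := by
          rw [mul_left_comm, ← Real.rpow_add hx]
          ring_nf
      _ ≤ C1 * ‖f‖ * x ^ (-2 : ℝ) := by
          gcongr
          linarith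
      _ ≤ C1 * ‖f‖ * (2 * (1 + x ^ 2)⁻¹) := by
          gcongr
          rw [Real.rpow_neg hx.le, Real.rpow_two, ← div_eq_mul_inv, le_div_iff₀ (by positivity),
            inv_mul_le_iff₀ (by positivity)]
          nlinarith
      _ ≤ _ := by
          rw [show 2 * (C1 + C0) * (1 + x ^ 2)⁻¹ * ‖f‖ = C0 * ‖f‖ * (2 * (1 + x ^ 2)⁻¹)
            + C1 * ‖f‖ * (2 * (1 + x ^ 2)⁻¹) by ring]
          have : 0 ≤ C0 * ‖f‖ * (2 * (1 + x ^ 2)⁻¹) := by positivity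
          linarith

/-- Mellin inversion recovers the Gaussian transform, which determines `f`. -/
theorem eq_zero_of_completedMellin_eq_zero {a : ℝ} (ha : 0 < a) {f : K} (hf : f ∈ sonineSpace a)
    (h : ∀ s, completedMellin f s = 0) : f = 0 := by
  have h0 : mellin (gaussTransform f) = fun _ => 0 := by
    ext s
    exact (mul_eq_zero.1 (h s)).resolve_left two_ne_zero
  refine eq_of_gaussTransform_eq fun x hx => ?_
  have h1 := mellinInv_mellin_eq 0 (gaussTransform f) hx (mellinConvergent_gaussTransform ha hf _)
    (by rw [h0]; simp [VerticalIntegrable])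
    ((continuousOn_gaussTransform f).continuousAt (Ioi_mem_nhds hx))
  rw [h0] at h1
  rw [← h1, gaussTransform_congr (Lp.coeFn_zero ℂ 2 halfLine)]
  simp [mellinInv, gaussTransform]

/-! ### Agreement with the right Mellin transform. -/

theorem integrable_mul_of_mem_vanishing {a : ℝ} (ha : 0 < a) {f : K} (hf : f ∈ vanishing a)
    {ψ : ℝ → ℂ} (h : MemLp ψ 2 (volume.restrict (Ioi a))) :
    Integrable (fun t => f t * ψ t) halfLine := by
  have hs : Ioi a ⊆ Ioi (0 : ℝ) := Ioi_subset_Ioi ha.le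
  have h1 := integrableOn_mul_of_memLp f hs h
  rw [← integrable_indicator_iff measurableSet_Ioi] at h1
  refine (h1.mono_measure Measure.restrict_le_self : Integrable _ halfLine).congr ?_
  have hne : ∀ᵐ t : ℝ ∂halfLine, t ≠ a := by
    refine ae_restrict_of_ae ?_
    rw [ae_iff]
    simp
  filter_upwards [ae_eq_zero_of_mem_vanishing hf, hne] with t h1 h2
  by_cases ht : t ∈ Ioi a
  · rw [indicator_of_mem ht]
  · rw [indicator_of_notMem ht, h1 (lt_of_le_of_ne (not_lt.1 ht) h2), zero_mul]

theorem aestronglyMeasurable_cpow (s : ℂ) {a : ℝ} (ha : 0 ≤ a) :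
    AEStronglyMeasurable (fun t : ℝ => (t : ℂ) ^ s) (volume.restrict (Ioi a)) := by
  refine ContinuousOn.aestronglyMeasurable ?_ measurableSet_Ioi
  intro t ht
  refine ContinuousAt.continuousWithinAt ?_
  exact (Complex.continuousAt_ofReal_cpow_const t s (Or.inr (ha.trans_lt ht).ne'))

theorem memLp_cpow_Ioi {a : ℝ} (ha : 0 < a) {s : ℂ} (hs : 1 / 2 < s.re) :
    MemLp (fun t : ℝ => (t : ℂ) ^ (-s)) 2 (volume.restrict (Ioi a)) := by
  rw [memLp_two_iff_integrable_sq_norm (aestronglyMeasurable_cpow _ ha.le)]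
  refine (integrableOn_Ioi_rpow_of_lt (a := -(2 * s.re)) (by linarith) ha).congr_fun ?_
    measurableSet_Ioi
  intro t ht
  have ht : 0 < t := ha.trans ht
  simp only
  rw [Complex.norm_cpow_eq_rpow_re_of_pos ht, ← Real.rpow_natCast, ← Real.rpow_mul ht.le,
    Complex.neg_re]
  congr 1
  push_cast
  ring

theorem gauss_eq_gauss_mul_one (x t : ℝ) : gauss x t = gauss (x * t) 1 := by
  rw [← mul_one t, gauss_mul, mul_one]

theorem mellinConvergent_gauss_one {s : ℂ} (hs : 0 < s.re) :
    MellinConvergent (fun x => (gauss x 1 : ℂ)) s := by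
  have h := integrableOn_rpow_mul_exp_neg_mul_sq (b := Real.pi) Real.pi_pos (s := s.re - 1)
    (by linarith)
  have hm : AEStronglyMeasurable (fun x : ℝ => (x : ℂ) ^ (s - 1) • (gauss x 1 : ℂ))
      (volume.restrict (Ioi 0)) := by
    refine (aestronglyMeasurable_cpow _ le_rfl).smul (Continuous.aestronglyMeasurable ?_)
    unfold gauss
    fun_prop
  refine Integrable.mono' h hm ?_
  filter_upwards [ae_restrict_mem measurableSet_Ioi] with x hx
  rw [norm_smul, Complex.norm_cpow_eq_rpow_re_of_pos hx, Complex.norm_real, Real.norm_eq_abs,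
    abs_of_pos (gauss_pos _ _), Complex.sub_re, Complex.one_re, gauss]
  simp

theorem mellin_gauss_one {s : ℂ} (hs : 0 < s.re) :
    mellin (fun x => (gauss x 1 : ℂ)) s = (Real.pi : ℂ) ^ (-s / 2) * Complex.Gamma (s / 2) / 2 := by
  have h := mellin_comp_rpow (fun y : ℝ => cexp (-(Real.pi * y))) s 2
  have e : (fun x => (gauss x 1 : ℂ)) = fun x : ℝ => cexp (-(Real.pi * ((x ^ (2 : ℝ) : ℝ) : ℂ))) := by
    ext x
    rw [gauss, Real.rpow_two]
    push_cast
    ring_nf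
  have h2 : mellin (fun y : ℝ => cexp (-(Real.pi * y))) (s / ((2 : ℝ) : ℂ))
      = (1 / Real.pi : ℂ) ^ (s / 2) * Complex.Gamma (s / 2) := by
    rw [mellin]
    simp only [smul_eq_mul]
    rw [← Complex.integral_cpow_mul_exp_neg_mul_Ioi (a := s / 2) (r := Real.pi)]
    · norm_num
    · simpa using hs
    · simpa using Real.pi_pos
  rw [e, h, h2, one_div, Complex.inv_cpow _ _ (by
      rw [Complex.arg_ofReal_of_nonneg Real.pi_pos.le]; exact Real.pi_pos.ne), ← Complex.cpow_neg,
      Complex.real_smul]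
  have : |(2 : ℝ)|⁻¹ = 1 / 2 := by norm_num
  rw [this]
  push_cast
  rw [neg_div]
  ring

/-- Fubini: the Mellin transform in `x` of `e^{-πt²x²}` is `t^{-s}` times half the gamma factor,
whence the `2` in `completedMellin`. Absolute convergence uses `t^{-s} ∈ L²(a, ∞)`, that is `Re s >
1/2`. -/
theorem completedMellin_eq_rightMellin {a : ℝ} (ha : 0 < a) {f : K} (hf : f ∈ sonineSpace a)
    {s : ℂ} (hs : 1 / 2 < s.re) :
    completedMellin f s = (Real.pi : ℂ) ^ (-s / 2) * Complex.Gamma (s / 2) * rightMellin f s := by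
  have hs0 : 0 < s.re := by linarith
  set c : ℝ := ∫ x in Ioi (0 : ℝ), ‖(x : ℂ) ^ (s - 1) • (gauss x 1 : ℂ)‖ with hc
  have hconv : ∀ t : ℝ, 0 < t → MellinConvergent (fun x => (gauss x t : ℂ)) s := by
    intro t ht
    have := (MellinConvergent.comp_mul_left (f := fun x => (gauss x 1 : ℂ)) (s := s) ht).2
      (mellinConvergent_gauss_one hs0)
    simp only [mul_comm t, ← gauss_eq_gauss_mul_one] at this
    exact this
  have hval : ∀ t : ℝ, 0 < t → mellin (fun x => (gauss x t : ℂ)) s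
      = (t : ℂ) ^ (-s) * ((Real.pi : ℂ) ^ (-s / 2) * Complex.Gamma (s / 2) / 2) := by
    intro t ht
    have := mellin_comp_mul_right (fun x => (gauss x 1 : ℂ)) s ht
    simp only [← gauss_eq_gauss_mul_one] at this
    rw [this, mellin_gauss_one hs0, smul_eq_mul]
  have hnorm : ∀ t : ℝ, 0 < t → ∫ x in Ioi (0 : ℝ), ‖(x : ℂ) ^ (s - 1) • (gauss x t : ℂ)‖
      = ‖(t : ℂ) ^ (-s)‖ * c := by
    intro t ht
    have h1 := integral_comp_mul_right_Ioi'
      (fun x => ‖((x : ℝ) : ℂ) ^ (s - 1) • (gauss x 1 : ℂ)‖) 0 ht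
    rw [zero_mul] at h1
    rw [hc, ← h1, smul_eq_mul, ← integral_const_mul, ← integral_const_mul]
    refine setIntegral_congr_fun measurableSet_Ioi fun x hx => ?_
    have hx : 0 < x := hx
    simp only [norm_smul, ← gauss_eq_gauss_mul_one]
    rw [Complex.norm_cpow_eq_rpow_re_of_pos ht, Complex.norm_cpow_eq_rpow_re_of_pos hx,
      Complex.norm_cpow_eq_rpow_re_of_pos (mul_pos hx ht), Real.mul_rpow hx.le ht.le]
    rw [Complex.neg_re, Complex.sub_re, Complex.one_re, Real.rpow_sub_one ht.ne', Real.rpow_neg ht.le]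
    field_simp
  have hint := integrable_mul_of_mem_vanishing ha hf.1 (memLp_cpow_Ioi ha hs)
  have hprod : Integrable (Function.uncurry fun x t : ℝ =>
      (x : ℂ) ^ (s - 1) * (f t * gauss x t)) (halfLine.prod halfLine) := by
    have hm : AEStronglyMeasurable (Function.uncurry fun x t : ℝ =>
        (x : ℂ) ^ (s - 1) * (f t * gauss x t)) (halfLine.prod halfLine) := by
      have m1 : AEStronglyMeasurable (fun p : ℝ × ℝ => (p.1 : ℂ) ^ (s - 1))
        (halfLine.prod halfLine) := (aestronglyMeasurable_cpow (s - 1) le_rfl).comp_fst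
      have m2 : AEStronglyMeasurable (fun p : ℝ × ℝ => f p.2)
        (halfLine.prod halfLine) := (Lp.memLp f).1.comp_snd
      have m3 : AEStronglyMeasurable (fun p : ℝ × ℝ => (gauss p.1 p.2 : ℂ))
        (halfLine.prod halfLine) := by
          refine Continuous.aestronglyMeasurable ?_
          unfold gauss
          fun_prop
      exact m1.mul (m2.mul m3)
    rw [integrable_prod_iff' hm]
    constructor
    · filter_upwards [ae_restrict_mem measurableSet_Ioi] with t ht
      refine ((hconv t ht).const_mul (f t)).congr (ae_of_all _ fun x => ?_)
      simp only [Function.uncurry, smul_eq_mul]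
      ring
    · refine (hint.norm.mul_const c).congr ?_
      filter_upwards [ae_restrict_mem measurableSet_Ioi] with t ht
      rw [norm_mul, mul_assoc, ← hnorm t ht, ← integral_const_mul]
      congr 1
      ext x
      simp only [Function.uncurry, norm_mul, norm_smul]
      ring
  have hswap := integral_integral_swap hprod
  rw [completedMellin, mellin]
  have e1 : ∫ x in Ioi (0 : ℝ), (x : ℂ) ^ (s - 1) • gaussTransform f x
      = ∫ x in Ioi (0 : ℝ), ∫ t in Ioi (0 : ℝ), (x : ℂ) ^ (s - 1) * (f t * gauss x t) := by
    congr 1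
    ext x
    rw [gaussTransform, smul_eq_mul, integral_const_mul]
  rw [e1, hswap, rightMellin, ← integral_const_mul, ← integral_const_mul]
  refine setIntegral_congr_fun measurableSet_Ioi fun t ht => ?_
  have := hval t ht
  rw [mellin] at this
  simp only [smul_eq_mul] at this
  have e2 : ∀ x : ℝ, (x : ℂ) ^ (s - 1) * (f t * gauss x t)
    = f t * ((x : ℂ) ^ (s - 1) * gauss x t) := fun x => by ring
  simp only [e2]
  rw [integral_const_mul, this]
  ring

theorem isCompletedMellin_completedMellin {a : ℝ} (ha : 0 < a) {f : K} (hf : f ∈ sonineSpace a) :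
    IsCompletedMellin f (completedMellin f) :=
  ⟨differentiable_completedMellin ha hf, fun _ hs => completedMellin_eq_rightMellin ha hf hs⟩

theorem eq_of_eqOn_halfPlane {F G : ℂ → ℂ} (hF : Differentiable ℂ F) (hG : Differentiable ℂ G)
    {σ : ℝ} (h : ∀ s : ℂ, σ < s.re → F s = G s) : F = G := by
  have hF' : AnalyticOnNhd ℂ F univ := hF.differentiableOn.analyticOnNhd isOpen_univ
  have hG' : AnalyticOnNhd ℂ G univ := hG.differentiableOn.analyticOnNhd isOpen_univ
  refine hF'.eq_of_eventuallyEq hG' (z₀ := ((σ + 1 : ℝ) : ℂ)) ?_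
  have : {s : ℂ | σ < s.re} ∈ 𝓝 ((σ + 1 : ℝ) : ℂ) :=
    (isOpen_lt continuous_const Complex.continuous_re).mem_nhds (by simp)
  filter_upwards [this] with s hs
  exact h s hs

theorem IsCompletedMellin.eq_completedMellin {a : ℝ} (ha : 0 < a) {f : K} (hf : f ∈ sonineSpace a)
    {F : ℂ → ℂ} (h : IsCompletedMellin f F) : F = completedMellin f :=
  eq_of_eqOn_halfPlane h.1 (differentiable_completedMellin ha hf) (σ := 1 / 2) fun s hs => by
    rw [h.2 s hs, completedMellin_eq_rightMellin ha hf hs]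

/-! ### Evaluators, and completeness as a uniqueness statement. -/

theorem isClosed_vanishing (a : ℝ) : IsClosed (vanishing a : Set K) := by
  have e : (vanishing a : Set K)
      = (LpToLpRestrictCLM ℝ ℂ ℂ halfLine 2 (Iio a)) ⁻¹' {0} := by
    ext f
    rw [mem_preimage, mem_singleton_iff]
    change (∀ᵐ t ∂halfLine, t < a → f t = 0) ↔ _
    rw [Lp.eq_zero_iff_ae_eq_zero]
    have h := LpToLpRestrictCLM_coeFn ℂ (Iio a) f
    have h1 : (∀ᵐ t ∂halfLine, t < a → f t = 0) ↔ ∀ᵐ t ∂(halfLine.restrict (Iio a)), f t = 0 :=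
      (ae_restrict_iff' measurableSet_Iio).symm
    rw [h1]
    constructor
    · intro h2
      filter_upwards [h, h2] with t h3 h4
      rw [h3, h4]
      rfl
    · intro h2
      filter_upwards [h, h2] with t h3 h4
      rw [← h3, h4]
      rfl
  rw [e]
  exact isClosed_singleton.preimage (LpToLpRestrictCLM ℝ ℂ ℂ halfLine 2 (Iio a)).continuous

theorem continuous_cosineTransform : Continuous cosineTransform :=
  (AddMonoidHomClass.isometry_of_norm cosineTransform norm_cosineTransform).continuous

theorem isClosed_sonineSpace (a : ℝ) : IsClosed (sonineSpace a : Set K) :=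
  (isClosed_vanishing a).inter ((isClosed_vanishing a).preimage continuous_cosineTransform)

instance completeSpace_sonineSpace (a : ℝ) : CompleteSpace (sonineSpace a) :=
  (isClosed_sonineSpace a).completeSpace_coe

/-- The `k`-th derivative of the completed Mellin transform at `w`, as a functional. -/
noncomputable def mellinJet (p : ℂ × ℕ) (f : K) : ℂ := iteratedDeriv p.2 (completedMellin f) p.1

theorem mellinJet_add {a : ℝ} (ha : 0 < a) (p : ℂ × ℕ) {f g : K} (hf : f ∈ sonineSpace a)
    (hg : g ∈ sonineSpace a) : mellinJet p (f + g) = mellinJet p f + mellinJet p g := by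
  have e : completedMellin (f + g) = completedMellin f + completedMellin g :=
    funext fun s => completedMellin_add ha hf hg s
  rw [mellinJet, e, iteratedDeriv_add]
  · rfl
  · exact (differentiable_completedMellin ha hf).contDiff.contDiffAt
  · exact (differentiable_completedMellin ha hg).contDiff.contDiffAt

theorem mellinJet_smul {a : ℝ} (ha : 0 < a) (p : ℂ × ℕ) (c : ℂ) {f : K} (hf : f ∈ sonineSpace a) :
    mellinJet p (c • f) = c * mellinJet p f := by
  have e : completedMellin (c • f) = c • completedMellin f :=
    funext fun s => completedMellin_smul c f s
  rw [mellinJet, e, iteratedDeriv_const_smul]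
  · rfl
  · exact (differentiable_completedMellin ha hf).contDiff.contDiffAt

theorem exists_norm_mellinJet_le {a : ℝ} (ha : 0 < a) (p : ℂ × ℕ) :
    ∃ C, ∀ f ∈ sonineSpace a, ‖mellinJet p f‖ ≤ C * ‖f‖ := by
  obtain ⟨C, -, h⟩ := exists_norm_completedMellin_le ha (‖p.1‖ + 1)
  refine ⟨p.2.factorial * C, fun f hf => ?_⟩
  have := Complex.norm_iteratedDeriv_le_of_forall_mem_sphere_norm_le p.2 one_pos
    (differentiable_completedMellin ha hf).diffContOnCl (c := p.1) (C := C * ‖f‖) ?_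
  · simpa [mellinJet, mul_assoc] using this
  · intro z hz
    refine h f hf z ?_
    have h1 : ‖z - p.1‖ = 1 := by simpa [dist_eq_norm] using hz
    have h2 := norm_sub_norm_le z p.1
    linarith

theorem exists_isEvaluator {a : ℝ} (ha : 0 < a) (w : ℂ) (k : ℕ) :
    ∃ Z : sonineSpace a, IsEvaluator a w k Z := by
  obtain ⟨C, hC⟩ := exists_norm_mellinJet_le ha (w, k)
  let L : sonineSpace a →ₗ[ℂ] ℂ :=
    { toFun := fun f => mellinJet (w, k) f
      map_add' := fun f g => mellinJet_add ha _ f.2 g.2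
      map_smul' := fun c f => mellinJet_smul ha _ c f.2 }
  let L' : sonineSpace a →L[ℂ] ℂ := L.mkContinuous C fun f => hC f f.2
  let Y := (InnerProductSpace.toDual ℂ (sonineSpace a)).symm L'
  have hY : ∀ f : sonineSpace a, inner ℂ Y f = mellinJet (w, k) f := fun f => by
    rw [InnerProductSpace.toDual_symm_apply]
    rfl
  -- The defining pairing of an evaluator is bilinear, so the evaluator is the complex conjugate of
  -- the Riesz vector.
  refine ⟨⟨star (Y : K), star_mem_sonineSpace Y.2⟩, fun f hf =>
    ⟨completedMellin f, isCompletedMellin_completedMellin ha hf, ?_⟩⟩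
  have h := hY ⟨f, hf⟩
  rw [Submodule.coe_inner, inner_eq_integral] at h
  change _ = mellinJet (w, k) f
  rw [← h]
  refine integral_congr_ae ?_
  filter_upwards [Lp.coeFn_star (Y : K)] with t ht
  rw [ht]
  rfl

theorem isEvaluator_evaluator {a : ℝ} (ha : 0 < a) (w : ℂ) (k : ℕ) :
    IsEvaluator a w k (evaluator a w k) := by
  have h := exists_isEvaluator ha w k
  rw [evaluator, dif_pos h]
  exact h.choose_spec

theorem inner_star_evaluator {a : ℝ} (ha : 0 < a) (w : ℂ) (k : ℕ) {f : K}
    (hf : f ∈ sonineSpace a) :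
    inner ℂ (star f) (evaluator a w k : K) = mellinJet (w, k) f := by
  obtain ⟨F, hF, h⟩ := isEvaluator_evaluator ha w k f hf
  rw [hF.eq_completedMellin ha hf] at h
  rw [inner_eq_integral, mellinJet, ← h]
  refine integral_congr_ae ?_
  filter_upwards [Lp.coeFn_star f] with t ht
  rw [ht, mul_comm]
  simp

theorem eq_zero_of_star_eq_zero {f : K} (h : star f = 0) : f = 0 := by
  rw [Lp.eq_zero_iff_ae_eq_zero] at h ⊢
  filter_upwards [h, Lp.coeFn_star f] with t h1 h2
  rw [h1] at h2
  exact star_eq_zero.1 h2.symm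

/-- A span is dense iff its orthogonal complement is zero. Since `K_a` is stable under conjugation,
every vector is some `star f`, and pairing it with the evaluators gives the jets of `M(f)`. -/
theorem isCompleteSystem_evaluators_iff {a : ℝ} (ha : 0 < a) (I : Set (ℂ × ℕ)) :
    IsCompleteSystem (evaluators a I) ↔
      ∀ f ∈ sonineSpace a, (∀ p ∈ I, mellinJet p f = 0) → f = 0 := by
  have hkey : ∀ f, (hf : f ∈ sonineSpace a) →
      ((⟨star f, star_mem_sonineSpace hf⟩ : sonineSpace a)
        ∈ (Submodule.span ℂ (range (evaluators a I)))ᗮ ↔ ∀ p ∈ I, mellinJet p f = 0) := by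
    intro f hf
    rw [Submodule.mem_orthogonal']
    constructor
    · intro h p hp
      have := h _ (Submodule.subset_span ⟨⟨p, hp⟩, rfl⟩)
      rw [← inner_star_evaluator ha p.1 p.2 hf]
      exact this
    · intro h u hu
      induction hu using Submodule.span_induction with
      | mem x hx =>
        obtain ⟨p, rfl⟩ := hx
        exact (inner_star_evaluator ha p.1.1 p.1.2 hf).trans (h p.1 p.2)
      | zero => exact inner_zero_right _
      | add x y _ _ hx hy => rw [inner_add_right, hx, hy, add_zero]
      | smul c x _ hx => rw [inner_smul_right, hx, mul_zero]
  rw [IsCompleteSystem, Submodule.dense_iff_topologicalClosure_eq_top,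
    Submodule.topologicalClosure_eq_top_iff, Submodule.eq_bot_iff]
  constructor
  · intro h f hf hp
    have := h _ ((hkey f hf).2 hp)
    have h2 : star f = 0 := congrArg Subtype.val this
    exact eq_zero_of_star_eq_zero h2
  · rintro h ⟨g, hg⟩ hgo
    have hs := star_mem_sonineSpace hg
    have e : (⟨star (star g), star_mem_sonineSpace hs⟩ : sonineSpace a) = ⟨g, hg⟩ :=
      Subtype.ext (star_star g)
    have h1 := (hkey (star g) hs).1 (by rw [e]; exact hgo)
    have h2 := h _ hs h1
    exact Subtype.ext (eq_zero_of_star_eq_zero h2)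

/-- The pairing with `star f` is continuous: if it kills the other evaluators, it kills their closed
span. -/
theorem exists_of_not_isMinimalSystem {a : ℝ} (ha : 0 < a) {I : Set (ℂ × ℕ)}
    (h : ¬ IsMinimalSystem (evaluators a I)) :
    ∃ p ∈ I, ∀ f ∈ sonineSpace a, (∀ q ∈ I, q ≠ p → mellinJet q f = 0) → mellinJet p f = 0 := by
  rw [IsMinimalSystem] at h
  push Not at h
  obtain ⟨⟨p, hp⟩, h⟩ := h
  refine ⟨p, hp, fun f hf hq => ?_⟩
  let v : sonineSpace a := ⟨star f, star_mem_sonineSpace hf⟩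
  have hcl : IsClosed {u : sonineSpace a | inner ℂ v u = 0} :=
    isClosed_eq (innerSL ℂ v).continuous continuous_const
  have hsub : (Submodule.span ℂ (evaluators a I '' {j | j ≠ ⟨p, hp⟩}) : Set (sonineSpace a))
      ⊆ {u : sonineSpace a | inner ℂ v u = 0} := by
    intro u hu
    change inner ℂ v u = 0
    induction hu using Submodule.span_induction with
    | mem x hx =>
      obtain ⟨q, hqp, rfl⟩ := hx
      exact (inner_star_evaluator ha q.1.1 q.1.2 hf).trans
        (hq q.1 q.2 fun e => hqp (Subtype.ext e))
    | zero => exact inner_zero_right _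
    | add x y _ _ hx hy => rw [inner_add_right, hx, hy, add_zero]
    | smul c x _ hx => rw [inner_smul_right, hx, mul_zero]
  have h1 := closure_minimal hsub hcl h
  exact (inner_star_evaluator ha p.1 p.2 hf).symm.trans h1

theorem not_isMinimalSystem_of_isCompleteSystem {a : ℝ} {I : Set (ℂ × ℕ)} {p : ℂ × ℕ} (hp : p ∈ I)
    (h : IsCompleteSystem (evaluators a (I \ {p}))) : ¬ IsMinimalSystem (evaluators a I) := by
  intro hm
  refine hm ⟨p, hp⟩ ?_
  have hsub : range (evaluators a (I \ {p})) ⊆ evaluators a I '' {j | j ≠ ⟨p, hp⟩} := by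
    rintro _ ⟨⟨q, hq⟩, rfl⟩
    exact ⟨⟨q, hq.1⟩, fun e => hq.2 (congrArg Subtype.val e), rfl⟩
  have hd : Dense (Submodule.span ℂ (evaluators a I '' {j | j ≠ ⟨p, hp⟩}) : Set (sonineSpace a)) :=
    Dense.mono (Submodule.span_mono hsub) h
  exact hd _

/-! ### Dividing out a zero: square integrability of the quotient. -/

/-- Integration by parts against the sine. The factor `x⁻¹` gained here makes the bound integrable
against an `L²` function on `(a, ∞)`. -/
theorem norm_integral_cos_mul_cpow_le {x t₁ t₂ : ℝ} (hx : 0 < x) (h1 : 0 < t₁) (h12 : t₁ ≤ t₂)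
    {s : ℂ} (hs : 0 < s.re) :
    ‖∫ u in t₁..t₂, (Real.cos (2 * Real.pi * x * u) : ℂ) * (u : ℂ) ^ (-s)‖
      ≤ (2 * Real.pi * x)⁻¹ * (t₁ ^ (-s.re) * (2 + ‖s‖ / s.re)) := by
  set k : ℝ := 2 * Real.pi * x with hk
  have hk0 : 0 < k := by have := Real.pi_pos; positivity
  have hkc : (k : ℂ) ≠ 0 := by exact_mod_cast hk0.ne'
  have hpos : ∀ u ∈ uIcc t₁ t₂, 0 < u := fun u hu => by
    rw [uIcc_of_le h12] at hu
    exact h1.trans_le hu.1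
  have hsin : ∀ u : ℝ, ‖((Real.sin (k * u) / k : ℝ) : ℂ)‖ ≤ k⁻¹ := fun u => by
    rw [Complex.norm_real, Real.norm_eq_abs, abs_div, abs_of_pos hk0, div_eq_mul_inv]
    exact mul_le_of_le_one_left (inv_pos.2 hk0).le (Real.abs_sin_le_one _)
  have hs0 : -s ≠ 0 := fun h => by
    have : s = 0 := neg_eq_zero.1 h
    rw [this] at hs
    simp at hs
  have hd1 : ∀ u ∈ uIcc t₁ t₂,
      HasDerivAt (fun u : ℝ => (u : ℂ) ^ (-s)) (-s * (u : ℂ) ^ (-s - 1)) u := fun u hu => by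
    have := hasDerivAt_ofReal_cpow_const' (x := u) (hpos u hu).ne' (r := -s - 1)
      (by intro h; apply hs0; linear_combination h)
    have h3 := this.const_mul (-s)
    refine h3.congr_of_eventuallyEq (Eventually.of_forall fun v => ?_) |>.congr_deriv rfl
    have : -s - 1 + 1 = -s := by ring
    simp only [this]
    rw [mul_div_cancel₀ _ hs0]
  have hd2 : ∀ u ∈ uIcc t₁ t₂, HasDerivAt (fun u : ℝ => ((Real.sin (k * u) / k : ℝ) : ℂ))
      (Real.cos (k * u) : ℂ) u := fun u _ => by
    have h3 : HasDerivAt (fun u : ℝ => Real.sin (k * u) / k) (Real.cos (k * u)) u := by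
      have := (((hasDerivAt_id' u).const_mul k).sin).div_const k
      refine this.congr_deriv ?_
      field_simp
    exact h3.ofReal_comp
  have hc1 : ContinuousOn (fun u : ℝ => -s * (u : ℂ) ^ (-s - 1)) (uIcc t₁ t₂) := fun u hu =>
    ((Complex.continuousAt_ofReal_cpow_const u _ (Or.inr (hpos u hu).ne')).const_mul _
      ).continuousWithinAt
  have hi1 : IntervalIntegrable (fun u : ℝ => -s * (u : ℂ) ^ (-s - 1)) volume t₁ t₂ :=
    hc1.intervalIntegrable
  have hi2 : IntervalIntegrable (fun u : ℝ => (Real.cos (k * u) : ℂ)) volume t₁ t₂ :=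
    Continuous.intervalIntegrable (by fun_prop) _ _
  have hibp := intervalIntegral.integral_mul_deriv_eq_deriv_mul hd1 hd2 hi1 hi2
  have e : ∫ u in t₁..t₂, (Real.cos (k * u) : ℂ) * (u : ℂ) ^ (-s)
      = ∫ u in t₁..t₂, (u : ℂ) ^ (-s) * (Real.cos (k * u) : ℂ) := by
    congr 1
    ext u
    ring
  rw [e, hibp]
  have hn : ∀ u : ℝ, 0 < u → ‖(u : ℂ) ^ (-s)‖ = u ^ (-s.re) := fun u hu => by
    rw [Complex.norm_cpow_eq_rpow_re_of_pos hu, Complex.neg_re]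
  have h2 : 0 < t₂ := h1.trans_le h12
  have hmono : t₂ ^ (-s.re) ≤ t₁ ^ (-s.re) := Real.rpow_le_rpow_of_nonpos h1 h12 (by linarith)
  have b1 : ‖((t₂ : ℂ)) ^ (-s) * ((Real.sin (k * t₂) / k : ℝ) : ℂ)‖ ≤ t₁ ^ (-s.re) * k⁻¹ := by
    rw [norm_mul, hn _ h2]
    exact mul_le_mul hmono (hsin _) (norm_nonneg _) (Real.rpow_nonneg h1.le _)
  have b2 : ‖((t₁ : ℂ)) ^ (-s) * ((Real.sin (k * t₁) / k : ℝ) : ℂ)‖ ≤ t₁ ^ (-s.re) * k⁻¹ := by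
    rw [norm_mul, hn _ h1]
    exact mul_le_mul le_rfl (hsin _) (norm_nonneg _) (Real.rpow_nonneg h1.le _)
  have b3 : ‖∫ u in t₁..t₂, -s * (u : ℂ) ^ (-s - 1) * ((Real.sin (k * u) / k : ℝ) : ℂ)‖
      ≤ ‖s‖ * k⁻¹ * (t₁ ^ (-s.re) / s.re) := by
    have hint : IntervalIntegrable (fun u : ℝ => ‖s‖ * k⁻¹ * u ^ (-s.re - 1)) volume t₁ t₂ := by
      refine ContinuousOn.intervalIntegrable fun u hu => ?_
      exact ((Real.continuousAt_rpow_const u _ (Or.inl (hpos u hu).ne')).const_mul _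
        ).continuousWithinAt
    refine (intervalIntegral.norm_integral_le_of_norm_le h12 (ae_of_all _ fun u hu => ?_) hint
      ).trans ?_
    · have hu0 : 0 < u := h1.trans hu.1
      rw [norm_mul, norm_mul, norm_neg, Complex.norm_cpow_eq_rpow_re_of_pos hu0, Complex.sub_re,
        Complex.neg_re, Complex.one_re, mul_right_comm]
      have := hsin u
      gcongr
    · rw [intervalIntegral.integral_const_mul, integral_rpow]
      · refine mul_le_mul_of_nonneg_left ?_ (by positivity)
        have : -s.re - 1 + 1 = -s.re := by ring
        rw [this, div_neg, ← neg_div, neg_sub]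
        refine div_le_div_of_nonneg_right ?_ hs.le
        have := Real.rpow_nonneg h2.le (-s.re)
        linarith
      · right
        refine ⟨by linarith, fun h0 => ?_⟩
        exact lt_irrefl _ (hpos 0 h0)
  refine (norm_sub_le _ _).trans ((add_le_add (norm_sub_le _ _) le_rfl).trans ?_)
  refine (add_le_add (add_le_add b1 b2) b3).trans (le_of_eq ?_)
  ring

/-- Integrals of `f(u) u^{-s}` over bounded intervals are small because `f` is the cosine
transform of a function vanishing near the origin. -/
theorem exists_norm_integral_mul_cpow_le {a : ℝ} (ha : 0 < a) {f : K} (hf : f ∈ sonineSpace a) :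
    ∃ D, 0 ≤ D ∧ ∀ t₁ t₂ : ℝ, 0 < t₁ → t₁ ≤ t₂ → ∀ s : ℂ, 0 < s.re →
      ‖∫ u in Ioc t₁ t₂, f u * (u : ℂ) ^ (-s)‖ ≤ D * (t₁ ^ (-s.re) * (2 + ‖s‖ / s.re)) := by
  set φ := cosineTransform f with hφ
  have hm := memLp_cpow_Ioi ha (s := 1) (by norm_num)
  have hsub : Ioi a ⊆ Ioi (0 : ℝ) := Ioi_subset_Ioi ha.le
  have hint := (integrableOn_mul_of_memLp φ hsub hm).norm
  -- The constant is `π⁻¹ ∫_a^∞ |φ(x)| x⁻¹ dx`, finite by Cauchy–Schwarz; it appears when Parseval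
  -- moves the integral to `φ`, which lives on `(a, ∞)`.
  refine ⟨Real.pi⁻¹ * ∫ x in Ioi a, ‖φ x * (x : ℂ) ^ (-1 : ℂ)‖, ?_, ?_⟩
  · exact mul_nonneg (inv_pos.2 Real.pi_pos).le (integral_nonneg fun x => norm_nonneg _)
  intro t₁ t₂ h1 h12 s hs
  set ψ : ℝ → ℂ := (Ioc t₁ t₂).indicator fun u => (u : ℂ) ^ (-s) with hψ
  have hsub2 : Ioc t₁ t₂ ⊆ Ioi (0 : ℝ) := fun u hu => h1.trans hu.1
  have hrest : halfLine.restrict (Ioc t₁ t₂) = volume.restrict (Ioc t₁ t₂) := by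
    rw [Measure.restrict_restrict measurableSet_Ioc, inter_eq_left.2 hsub2]
  have hfin : IsFiniteMeasure (halfLine.restrict (Ioc t₁ t₂)) := by
    rw [hrest]
    infer_instance
  have hbdd : MemLp (fun u : ℝ => (u : ℂ) ^ (-s)) ∞ (halfLine.restrict (Ioc t₁ t₂)) := by
    have hmeas : AEStronglyMeasurable (fun u : ℝ => (u : ℂ) ^ (-s))
        (halfLine.restrict (Ioc t₁ t₂)) :=
      (aestronglyMeasurable_cpow (-s) (le_refl (0 : ℝ))).mono_measure Measure.restrict_le_self
    refine memLp_top_of_bound hmeas (t₁ ^ (-s.re)) ?_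
    filter_upwards [ae_restrict_mem measurableSet_Ioc] with u hu
    have hu0 : 0 < u := h1.trans hu.1
    rw [Complex.norm_cpow_eq_rpow_re_of_pos hu0, Complex.neg_re]
    exact Real.rpow_le_rpow_of_nonpos h1 hu.1.le (by linarith)
  have hψ2 : MemLp ψ 2 halfLine :=
    (memLp_indicator_iff_restrict measurableSet_Ioc).2 (hbdd.mono_exponent le_top)
  have hψ1 : Integrable ψ halfLine :=
    memLp_one_iff_integrable.1
      ((memLp_indicator_iff_restrict measurableSet_Ioc).2 (hbdd.mono_exponent le_top))
  have hind : ∀ c : ℝ → ℂ, ∫ u in Ioi (0 : ℝ), c u * ψ u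
      = ∫ u in Ioc t₁ t₂, c u * (u : ℂ) ^ (-s) := by
    intro c
    have : ∀ u, c u * ψ u = (Ioc t₁ t₂).indicator (fun u => c u * (u : ℂ) ^ (-s)) u := fun u => by
      by_cases hu : u ∈ Ioc t₁ t₂ <;> simp [hψ, hu]
    simp only [this]
    rw [integral_indicator measurableSet_Ioc, hrest]
  rw [← hind, integral_mul_eq_integral_cosineTransform_mul f hψ1 hψ2,
    setIntegral_Ioi_eq_of_mem_vanishing ha.le hf.2, mul_right_comm, ← integral_const_mul]
  refine norm_integral_le_of_norm_le (hint.const_mul _) ?_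
  filter_upwards [ae_restrict_mem measurableSet_Ioi] with x hx
  have hx0 : 0 < x := ha.trans hx
  have hc : ‖cosInt ψ x‖ ≤ 2 * ((2 * Real.pi * x)⁻¹ * (t₁ ^ (-s.re) * (2 + ‖s‖ / s.re))) := by
    rw [cosInt, norm_mul, Complex.norm_ofNat, hind, ← intervalIntegral.integral_of_le h12]
    exact mul_le_mul_of_nonneg_left (norm_integral_cos_mul_cpow_le hx0 h1 h12 hs) zero_le_two
  rw [norm_mul, norm_mul, Complex.norm_cpow_eq_rpow_re_of_pos hx0, Complex.neg_re, Complex.one_re,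
    Real.rpow_neg_one]
  refine (mul_le_mul_of_nonneg_left hc (norm_nonneg _)).trans (le_of_eq ?_)
  have := Real.pi_pos
  field_simp
  rw [hφ]

theorem gammaFactor_ne_zero {s : ℂ} (hs : 0 < s.re) :
    (Real.pi : ℂ) ^ (-s / 2) * Complex.Gamma (s / 2) ≠ 0 := by
  refine mul_ne_zero ?_ (Complex.Gamma_ne_zero_of_re_pos (by simpa using hs))
  rw [Complex.cpow_def_of_ne_zero (by exact_mod_cast Real.pi_ne_zero)]
  exact Complex.exp_ne_zero _

theorem continuousAt_gammaFactor {s : ℂ} (hs : 0 < s.re) :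
    ContinuousAt (fun s : ℂ => (Real.pi : ℂ) ^ (-s / 2) * Complex.Gamma (s / 2)) s := by
  have h1 : ContinuousAt (fun s : ℂ => (Real.pi : ℂ) ^ (-s / 2)) s := by
    refine ContinuousAt.const_cpow (by fun_prop) (Or.inl (by exact_mod_cast Real.pi_ne_zero))
  have h2 : ContinuousAt (fun s : ℂ => Complex.Gamma (s / 2)) s := by
    have : ContinuousAt Complex.Gamma (s / 2) := by
      refine (Complex.differentiableAt_Gamma _ fun m h => ?_).continuousAt
      have h3 := congrArg Complex.re h
      simp at h3
      have : (0 : ℝ) ≤ m := Nat.cast_nonneg m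
      linarith
    exact ContinuousAt.comp (f := fun s : ℂ => s / 2) this (by fun_prop)
  exact h1.mul h2

theorem integrableOn_mul_cpow_Ioc {a : ℝ} (ha : 0 < a) (f : K) (s : ℂ) (t : ℝ) :
    IntegrableOn (fun u => f u * (u : ℂ) ^ (-s)) (Ioc a t) := by
  have hc : ContinuousOn (fun u : ℝ => (u : ℂ) ^ (-s)) (Icc a t) := fun u hu =>
    (Complex.continuousAt_ofReal_cpow_const u _ (Or.inr (ha.trans_le hu.1).ne')
      ).continuousWithinAt
  obtain ⟨C, hC⟩ := isCompact_Icc.exists_bound_of_continuousOn hc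
  refine Integrable.mul_bdd (c := C) (integrableOn_Ioc f ha.le) ?_ ?_
  · exact (hc.mono Ioc_subset_Icc_self).aestronglyMeasurable measurableSet_Ioc
  · filter_upwards [ae_restrict_mem measurableSet_Ioc] with u hu
    exact hC u (Ioc_subset_Icc_self hu)

theorem tendsto_integral_mul_cpow {a : ℝ} (ha : 0 < a) (f : K) (w : ℂ) (t : ℝ) :
    Tendsto (fun ε : ℝ => ∫ u in Ioc a t, f u * (u : ℂ) ^ (-(w + ε))) (𝓝[>] 0)
      (𝓝 (∫ u in Ioc a t, f u * (u : ℂ) ^ (-w))) := by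
  set C : ℝ := max 1 (a ^ (-1 : ℝ)) with hC
  refine tendsto_integral_filter_of_dominated_convergence
    (fun u => ‖f u * (u : ℂ) ^ (-w)‖ * C) ?_ ?_ ?_ ?_
  · exact Eventually.of_forall fun ε => (integrableOn_mul_cpow_Ioc ha f _ t).1
  · filter_upwards [Ioc_mem_nhdsGT one_pos] with ε hε
    filter_upwards [ae_restrict_mem measurableSet_Ioc] with u hu
    have hu0 : 0 < u := ha.trans hu.1
    have hu0' : (u : ℂ) ≠ 0 := by exact_mod_cast hu0.ne'
    rw [neg_add, Complex.cpow_add _ _ hu0', ← mul_assoc, norm_mul]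
    refine mul_le_mul_of_nonneg_left ?_ (norm_nonneg _)
    rw [Complex.norm_cpow_eq_rpow_re_of_pos hu0, Complex.neg_re, Complex.ofReal_re]
    rcases le_total 1 u with h1 | h1
    · exact (Real.rpow_le_one_of_one_le_of_nonpos h1 (by linarith [hε.1])).trans (le_max_left _ _)
    · calc u ^ (-ε) ≤ u ^ (-1 : ℝ) :=
            Real.rpow_le_rpow_of_exponent_ge hu0 h1 (by linarith [hε.2])
        _ ≤ a ^ (-1 : ℝ) := Real.rpow_le_rpow_of_nonpos ha hu.1.le (by norm_num)
        _ ≤ C := le_max_right _ _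
  · exact (integrableOn_mul_cpow_Ioc ha f w t).norm.mul_const C
  · filter_upwards [ae_restrict_mem measurableSet_Ioc] with u hu
    have hu0' : (u : ℂ) ≠ 0 := by exact_mod_cast (ha.trans hu.1).ne'
    refine Tendsto.const_mul _ ?_
    have : ContinuousAt (fun ε : ℝ => (u : ℂ) ^ (-(w + ε))) 0 :=
      ContinuousAt.const_cpow (by fun_prop) (Or.inl hu0')
    have h2 := this.tendsto
    simp only [Complex.ofReal_zero, add_zero] at h2
    exact h2.mono_left nhdsWithin_le_nhds

theorem rightMellin_eq_integral_add {a : ℝ} (ha : 0 < a) {f : K} (hf : f ∈ sonineSpace a) {s : ℂ}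
    (hs : 1 / 2 < s.re) {t : ℝ} (hat : a ≤ t) :
    rightMellin f s = (∫ u in Ioc a t, f u * (u : ℂ) ^ (-s))
      + ∫ u in Ioi t, f u * (u : ℂ) ^ (-s) := by
  have hint := integrable_mul_of_mem_vanishing ha hf.1 (memLp_cpow_Ioi ha hs)
  rw [rightMellin, setIntegral_Ioi_eq_of_mem_vanishing ha.le hf.1, ← Ioc_union_Ioi_eq_Ioi hat]
  refine setIntegral_union (Ioc_disjoint_Ioi le_rfl) measurableSet_Ioi
    (integrableOn_mul_cpow_Ioc ha f s t)
    (IntegrableOn.mono_set hint (Ioi_subset_Ioi (ha.le.trans hat)))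

/-- If the completed Mellin transform vanishes at `w`, `Re w ≥ 1/2`, then the partial integrals
`∫_a^t f(u) u^{-w} du` are `O(t^{-Re w})`. -/
theorem exists_norm_partial_integral_le {a : ℝ} (ha : 0 < a) {f : K} (hf : f ∈ sonineSpace a) {w : ℂ}
    (hw : 1 / 2 ≤ w.re) (h0 : completedMellin f w = 0) :
    ∃ D, 0 ≤ D ∧ ∀ t, a ≤ t → ‖∫ u in Ioc a t, f u * (u : ℂ) ^ (-w)‖ ≤ D * t ^ (-w.re) := by
  have hw0 : 0 < w.re := by linarith
  obtain ⟨D, hD, hb⟩ := exists_norm_integral_mul_cpow_le ha hf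
  refine ⟨D * (2 + ‖w‖ / w.re), by positivity, fun t hat => ?_⟩
  have ht : 0 < t := ha.trans_le hat
  have htail : ∀ s : ℂ, 1 / 2 < s.re →
      ‖∫ u in Ioi t, f u * (u : ℂ) ^ (-s)‖ ≤ D * (t ^ (-s.re) * (2 + ‖s‖ / s.re)) := by
    intro s hs
    have hint := integrable_mul_of_mem_vanishing ha hf.1 (memLp_cpow_Ioi ha hs)
    have hlim := intervalIntegral_tendsto_integral_Ioi t
      (IntegrableOn.mono_set hint (Ioi_subset_Ioi ht.le)) tendsto_id
    refine le_of_tendsto hlim.norm ?_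
    filter_upwards [eventually_ge_atTop t] with T hT
    rw [id, intervalIntegral.integral_of_le hT]
    exact hb t T ht hT s (by linarith)
  have hre : ∀ ε : ℝ, (w + ε).re = w.re + ε := fun ε => by simp
  have hcont : ContinuousAt (fun ε : ℝ => w + (ε : ℂ)) 0 := by fun_prop
  have hlim0 : Tendsto (fun ε : ℝ => w + (ε : ℂ)) (𝓝[>] 0) (𝓝 w) := by
    have := hcont.tendsto
    simp only [Complex.ofReal_zero, add_zero] at this
    exact this.mono_left nhdsWithin_le_nhds
  -- On the line `Re w = 1/2` the integral for `rightMellin` need not converge absolutely, so `w` is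
  -- approached as `w + ε`. There the partial integral is `rightMellin` minus a tail, and
  -- `rightMellin` tends to `0` because the gamma factor does not vanish at `w`.
  have hR : Tendsto (fun ε : ℝ => rightMellin f (w + ε)) (𝓝[>] 0) (𝓝 0) := by
    have h1 := ((differentiable_completedMellin ha hf).continuous.tendsto w).comp hlim0
    have h2 := (continuousAt_gammaFactor hw0).tendsto.comp hlim0
    have h3 := h1.div h2 (gammaFactor_ne_zero hw0)
    rw [h0, zero_div] at h3
    refine h3.congr' ?_
    filter_upwards [self_mem_nhdsWithin] with ε hε
    have hε : 0 < ε := hε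
    have hs : 1 / 2 < (w + ε).re := by rw [hre]; linarith
    simp only [Function.comp_apply, Pi.div_apply]
    rw [completedMellin_eq_rightMellin ha hf hs]
    exact mul_div_cancel_left₀ _ (gammaFactor_ne_zero (by linarith))
  have hI := tendsto_integral_mul_cpow ha f w t
  have hB : Tendsto (fun ε : ℝ => ‖rightMellin f (w + ε)‖
      + D * (t ^ (-(w + ε).re) * (2 + ‖w + ε‖ / (w + ε).re))) (𝓝[>] 0)
      (𝓝 (‖(0 : ℂ)‖ + D * (t ^ (-w.re) * (2 + ‖w‖ / w.re)))) := by
    have hre' := (Complex.continuous_re.tendsto w).comp hlim0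
    refine hR.norm.add (Tendsto.const_mul _ (Tendsto.mul ?_ (Tendsto.const_add _ ?_)))
    · exact Tendsto.rpow tendsto_const_nhds hre'.neg (Or.inl ht.ne')
    · exact hlim0.norm.div hre' hw0.ne'
  have := le_of_tendsto_of_tendsto hI.norm hB ?_
  · rw [norm_zero, zero_add] at this
    refine this.trans (le_of_eq ?_)
    ring
  · filter_upwards [self_mem_nhdsWithin] with ε hε
    have hε : 0 < ε := hε
    have hs : 1 / 2 < (w + ε).re := by rw [hre]; linarith
    have e := rightMellin_eq_integral_add ha hf hs hat
    rw [eq_sub_of_add_eq e.symm]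
    exact (norm_sub_le _ _).trans (add_le_add le_rfl (htail _ hs))

/-- The function `t ↦ ∫₀¹ f(λt) λ^{-w} dλ = t^{w-1} ∫₀ᵗ f(u) u^{-w} du`. -/
noncomputable def mellinPrimitive (w : ℂ) (f : ℝ → ℂ) (t : ℝ) : ℂ :=
  ∫ l in Ioc (0 : ℝ) 1, f (l * t) * (l : ℂ) ^ (-w)

theorem mellinPrimitive_eq {t : ℝ} (ht : 0 < t) (w : ℂ) (f : ℝ → ℂ) :
    mellinPrimitive w f t = (t : ℂ) ^ (w - 1) * ∫ u in Ioc 0 t, f u * (u : ℂ) ^ (-w) := by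
  have ht' : (t : ℂ) ≠ 0 := by exact_mod_cast ht.ne'
  have h := intervalIntegral.integral_comp_mul_right
    (fun u : ℝ => f u * (u : ℂ) ^ (-w)) (a := 0) (b := 1) ht.ne'
  rw [zero_mul, one_mul, intervalIntegral.integral_of_le zero_le_one,
    intervalIntegral.integral_of_le ht.le] at h
  have e : ∫ l in Ioc (0 : ℝ) 1, f (l * t) * ((l * t : ℝ) : ℂ) ^ (-w)
      = (∫ l in Ioc (0 : ℝ) 1, f (l * t) * (l : ℂ) ^ (-w)) * (t : ℂ) ^ (-w) := by
    rw [← integral_mul_const]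
    refine setIntegral_congr_fun measurableSet_Ioc fun l hl => ?_
    rw [Complex.ofReal_mul, Complex.mul_cpow_ofReal_nonneg hl.1.le ht.le]
    ring
  rw [e, Complex.real_smul, Complex.cpow_neg] at h
  have h3 : (t : ℂ) ^ w ≠ 0 := by
    rw [Complex.cpow_def_of_ne_zero ht']
    exact Complex.exp_ne_zero _
  rw [mellinPrimitive, Complex.cpow_sub _ _ ht', Complex.cpow_one]
  rw [← div_eq_mul_inv, div_eq_iff h3] at h
  rw [h]
  push_cast
  ring

theorem setIntegral_Ioc_eq_of_mem_vanishing {a t : ℝ} (ha : 0 ≤ a) {f : K} (h : f ∈ vanishing a)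
    (ψ : ℝ → ℂ) : ∫ u in Ioc 0 t, f u * ψ u = ∫ u in Ioc a t, f u * ψ u := by
  refine setIntegral_eq_of_subset_of_ae_sdiff_eq_zero measurableSet_Ioc.nullMeasurableSet
    (Ioc_subset_Ioc_left ha) ?_
  have h1 := (ae_restrict_iff' measurableSet_Ioi).1 (ae_eq_zero_of_mem_vanishing h)
  have h2 : ∀ᵐ t : ℝ, t ≠ a := by
    rw [ae_iff]
    simp
  filter_upwards [h1, h2] with u h1 h2 hu
  have h3 : u ≤ a := by
    by_contra h
    exact hu.2 ⟨not_le.1 h, hu.1.2⟩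
  rw [h1 hu.1.1 (lt_of_le_of_ne h3 h2), zero_mul]

theorem stronglyMeasurable_cpow (s : ℂ) : StronglyMeasurable (fun u : ℝ => (u : ℂ) ^ s) := by
  refine Measurable.stronglyMeasurable ?_
  fun_prop

theorem stronglyMeasurable_mellinPrimitive (w : ℂ) (f : K) :
    StronglyMeasurable (mellinPrimitive w f) := by
  have hf : StronglyMeasurable f := Lp.stronglyMeasurable f
  have h : StronglyMeasurable (fun p : ℝ × ℝ => f (p.2 * p.1) * (p.2 : ℂ) ^ (-w)) := by
    refine StronglyMeasurable.mul (hf.comp_measurable (by fun_prop)) ?_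
    exact (stronglyMeasurable_cpow (-w)).comp_measurable measurable_snd
  exact h.integral_prod_right

theorem mellinPrimitive_eq_zero {a : ℝ} {f : K} (h : f ∈ vanishing a) (ha : 0 ≤ a) (w : ℂ) {t : ℝ}
    (ht : 0 < t) (hta : t ≤ a) : mellinPrimitive w f t = 0 := by
  rw [mellinPrimitive_eq ht, setIntegral_Ioc_eq_of_mem_vanishing ha h, Ioc_eq_empty (not_lt.2 hta)]
  simp

/-- The primitive is `t^{w-1}` times a partial integral of size `O(t^{-Re w})`, hence `O(t⁻¹)`; it
is zero on `(0, a]`. -/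
theorem memLp_mellinPrimitive {a : ℝ} (ha : 0 < a) {f : K} (hf : f ∈ sonineSpace a) {w : ℂ}
    (hw : 1 / 2 ≤ w.re) (h0 : completedMellin f w = 0) :
    MemLp (mellinPrimitive w f) 2 halfLine := by
  obtain ⟨D, hD, hb⟩ := exists_norm_partial_integral_le ha hf hw h0
  have hm : AEStronglyMeasurable (mellinPrimitive w f) (volume.restrict (Ioi a)) :=
    (stronglyMeasurable_mellinPrimitive w f).aestronglyMeasurable
  have hbase : MemLp (fun t : ℝ => (D : ℂ) * (t : ℂ) ^ (-1 : ℂ)) 2 (volume.restrict (Ioi a)) :=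
    (memLp_cpow_Ioi ha (s := 1) (by norm_num)).const_mul _
  have h1 : MemLp (mellinPrimitive w f) 2 (volume.restrict (Ioi a)) := by
    refine hbase.of_le hm ?_
    filter_upwards [ae_restrict_mem measurableSet_Ioi] with t ht
    have hat : a < t := ht
    have ht0 : 0 < t := ha.trans hat
    rw [mellinPrimitive_eq ht0, setIntegral_Ioc_eq_of_mem_vanishing ha.le hf.1, norm_mul, norm_mul,
      Complex.norm_cpow_eq_rpow_re_of_pos ht0, Complex.norm_cpow_eq_rpow_re_of_pos ht0,
      Complex.norm_real, Real.norm_eq_abs, abs_of_nonneg hD]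
    refine (mul_le_mul_of_nonneg_left (hb t hat.le) (Real.rpow_nonneg ht0.le _)).trans
      (le_of_eq ?_)
    rw [mul_left_comm, ← Real.rpow_add ht0]
    congr 2
    simp only [Complex.sub_re, Complex.one_re, Complex.neg_re]
    ring
  have h2 : MemLp ((Ioi a).indicator (mellinPrimitive w f)) 2 halfLine := by
    rw [memLp_indicator_iff_restrict measurableSet_Ioi, Measure.restrict_restrict measurableSet_Ioi,
      inter_eq_left.2 (Ioi_subset_Ioi ha.le)]
    exact h1
  refine (memLp_congr_ae ?_).1 h2
  filter_upwards [ae_restrict_mem measurableSet_Ioi] with t ht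
  by_cases hta : t ∈ Ioi a
  · rw [indicator_of_mem hta]
  · rw [indicator_of_notMem hta, mellinPrimitive_eq_zero hf.1 ha.le w ht (not_lt.1 hta)]

/-! ### Dividing out a zero: transforms of the primitive and membership in the Sonine space. -/

theorem integral_norm_mul_gauss_le {a : ℝ} (ha : 0 < a) {f : K} (hf : f ∈ vanishing a) {x : ℝ}
    (hx : 0 < x) :
    ∫ t in Ioi (0 : ℝ), ‖f t‖ * gauss x t ≤ ‖f‖ * (gauss x a / Real.sqrt x) := by
  have h1 : ∫ t in Ioi (0 : ℝ), ‖f t‖ * gauss x t = ∫ t in Ioi a, ‖f t‖ * gauss x t := by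
    refine setIntegral_eq_of_subset_of_ae_sdiff_eq_zero measurableSet_Ioi.nullMeasurableSet
      (Ioi_subset_Ioi ha.le) ?_
    have h1 := (ae_restrict_iff' measurableSet_Ioi).1 (ae_eq_zero_of_mem_vanishing hf)
    have h2 : ∀ᵐ t : ℝ, t ≠ a := by
      rw [ae_iff]
      simp
    filter_upwards [h1, h2] with t h1 h2 ht
    rw [h1 ht.1 (lt_of_le_of_ne (not_lt.1 ht.2) h2), norm_zero, zero_mul]
  have h2 := norm_setIntegral_mul_le f measurableSet_Ioi (Ioi_subset_Ioi ha.le)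
    (memLp_gauss_Ioi hx ha.le)
  have h3 : ∀ t, ‖(gauss x t : ℂ)‖ = gauss x t := fun t => by
    rw [Complex.norm_real, Real.norm_eq_abs, abs_of_pos (gauss_pos _ _)]
  rw [h1]
  refine le_trans ?_ (h2.trans (mul_le_mul_of_nonneg_left (sqrt_integral_gauss_le hx ha.le)
    (norm_nonneg _)))
  simp only [h3]
  exact le_rfl

theorem integral_comp_mul_left_mul_gauss (h : ℝ → ℂ) {l : ℝ} (hl : 0 < l) (x : ℝ) :
    ∫ t in Ioi (0 : ℝ), h (l * t) * gauss x t = (l : ℂ)⁻¹ * gaussTransform h (x * l⁻¹) := by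
  have h1 := integral_comp_mul_left_Ioi (fun t => h t * gauss (x * l⁻¹) t) 0 hl
  rw [mul_zero] at h1
  have e : ∀ t, (h (l * t) * gauss (x * l⁻¹) (l * t) : ℂ) = h (l * t) * gauss x t := by
    intro t
    rw [gauss_mul, inv_mul_cancel_right₀ hl.ne']
  simp only [e] at h1
  rw [gaussTransform, h1, Complex.real_smul, Complex.ofReal_inv]

/-- The Fubini condition for the next formulas. Near `l = 0` the powers of `l` are absorbed by the
Gaussian `gauss (x * l⁻¹) a`, smaller than any power of `l`; this is where the gap `(0, a)` of `f`
matters. -/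
theorem integrable_dilation_mul_gauss {a : ℝ} (ha : 0 < a) {f : K} (hf : f ∈ vanishing a) (w : ℂ)
    {x : ℝ} (hx : 0 < x) :
    Integrable (Function.uncurry fun t l : ℝ => f (l * t) * (l : ℂ) ^ (-w) * gauss x t)
      (halfLine.prod (volume.restrict (Ioc 0 1))) := by
  have hm : AEStronglyMeasurable
      (Function.uncurry fun t l : ℝ => f (l * t) * (l : ℂ) ^ (-w) * gauss x t)
      (halfLine.prod (volume.restrict (Ioc 0 1))) := by
    have m1 : StronglyMeasurable (fun p : ℝ × ℝ => f (p.2 * p.1)) :=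
      (Lp.stronglyMeasurable f).comp_measurable (by fun_prop)
    have m2 : StronglyMeasurable (fun p : ℝ × ℝ => (p.2 : ℂ) ^ (-w)) :=
      (stronglyMeasurable_cpow (-w)).comp_measurable measurable_snd
    have m3 : StronglyMeasurable (fun p : ℝ × ℝ => (gauss x p.1 : ℂ)) := by
      refine Continuous.stronglyMeasurable ?_
      unfold gauss
      fun_prop
    exact ((m1.mul m2).mul m3).aestronglyMeasurable
  obtain ⟨C, hC, hg⟩ := exists_gauss_le_rpow (mul_pos hx ha) (-(w.re + 1))
  rw [integrable_prod_iff' hm]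
  constructor
  · filter_upwards [ae_restrict_mem measurableSet_Ioc] with l hl
    have h1 := (memLp_comp_mul_left hl.1 f).integrable_mul (memLp_gauss hx)
    refine (h1.mul_const ((l : ℂ) ^ (-w))).congr (ae_of_all _ fun t => ?_)
    simp only [Function.uncurry, Pi.mul_apply]
    ring
  · refine Integrable.mono' (g := fun _ => ‖f‖ * C / Real.sqrt x) (integrable_const _) ?_ ?_
    · exact hm.norm.prod_swap.integral_prod_right'
    · filter_upwards [ae_restrict_mem measurableSet_Ioc] with l hl
      have hl0 := hl.1
      rw [Real.norm_eq_abs, abs_of_nonneg (integral_nonneg fun t => norm_nonneg _)]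
      have e : ∀ t, ‖Function.uncurry (fun t l : ℝ => f (l * t) * (l : ℂ) ^ (-w) * gauss x t) (t, l)‖
          = l ^ (-w.re) * (‖f (l * t)‖ * gauss (x * l⁻¹) (l * t)) := fun t => by
        simp only [Function.uncurry]
        rw [norm_mul, norm_mul, Complex.norm_cpow_eq_rpow_re_of_pos hl0, Complex.norm_real,
          Real.norm_eq_abs, abs_of_pos (gauss_pos _ _), gauss_mul, inv_mul_cancel_right₀ hl0.ne',
          Complex.neg_re]
        ring
      simp only [e]
      have h1 := integral_comp_mul_left_Ioi (fun t => ‖f t‖ * gauss (x * l⁻¹) t) 0 hl0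
      rw [mul_zero] at h1
      rw [integral_const_mul, h1, smul_eq_mul]
      have hy : 0 < x * l⁻¹ := by positivity
      have h2 := integral_norm_mul_gauss_le ha hf hy
      have hli : 1 ≤ l⁻¹ := (one_le_inv₀ hl0).2 hl.2
      have h3 : gauss (x * l⁻¹) a ≤ C * l ^ (w.re + 1) := by
        have : gauss (x * l⁻¹) a = gauss l⁻¹ (x * a) := by
          rw [gauss_comm, mul_comm, gauss_mul, gauss_comm]
          simp only [gauss]
          ring_nf
        rw [this]
        have := hg _ hli
        rwa [Real.inv_rpow hl0.le, Real.rpow_neg hl0.le, inv_inv] at this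
      have h4 : Real.sqrt x ≤ Real.sqrt (x * l⁻¹) :=
        Real.sqrt_le_sqrt (le_mul_of_one_le_right hx.le hli)
      have hsx : 0 < Real.sqrt x := Real.sqrt_pos.2 hx
      calc l ^ (-w.re) * (l⁻¹ * ∫ t in Ioi (0 : ℝ), ‖f t‖ * gauss (x * l⁻¹) t)
          ≤ l ^ (-w.re) * (l⁻¹ * (‖f‖ * (C * l ^ (w.re + 1) / Real.sqrt x))) := by
            refine mul_le_mul_of_nonneg_left (mul_le_mul_of_nonneg_left (h2.trans ?_)
              (inv_pos.2 hl0).le) (Real.rpow_nonneg hl0.le _)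
            refine mul_le_mul_of_nonneg_left ?_ (norm_nonneg _)
            exact div_le_div₀ (by positivity) h3 hsx h4
        _ = ‖f‖ * C / Real.sqrt x := by
            rw [Real.rpow_add hl0, Real.rpow_one, Real.rpow_neg hl0.le]
            have : 0 < l ^ w.re := Real.rpow_pos_of_pos hl0 _
            field_simp

theorem cpow_neg_mul_inv {l : ℝ} (hl : 0 < l) (w : ℂ) :
    (l : ℂ) ^ (-w) * (l : ℂ)⁻¹ = (l : ℂ) ^ (-w - 1) := by
  have hl' : (l : ℂ) ≠ 0 := by exact_mod_cast hl.ne'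
  rw [Complex.cpow_sub _ _ hl', Complex.cpow_one, div_eq_mul_inv]

theorem gaussTransform_mellinPrimitive {a : ℝ} (ha : 0 < a) {f : K} (hf : f ∈ vanishing a) (w : ℂ)
    {x : ℝ} (hx : 0 < x) :
    gaussTransform (mellinPrimitive w f) x
      = ∫ l in Ioc (0 : ℝ) 1, (l : ℂ) ^ (-w - 1) * gaussTransform f (x * l⁻¹) := by
  have h := integral_integral_swap (integrable_dilation_mul_gauss ha hf w hx)
  have e1 : gaussTransform (mellinPrimitive w f) x = ∫ t in Ioi (0 : ℝ),
      ∫ l in Ioc (0 : ℝ) 1, f (l * t) * (l : ℂ) ^ (-w) * gauss x t := by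
    rw [gaussTransform]
    congr 1
    ext t
    rw [integral_mul_const]
    rfl
  rw [e1, h]
  refine setIntegral_congr_fun measurableSet_Ioc fun l hl => ?_
  have e2 : ∀ t, f (l * t) * (l : ℂ) ^ (-w) * gauss x t
    = (l : ℂ) ^ (-w) * (f (l * t) * gauss x t) := fun t => by ring
  simp only [e2]
  rw [integral_const_mul, integral_comp_mul_left_mul_gauss _ hl.1, ← mul_assoc,
    cpow_neg_mul_inv hl.1]

theorem stronglyMeasurable_gaussTransform (f : K) : StronglyMeasurable (gaussTransform f) := by
  have h : StronglyMeasurable (fun p : ℝ × ℝ => f p.2 * (gauss p.1 p.2 : ℂ)) := by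
    refine StronglyMeasurable.mul ((Lp.stronglyMeasurable f).comp_measurable measurable_snd) ?_
    refine Continuous.stronglyMeasurable ?_
    unfold gauss
    fun_prop
  exact h.integral_prod_right

/-- The primitive is a superposition of dilations of `f`. On Mellin transforms they contribute the
factor `∫₀¹ l^{s-w-1} dl = 1/(s-w)`, convergent for `Re s > Re w`. -/
theorem mellin_gaussTransform_mellinPrimitive {a : ℝ} (ha : 0 < a) {f : K} (hf : f ∈ sonineSpace a)
    {w s : ℂ} (hs : w.re < s.re) :
    mellin (gaussTransform (mellinPrimitive w f)) s = mellin (gaussTransform f) s / (s - w) := by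
  have hconv := mellinConvergent_gaussTransform ha hf s
  set c : ℝ := ∫ x in Ioi (0 : ℝ), ‖(x : ℂ) ^ (s - 1) • gaussTransform f x‖ with hc
  have hconvl : ∀ l : ℝ, 0 < l → MellinConvergent (fun x => gaussTransform f (x * l⁻¹)) s := by
    intro l hl
    have := (MellinConvergent.comp_mul_left (f := gaussTransform f) (s := s) (inv_pos.2 hl)).2 hconv
    simpa only [mul_comm] using this
  have hl4 : ∀ l : ℝ, 0 < l → ((l⁻¹ : ℝ) : ℂ) ^ (-s) = (l : ℂ) ^ s := fun l hl => by
    rw [Complex.ofReal_inv, Complex.inv_cpow _ _ (by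
      rw [Complex.arg_ofReal_of_nonneg hl.le]; exact Real.pi_pos.ne), Complex.cpow_neg, inv_inv]
  have hval : ∀ l : ℝ, 0 < l → mellin (fun x => gaussTransform f (x * l⁻¹)) s
      = (l : ℂ) ^ s * mellin (gaussTransform f) s := fun l hl => by
    rw [mellin_comp_mul_right _ _ (inv_pos.2 hl), hl4 l hl, smul_eq_mul]
  have hnorm : ∀ l : ℝ, 0 < l → ∫ x in Ioi (0 : ℝ), ‖(x : ℂ) ^ (s - 1) • gaussTransform f (x * l⁻¹)‖
      = l ^ s.re * c := by
    intro l hl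
    have h1 := integral_comp_mul_right_Ioi'
      (fun x => ‖((x : ℝ) : ℂ) ^ (s - 1) • gaussTransform f x‖) 0 (inv_pos.2 hl)
    rw [zero_mul] at h1
    rw [hc, ← h1, smul_eq_mul, ← integral_const_mul, ← integral_const_mul]
    refine setIntegral_congr_fun measurableSet_Ioi fun x hx => ?_
    have hx : 0 < x := hx
    simp only [norm_smul]
    rw [Complex.norm_cpow_eq_rpow_re_of_pos hx,
      Complex.norm_cpow_eq_rpow_re_of_pos (mul_pos hx (inv_pos.2 hl)),
      Real.mul_rpow hx.le (inv_pos.2 hl).le, Complex.sub_re, Complex.one_re,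
      Real.inv_rpow hl.le, Real.rpow_sub_one hl.ne']
    have : 0 < l ^ s.re := Real.rpow_pos_of_pos hl _
    field_simp
  have hm : AEStronglyMeasurable (Function.uncurry fun x l : ℝ =>
      (x : ℂ) ^ (s - 1) * ((l : ℂ) ^ (-w - 1) * gaussTransform f (x * l⁻¹)))
      (halfLine.prod (volume.restrict (Ioc 0 1))) := by
    have m1 : StronglyMeasurable (fun p : ℝ × ℝ => (p.1 : ℂ) ^ (s - 1)) :=
      (stronglyMeasurable_cpow _).comp_measurable measurable_fst
    have m2 : StronglyMeasurable (fun p : ℝ × ℝ => (p.2 : ℂ) ^ (-w - 1)) :=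
      (stronglyMeasurable_cpow _).comp_measurable measurable_snd
    have m3 : StronglyMeasurable (fun p : ℝ × ℝ => gaussTransform f (p.1 * p.2⁻¹)) :=
      (stronglyMeasurable_gaussTransform f).comp_measurable (by fun_prop)
    exact (m1.mul (m2.mul m3)).aestronglyMeasurable
  have hprod : Integrable (Function.uncurry fun x l : ℝ =>
      (x : ℂ) ^ (s - 1) * ((l : ℂ) ^ (-w - 1) * gaussTransform f (x * l⁻¹)))
      (halfLine.prod (volume.restrict (Ioc 0 1))) := by
    rw [integrable_prod_iff' hm]
    constructor
    · filter_upwards [ae_restrict_mem measurableSet_Ioc] with l hl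
      refine ((hconvl l hl.1).const_mul ((l : ℂ) ^ (-w - 1))).congr (ae_of_all _ fun x => ?_)
      simp only [Function.uncurry, smul_eq_mul]
      ring
    · have hi : IntegrableOn (fun l : ℝ => l ^ (s.re - w.re - 1) * c) (Ioc 0 1) := by
        have := intervalIntegral.intervalIntegrable_rpow' (a := 0) (b := 1)
          (r := s.re - w.re - 1) (by linarith)
        rw [intervalIntegrable_iff_integrableOn_Ioc_of_le zero_le_one] at this
        exact this.mul_const c
      refine Integrable.congr hi ?_
      filter_upwards [ae_restrict_mem measurableSet_Ioc] with l hl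
      have e : ∀ x : ℝ, ‖Function.uncurry (fun x l : ℝ => (x : ℂ) ^ (s - 1) *
          ((l : ℂ) ^ (-w - 1) * gaussTransform f (x * l⁻¹))) (x, l)‖
          = l ^ (-w.re - 1) * ‖(x : ℂ) ^ (s - 1) • gaussTransform f (x * l⁻¹)‖ := fun x => by
        simp only [Function.uncurry, norm_mul, norm_smul]
        rw [Complex.norm_cpow_eq_rpow_re_of_pos hl.1, Complex.sub_re, Complex.neg_re,
          Complex.one_re]
        ring
      simp only [e]
      rw [integral_const_mul, hnorm l hl.1, ← mul_assoc, ← Real.rpow_add hl.1]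
      congr 2
      ring
  have hswap := integral_integral_swap hprod
  have e1 : mellin (gaussTransform (mellinPrimitive w f)) s = ∫ x in Ioi (0 : ℝ),
      ∫ l in Ioc (0 : ℝ) 1, (x : ℂ) ^ (s - 1) *
        ((l : ℂ) ^ (-w - 1) * gaussTransform f (x * l⁻¹)) := by
    rw [mellin]
    refine setIntegral_congr_fun measurableSet_Ioi fun x hx => ?_
    rw [gaussTransform_mellinPrimitive ha hf.1 w hx, integral_const_mul, smul_eq_mul]
  rw [e1, hswap]
  have e2 : ∫ l in Ioc (0 : ℝ) 1, ∫ x in Ioi (0 : ℝ), (x : ℂ) ^ (s - 1) *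
      ((l : ℂ) ^ (-w - 1) * gaussTransform f (x * l⁻¹))
      = ∫ l in Ioc (0 : ℝ) 1, (l : ℂ) ^ (s - w - 1) * mellin (gaussTransform f) s := by
    refine setIntegral_congr_fun measurableSet_Ioc fun l hl => ?_
    have hl' : (l : ℂ) ≠ 0 := by exact_mod_cast hl.1.ne'
    have e3 : ∀ x : ℝ, (x : ℂ) ^ (s - 1) * ((l : ℂ) ^ (-w - 1) * gaussTransform f (x * l⁻¹))
      = (l : ℂ) ^ (-w - 1) * ((x : ℂ) ^ (s - 1) • gaussTransform f (x * l⁻¹)) := fun x => by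
        rw [smul_eq_mul]
        ring
    simp only [e3]
    rw [integral_const_mul]
    change _ * mellin (fun x => gaussTransform f (x * l⁻¹)) s = _
    rw [hval l hl.1, ← mul_assoc, ← Complex.cpow_add _ _ hl']
    congr 2
    ring
  have hre : 0 < (s - w).re := by simpa using hs
  have hne : s - w ≠ 0 := fun h => by simp [h] at hre
  rw [e2, integral_mul_const, ← intervalIntegral.integral_of_le zero_le_one,
    integral_cpow (Or.inl (by simpa using hs)), sub_add_cancel]
  rw [Complex.ofReal_one, Complex.one_cpow, Complex.ofReal_zero, Complex.zero_cpow hne, sub_zero,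
    div_mul_eq_mul_div, one_mul]

/-- Decay at `0`, from that of the cosine transform at infinity. The factor `z` of the functional
equation is paid for by lowering the exponent from `a` to `b`. -/
theorem exists_norm_gaussTransform_inv_le {a b : ℝ} (hb : 0 < b) (hba : b < a) :
    ∃ C, 0 ≤ C ∧ ∀ f ∈ sonineSpace a, ∀ z, 1 ≤ z →
      ‖gaussTransform f z⁻¹‖ ≤ C * ‖f‖ * gauss z b := by
  have ha : 0 < a := hb.trans hba
  have hd : 0 < a ^ 2 - b ^ 2 := by nlinarith
  obtain ⟨C, hC, hg⟩ := exists_gauss_le_rpow (Real.sqrt_pos.2 hd) (-1)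
  refine ⟨C, hC, fun f hf z hz => ?_⟩
  have hz0 : 0 < z := by linarith
  have h1 := norm_gaussTransform_le ha.le hf.2 hz0
  rw [norm_cosineTransform] at h1
  have h2 := gaussTransform_eq_inv f (inv_pos.2 hz0)
  rw [inv_inv] at h2
  have h3 : gauss z a = gauss z b * gauss z (Real.sqrt (a ^ 2 - b ^ 2)) := by
    rw [gauss, gauss, gauss, ← Real.exp_add, Real.sq_sqrt hd.le]
    ring_nf
  have h4 := hg z hz
  rw [Real.rpow_neg_one] at h4
  rw [h2, norm_mul, Complex.ofReal_inv, inv_inv, Complex.norm_real, Real.norm_eq_abs,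
    abs_of_pos hz0]
  have h5 : 1 ≤ Real.sqrt z := by rwa [Real.one_le_sqrt]
  calc z * ‖gaussTransform (cosineTransform f) z‖
      ≤ z * (‖f‖ * (gauss z a / Real.sqrt z)) := mul_le_mul_of_nonneg_left h1 hz0.le
    _ ≤ z * (‖f‖ * (gauss z b * (C * z⁻¹))) := by
        gcongr
        refine (div_le_self (gauss_pos _ _).le h5).trans ?_
        rw [h3]
        exact mul_le_mul_of_nonneg_left h4 (gauss_pos _ _).le
    _ = C * ‖f‖ * gauss z b := by field_simp

theorem gauss_anti {x y b : ℝ} (hx : 0 ≤ x) (h : x ≤ y) : gauss y b ≤ gauss x b := by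
  rw [gauss, gauss, Real.exp_le_exp]
  have h1 := mul_le_mul_of_nonneg_left (pow_le_pow_left₀ hx h 2)
    (mul_nonneg Real.pi_pos.le (sq_nonneg b))
  linarith

/-- Decay at `0` of the Gaussian transform of the primitive, from the vanishing of the completed
Mellin transform at `w`. -/
theorem exists_norm_gaussTransform_mellinPrimitive_inv_le {a b : ℝ} (hb : 0 < b) (hba : b < a)
    {f : K} (hf : f ∈ sonineSpace a) {w : ℂ} (hw : 0 < w.re) (h0 : completedMellin f w = 0) :
    ∃ C, ∀ z, 1 ≤ z → ‖gaussTransform (mellinPrimitive w f) z⁻¹‖ ≤ C * gauss z b := by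
  have ha : 0 < a := hb.trans hba
  obtain ⟨C, hC, hg⟩ := exists_norm_gaussTransform_inv_le hb hba
  refine ⟨C * ‖f‖ / w.re, fun z hz => ?_⟩
  have hz0 : 0 < z := by linarith
  have hzi : 0 < z⁻¹ := inv_pos.2 hz0
  have hm0 : mellin (gaussTransform f) w = 0 := (mul_eq_zero.1 h0).resolve_left two_ne_zero
  have hconv : IntegrableOn (fun l : ℝ => (l : ℂ) ^ (-w - 1) * gaussTransform f (z⁻¹ * l⁻¹)) (Ioi 0) := by
    have h1 := (MellinConvergent.comp_mul_left (f := gaussTransform f) (s := w) hzi).2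
      (mellinConvergent_gaussTransform ha hf w)
    have h2 := (MellinConvergent.comp_rpow (f := fun x => gaussTransform f (z⁻¹ * x)) (s := -w)
      (a := -1) (by norm_num)).2 (by simpa using h1)
    refine IntegrableOn.congr_fun h2 (fun l hl => ?_) measurableSet_Ioi
    simp only [smul_eq_mul, Real.rpow_neg_one]
  -- Vanishing of the Mellin transform at `w` says that the integral over all `l` is zero, so the
  -- part over `(0, 1]` can be exchanged for the part over `(1, ∞)`. There the Gaussian transform is
  -- taken at `(z l)⁻¹` with `z l ≥ z`, where it is small.
  have htot : ∫ l in Ioi (0 : ℝ), (l : ℂ) ^ (-w - 1) * gaussTransform f (z⁻¹ * l⁻¹) = 0 := by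
    have h1 := mellin_comp_inv (fun x => gaussTransform f (z⁻¹ * x)) (-w)
    rw [neg_neg, mellin_comp_mul_left _ _ hzi, hm0, smul_zero] at h1
    exact h1
  rw [← Ioc_union_Ioi_eq_Ioi zero_le_one, setIntegral_union (Ioc_disjoint_Ioi le_rfl)
    measurableSet_Ioi (hconv.mono_set Ioc_subset_Ioi_self)
    (hconv.mono_set (Ioi_subset_Ioi zero_le_one))] at htot
  rw [gaussTransform_mellinPrimitive ha hf.1 w hzi, eq_neg_of_add_eq_zero_left htot, norm_neg]
  have hi : IntegrableOn (fun l : ℝ => C * ‖f‖ * gauss z b * l ^ (-w.re - 1)) (Ioi 1) :=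
    (integrableOn_Ioi_rpow_of_lt (by linarith) one_pos).const_mul _
  refine (norm_integral_le_of_norm_le hi ?_).trans (le_of_eq ?_)
  · filter_upwards [ae_restrict_mem measurableSet_Ioi] with l hl
    have hl : 1 < l := hl
    have hl0 : 0 < l := by linarith
    rw [norm_mul, Complex.norm_cpow_eq_rpow_re_of_pos hl0, Complex.sub_re, Complex.neg_re,
      Complex.one_re, ← mul_inv, mul_comm]
    refine mul_le_mul_of_nonneg_right ?_ (Real.rpow_nonneg hl0.le _)
    refine (hg f hf (z * l) (by nlinarith)).trans ?_
    refine mul_le_mul_of_nonneg_left (gauss_anti hz0.le (by nlinarith)) (by positivity)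
  · rw [integral_const_mul, integral_Ioi_rpow_of_lt (by linarith) one_pos]
    have : -w.re - 1 + 1 = -w.re := by ring
    rw [this, Real.one_rpow]
    field_simp

/-- The quotient is realised by `mellinPrimitive w f`, which inherits the gap of `f`. Its cosine
transform has the gap `(0, b)` for every `b < a` by Gaussian decay, hence `(0, a)`. The identity,
known for `Re s > Re w`, extends by analytic continuation. -/
theorem exists_sub_mul_completedMellin_eq_of_half_le {a : ℝ} (ha : 0 < a) {f : K}
    (hf : f ∈ sonineSpace a) {w : ℂ} (hw : 1 / 2 ≤ w.re) (h0 : completedMellin f w = 0) :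
    ∃ g ∈ sonineSpace a, ∀ s, (s - w) * completedMellin g s = completedMellin f s := by
  have hL := memLp_mellinPrimitive ha hf hw h0
  set g : K := hL.toLp _ with hg
  have hcoe : g =ᵐ[halfLine] mellinPrimitive w f := hL.coeFn_toLp
  have hgauss : gaussTransform g = gaussTransform (mellinPrimitive w f) :=
    funext fun x => gaussTransform_congr hcoe x
  have hgv : g ∈ vanishing a := by
    change ∀ᵐ t ∂halfLine, t < a → g t = 0
    filter_upwards [hcoe, ae_restrict_mem measurableSet_Ioi] with t h1 h2 h3
    rw [h1]
    exact mellinPrimitive_eq_zero hf.1 ha.le w h2 h3.le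
  have hgF : cosineTransform g ∈ vanishing a := by
    refine mem_vanishing_of_forall_lt _ ha fun b hb hba => ?_
    obtain ⟨C, hC⟩ :=
      exists_norm_gaussTransform_mellinPrimitive_inv_le hb hba hf (by linarith) h0
    refine mem_vanishing_of_gaussTransform_le _ (C := C) hb fun x hx => ?_
    have hx0 : 0 < x := by linarith
    rw [gaussTransform_cosineTransform _ hx0, norm_mul, norm_inv, Complex.norm_real,
      Real.norm_eq_abs, abs_of_pos hx0, hgauss]
    refine (mul_le_of_le_one_left (norm_nonneg _) ?_).trans (hC x hx)
    exact inv_le_one_of_one_le₀ hx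
  have hgK : g ∈ sonineSpace a := mem_sonineSpace_iff.2 ⟨hgv, hgF⟩
  refine ⟨g, hgK, fun s => ?_⟩
  refine congrFun (eq_of_eqOn_halfPlane (F := fun s => (s - w) * completedMellin g s)
    ((differentiable_id.sub_const w).mul (differentiable_completedMellin ha hgK))
    (differentiable_completedMellin ha hf) (σ := w.re) fun s hs => ?_) s
  have hre : 0 < (s - w).re := by simpa using hs
  have hne : s - w ≠ 0 := fun h => by simp [h] at hre
  simp only [completedMellin]
  rw [hgauss, mellin_gaussTransform_mellinPrimitive ha hf hs]
  field_simp

/-- Zeros of completed Mellin transforms can be divided out inside a Sonine space. -/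
theorem exists_sub_mul_completedMellin_eq {a : ℝ} (ha : 0 < a) {f : K} (hf : f ∈ sonineSpace a)
    {w : ℂ} (h0 : completedMellin f w = 0) :
    ∃ g ∈ sonineSpace a, ∀ s, (s - w) * completedMellin g s = completedMellin f s := by
  rcases le_total (1 / 2) w.re with hw | hw
  · exact exists_sub_mul_completedMellin_eq_of_half_le ha hf hw h0
  -- For `Re w ≤ 1/2` the cosine transform reflects the zero to `1 - w`. The sign `-1` below comes
  -- from `(1 - s) - (1 - w) = -(s - w)`.
  · obtain ⟨g, hg, h⟩ := exists_sub_mul_completedMellin_eq_of_half_le ha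
      (cosineTransform_mem_sonineSpace hf) (w := 1 - w)
      (by rw [Complex.sub_re, Complex.one_re]; linarith)
      (by rw [completedMellin_cosineTransform, sub_sub_cancel]; exact h0)
    refine ⟨(-1 : ℂ) • cosineTransform g,
      Submodule.smul_mem _ _ (cosineTransform_mem_sonineSpace hg), fun s => ?_⟩
    have := h (1 - s)
    rw [completedMellin_cosineTransform, sub_sub_cancel] at this
    rw [completedMellin_smul, completedMellin_cosineTransform, ← this]
    ring

/-! ### Nonzero elements of Sonine spaces. -/

/-- The even function `r ↦ ∫_a^{a+1} (cos (2πrξ) - cos (2πr(ξ+1))) dξ`, whose Fourier transform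
is supported outside `(-a, a)`. -/
noncomputable def bump (a r : ℝ) : ℝ :=
  ∫ ξ in a..(a + 1), (Real.cos (2 * Real.pi * ξ * r) - Real.cos (2 * Real.pi * (ξ + 1) * r))

/-- The difference of two cosines makes `bump` of size `O(r)` at `0`, which cancels the singularity
of `t / √(t² - a²)` at `t = a`. The average over `ξ` gives `O(r⁻¹)` at infinity (`abs_bump_le_inv`),
which makes `sonineFun` square integrable. -/
theorem abs_bump_le_mul (a : ℝ) {r : ℝ} (hr : 0 ≤ r) : |bump a r| ≤ 2 * Real.pi * r := by
  have := intervalIntegral.norm_integral_le_of_norm_le_const (a := a) (b := a + 1)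
    (C := 2 * Real.pi * r)
    (f := fun ξ => Real.cos (2 * Real.pi * ξ * r) - Real.cos (2 * Real.pi * (ξ + 1) * r)) ?_
  · simpa [bump] using this
  · intro ξ _
    rw [Real.norm_eq_abs]
    refine (Real.abs_cos_sub_cos_le _ _).trans ?_
    have : 2 * Real.pi * ξ * r - 2 * Real.pi * (ξ + 1) * r = -(2 * Real.pi * r) := by ring
    rw [this, abs_neg, abs_of_nonneg (by have := Real.pi_pos; positivity)]

theorem integral_cos_mul (α β : ℝ) {r : ℝ} (hr : 0 < r) :
    |∫ ξ in α..β, Real.cos (2 * Real.pi * ξ * r)| ≤ (Real.pi * r)⁻¹ := by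
  have hk : 0 < 2 * Real.pi * r := by have := Real.pi_pos; positivity
  have e : ∫ ξ in α..β, Real.cos (2 * Real.pi * ξ * r)
      = ∫ ξ in α..β, Real.cos (2 * Real.pi * r * ξ) := by
    congr 1
    ext ξ
    ring_nf
  rw [e, intervalIntegral.integral_comp_mul_left (fun y => Real.cos y) hk.ne', integral_cos,
    smul_eq_mul, abs_mul, abs_of_pos (inv_pos.2 hk)]
  have h1 : |Real.sin (2 * Real.pi * r * β) - Real.sin (2 * Real.pi * r * α)| ≤ 2 := by
    refine (abs_sub _ _).trans ?_
    have := Real.abs_sin_le_one (2 * Real.pi * r * β)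
    have := Real.abs_sin_le_one (2 * Real.pi * r * α)
    linarith
  calc _ ≤ (2 * Real.pi * r)⁻¹ * 2 := mul_le_mul_of_nonneg_left h1 (inv_pos.2 hk).le
    _ = _ := by
      have := Real.pi_pos
      field_simp

theorem abs_bump_le_inv (a : ℝ) {r : ℝ} (hr : 0 < r) : |bump a r| ≤ r⁻¹ := by
  have h1 := integral_cos_mul a (a + 1) hr
  have h2 := integral_cos_mul (a + 1) (a + 1 + 1) hr
  have e : ∫ ξ in a..(a + 1), Real.cos (2 * Real.pi * (ξ + 1) * r)
      = ∫ ξ in (a + 1)..(a + 1 + 1), Real.cos (2 * Real.pi * ξ * r) :=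
    intervalIntegral.integral_comp_add_right (fun ξ => Real.cos (2 * Real.pi * ξ * r)) 1
  rw [bump, intervalIntegral.integral_sub (Continuous.intervalIntegrable (by fun_prop) _ _)
    (Continuous.intervalIntegrable (by fun_prop) _ _), e]
  refine (abs_sub _ _).trans ((add_le_add h1 h2).trans ?_)
  rw [mul_inv]
  have hpi : Real.pi⁻¹ ≤ 1 / 2 := by
    rw [inv_le_comm₀ Real.pi_pos (by norm_num)]
    have := Real.pi_gt_three
    norm_num
    linarith
  have := inv_pos.2 hr
  nlinarith

theorem continuous_bump (a : ℝ) : Continuous (bump a) := by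
  unfold bump
  refine intervalIntegral.continuous_parametric_intervalIntegral_of_continuous' ?_ _ _
  fun_prop

theorem integrable_cos_mul_gauss {x : ℝ} (hx : 0 < x) (ξ : ℝ) :
    Integrable (fun r => (Real.cos (2 * Real.pi * ξ * r) : ℂ) * gauss x r) halfLine := by
  refine (integrable_gauss_ofReal hx).bdd_mul (c := 1)
    (Continuous.aestronglyMeasurable (by fun_prop)) (ae_of_all _ fun r => ?_)
  rw [Complex.norm_real]
  exact Real.abs_cos_le_one _

theorem integral_bump_mul_gauss (a : ℝ) {x : ℝ} (hx : 0 < x) :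
    ∫ r in Ioi (0 : ℝ), (bump a r : ℂ) * gauss x r
      = (((2 * x)⁻¹ * ∫ ξ in a..(a + 1), (gauss x⁻¹ ξ - gauss x⁻¹ (ξ + 1)) : ℝ) : ℂ) := by
  have hle : a ≤ a + 1 := by linarith
  have hprod : Integrable (Function.uncurry fun r ξ : ℝ =>
      ((Real.cos (2 * Real.pi * ξ * r) - Real.cos (2 * Real.pi * (ξ + 1) * r) : ℝ) : ℂ) * gauss x r)
      (halfLine.prod (volume.restrict (Ioc a (a + 1)))) := by
    have h1 : Integrable (fun p : ℝ × ℝ => (gauss x p.1 : ℂ))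
        (halfLine.prod (volume.restrict (Ioc a (a + 1)))) :=
      (integrable_gauss_ofReal hx).comp_fst _
    refine h1.bdd_mul (c := 2) (Continuous.aestronglyMeasurable (by fun_prop))
      (ae_of_all _ fun p => ?_)
    rw [Complex.norm_real, Real.norm_eq_abs]
    refine (abs_sub _ _).trans ?_
    have := Real.abs_cos_le_one (2 * Real.pi * p.2 * p.1)
    have := Real.abs_cos_le_one (2 * Real.pi * (p.2 + 1) * p.1)
    linarith
  have hswap := integral_integral_swap hprod
  have e1 : ∫ r in Ioi (0 : ℝ), (bump a r : ℂ) * gauss x r = ∫ r in Ioi (0 : ℝ),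
      ∫ ξ in Ioc a (a + 1), ((Real.cos (2 * Real.pi * ξ * r)
        - Real.cos (2 * Real.pi * (ξ + 1) * r) : ℝ) : ℂ) * gauss x r := by
    congr 1
    ext r
    rw [integral_mul_const, bump, intervalIntegral.integral_of_le hle]
    congr 1
    exact (integral_ofReal (𝕜 := ℂ)).symm
  rw [e1, hswap, intervalIntegral.integral_of_le hle, ← integral_const_mul]
  rw [← integral_complex_ofReal]
  congr 1
  ext ξ
  simp only [Complex.ofReal_sub, sub_mul]
  rw [integral_sub (integrable_cos_mul_gauss hx ξ) (integrable_cos_mul_gauss hx (ξ + 1)),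
    integral_cos_mul_gauss hx, integral_cos_mul_gauss hx]
  push_cast
  ring

/-- Sonine's function attached to `bump`. -/
noncomputable def sonineFun (a : ℝ) : ℝ → ℂ :=
  (Ioi a).indicator fun t =>
    ((bump a (Real.sqrt (t ^ 2 - a ^ 2)) * (t / Real.sqrt (t ^ 2 - a ^ 2)) : ℝ) : ℂ)

theorem norm_sonineFun_le {a : ℝ} (ha : 0 < a) {t : ℝ} (ht : a < t) :
    |bump a (Real.sqrt (t ^ 2 - a ^ 2)) * (t / Real.sqrt (t ^ 2 - a ^ 2))|
      ≤ (8 * Real.pi * a ^ 2 + 2) * t⁻¹ := by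
  have ht0 : 0 < t := ha.trans ht
  have hd : 0 < t ^ 2 - a ^ 2 := by nlinarith
  set r := Real.sqrt (t ^ 2 - a ^ 2) with hr
  have hr0 : 0 < r := Real.sqrt_pos.2 hd
  have hr2 : r ^ 2 = t ^ 2 - a ^ 2 := Real.sq_sqrt hd.le
  have hpi := Real.pi_pos
  rw [abs_mul, abs_of_pos (div_pos ht0 hr0)]
  rcases le_total t (2 * a) with h | h
  · calc |bump a r| * (t / r) ≤ 2 * Real.pi * r * (t / r) :=
          mul_le_mul_of_nonneg_right (abs_bump_le_mul a hr0.le) (div_pos ht0 hr0).le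
      _ = 2 * Real.pi * t ^ 2 * t⁻¹ := by field_simp
      _ ≤ _ := by
        refine mul_le_mul_of_nonneg_right ?_ (inv_pos.2 ht0).le
        have := mul_le_mul_of_nonneg_left (pow_le_pow_left₀ ht0.le h 2) hpi.le
        linarith
  · calc |bump a r| * (t / r) ≤ r⁻¹ * (t / r) :=
          mul_le_mul_of_nonneg_right (abs_bump_le_inv a hr0) (div_pos ht0 hr0).le
      _ = t ^ 2 / r ^ 2 * t⁻¹ := by field_simp
      _ ≤ _ := by
        refine mul_le_mul_of_nonneg_right ?_ (inv_pos.2 ht0).le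
        rw [hr2, div_le_iff₀ hd]
        have : 0 ≤ 8 * Real.pi * a ^ 2 * (t ^ 2 - a ^ 2) := by positivity
        nlinarith

theorem memLp_sonineFun {a : ℝ} (ha : 0 < a) : MemLp (sonineFun a) 2 halfLine := by
  have hbase : MemLp (fun t : ℝ => ((8 * Real.pi * a ^ 2 + 2 : ℝ) : ℂ) * (t : ℂ) ^ (-1 : ℂ)) 2
      (volume.restrict (Ioi a)) := (memLp_cpow_Ioi ha (s := 1) (by norm_num)).const_mul _
  rw [sonineFun, memLp_indicator_iff_restrict measurableSet_Ioi,
    Measure.restrict_restrict measurableSet_Ioi, inter_eq_left.2 (Ioi_subset_Ioi ha.le)]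
  refine hbase.of_le ?_ ?_
  · have := (continuous_bump a).measurable
    exact Measurable.aestronglyMeasurable (by fun_prop)
  · filter_upwards [ae_restrict_mem measurableSet_Ioi] with t ht
    have ht0 : 0 < t := ha.trans ht
    have hpi := Real.pi_pos
    rw [Complex.norm_real, Real.norm_eq_abs, norm_mul, Complex.norm_real, Real.norm_eq_abs,
      abs_of_nonneg (by positivity : (0 : ℝ) ≤ 8 * Real.pi * a ^ 2 + 2),
      Complex.norm_cpow_eq_rpow_re_of_pos ht0, Complex.neg_re, Complex.one_re, Real.rpow_neg_one]
    exact norm_sonineFun_le ha ht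

/-- The substitution `r = √(t² - a²)` factors `e^{-πt²x²}` as `e^{-πa²x²} e^{-πr²x²}`. The prefactor
reflects the gap of the function; after `x ↦ x⁻¹` the integral over `ξ ≥ a` gives the gap of its
cosine transform. -/
theorem gaussTransform_sonineFun {a : ℝ} (ha : 0 < a) {x : ℝ} (hx : 0 < x) :
    gaussTransform (sonineFun a) x = ((gauss x a * ((2 * x)⁻¹ *
      ∫ ξ in a..(a + 1), (gauss x⁻¹ ξ - gauss x⁻¹ (ξ + 1))) : ℝ) : ℂ) := by
  set φ : ℝ → ℝ := fun t => Real.sqrt (t ^ 2 - a ^ 2) with hφ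
  set g : ℝ → ℝ := fun r => bump a r * (gauss x a * gauss x r) with hg
  have hφa : φ a = 0 := by simp [hφ]
  have hgc : Continuous g := by
    have := continuous_bump a
    have := continuous_gauss x
    fun_prop
  have hgauss : ∀ t, a < t → gauss x a * gauss x (φ t) = gauss x t := by
    intro t ht
    have hd : 0 ≤ t ^ 2 - a ^ 2 := by nlinarith
    rw [gauss, gauss, gauss, ← Real.exp_add, hφ, Real.sq_sqrt hd]
    ring_nf
  have hbump : ∀ r, |bump a r| ≤ 2 := fun r => by
    have := intervalIntegral.norm_integral_le_of_norm_le_const (a := a) (b := a + 1) (C := 2)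
      (f := fun ξ => Real.cos (2 * Real.pi * ξ * r) - Real.cos (2 * Real.pi * (ξ + 1) * r)) ?_
    · simpa [bump] using this
    · intro ξ _
      refine (abs_sub _ _).trans ?_
      have := Real.abs_cos_le_one (2 * Real.pi * ξ * r)
      have := Real.abs_cos_le_one (2 * Real.pi * (ξ + 1) * r)
      linarith
  have hgi : Integrable g := by
    refine ((integrable_gauss hx).const_mul (gauss x a)).bdd_mul (c := 2)
      (continuous_bump a).aestronglyMeasurable (ae_of_all _ hbump)
  have hfi : Integrable (fun t => sonineFun a t * gauss x t) halfLine :=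
    (memLp_sonineFun ha).integrable_mul (memLp_gauss hx)
  have hcomp : ∀ t, a < t → (((g ∘ φ) t * (t / φ t) : ℝ) : ℂ) = sonineFun a t * gauss x t := by
    intro t ht
    rw [sonineFun, indicator_of_mem (show t ∈ Ioi a from ht), Function.comp_apply, hg]
    simp only
    rw [hgauss t ht]
    push_cast
    ring
  have hreal : IntegrableOn (fun t => (g ∘ φ) t * (t / φ t)) (Ioi a) := by
    have h1 := (IntegrableOn.mono_set hfi (Ioi_subset_Ioi ha.le)).re
    refine IntegrableOn.congr_fun h1 (fun t ht => ?_) measurableSet_Ioi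
    change (sonineFun a t * gauss x t).re = _
    rw [← hcomp t ht, Complex.ofReal_re]
  have hcv := integral_comp_mul_deriv_Ioi (f := φ) (f' := fun t => t / φ t) (g := g) (a := a)
    ?_ ?_ ?_ hgc.continuousOn hgi.integrableOn 
    ((integrableOn_Ici_iff_integrableOn_Ioi (by simp [hφa])).2 hreal)
  · have e1 : gaussTransform (sonineFun a) x
        = ((∫ t in Ioi a, (g ∘ φ) t * (t / φ t) : ℝ) : ℂ) := by
      rw [← integral_complex_ofReal, gaussTransform]
      rw [setIntegral_eq_of_subset_of_forall_sdiff_eq_zero measurableSet_Ioi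
        (Ioi_subset_Ioi ha.le) (f := fun t => sonineFun a t * (gauss x t : ℂ))]
      swap
      · intro t ht
        rw [sonineFun, indicator_of_notMem ht.2, zero_mul]
      refine setIntegral_congr_fun measurableSet_Ioi fun t ht => ?_
      exact (hcomp t ht).symm
    rw [e1, hcv, hφa, hg, Complex.ofReal_mul, ← integral_bump_mul_gauss a hx,
      ← integral_const_mul, ← integral_complex_ofReal]
    congr 1
    ext r
    push_cast
    ring
  · exact Continuous.continuousOn (by fun_prop)
  · refine Real.tendsto_sqrt_atTop.comp ?_
    exact tendsto_atTop_add_const_right _ _ (tendsto_pow_atTop two_ne_zero)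
  · intro t ht
    have ht : a < t := ht
    have hd : 0 < t ^ 2 - a ^ 2 := by nlinarith
    have h1 : HasDerivAt (fun t : ℝ => t ^ 2 - a ^ 2) (2 * t) t := by
      simpa using (hasDerivAt_pow 2 t).sub_const (a ^ 2)
    have h2 := h1.sqrt hd.ne'
    refine (h2.congr_deriv ?_).hasDerivWithinAt
    have := Real.sqrt_pos.2 hd
    simp only [hφ]
    field_simp

/-- Sonine spaces are nontrivial. -/
theorem exists_mem_sonineSpace_ne_zero {a : ℝ} (ha : 0 < a) : ∃ f ∈ sonineSpace a, f ≠ 0 := by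
  set f : K := (memLp_sonineFun ha).toLp _ with hf
  have hcoe : f =ᵐ[halfLine] sonineFun a := (memLp_sonineFun ha).coeFn_toLp
  have hG : ∀ x, 0 < x → gaussTransform f x = ((gauss x a * ((2 * x)⁻¹ *
      ∫ ξ in a..(a + 1), (gauss x⁻¹ ξ - gauss x⁻¹ (ξ + 1))) : ℝ) : ℂ) := fun x hx => by
    rw [gaussTransform_congr hcoe, gaussTransform_sonineFun ha hx]
  have hlt : ∀ x ξ : ℝ, 0 < x → 0 < ξ → gauss x (ξ + 1) < gauss x ξ := fun x ξ hx hξ => by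
    rw [gauss, gauss, Real.exp_lt_exp]
    have := mul_pos Real.pi_pos (pow_pos hx 2)
    nlinarith
  have hcont : ∀ x : ℝ, Continuous fun ξ => gauss x ξ - gauss x (ξ + 1) := fun x => by
    have := continuous_gauss x
    fun_prop
  refine ⟨f, mem_sonineSpace_iff.2 ⟨?_, ?_⟩, ?_⟩
  · change ∀ᵐ t ∂halfLine, t < a → f t = 0
    filter_upwards [hcoe] with t h1 h2
    rw [h1, sonineFun, indicator_of_notMem (show t ∉ Ioi a from not_lt.2 h2.le)]
  · refine mem_vanishing_of_gaussTransform_le _ (C := 1) ha fun x hx => ?_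
    have hx0 : 0 < x := by linarith
    rw [gaussTransform_cosineTransform _ hx0, hG _ (inv_pos.2 hx0), inv_inv, norm_mul, norm_inv,
      Complex.norm_real, Complex.norm_real, Real.norm_eq_abs, Real.norm_eq_abs, abs_of_pos hx0,
      abs_mul, abs_mul, abs_of_pos (gauss_pos _ _), abs_of_pos (by positivity : 0 < (2 * x⁻¹)⁻¹)]
    have hI : |∫ ξ in a..(a + 1), (gauss x ξ - gauss x (ξ + 1))| ≤ gauss x a := by
      have := intervalIntegral.norm_integral_le_of_norm_le_const (a := a) (b := a + 1)
        (C := gauss x a) (f := fun ξ => gauss x ξ - gauss x (ξ + 1)) ?_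
      · simpa using this
      · intro ξ hξ
        rw [uIoc_of_le (by linarith)] at hξ
        have h1 := hlt x ξ hx0 (ha.trans hξ.1)
        rw [Real.norm_eq_abs, abs_of_pos (by linarith)]
        have h2 := gauss_anti (b := x) ha.le hξ.1.le
        rw [gauss_comm x ξ, gauss_comm x a]
        have := gauss_pos x (ξ + 1)
        linarith
    have h1 := gauss_le_one x⁻¹ a
    have h0 := gauss_pos x⁻¹ a
    calc x⁻¹ * (gauss x⁻¹ a * ((2 * x⁻¹)⁻¹ * |∫ ξ in a..(a + 1), (gauss x ξ - gauss x (ξ + 1))|))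
        ≤ x⁻¹ * (1 * ((2 * x⁻¹)⁻¹ * gauss x a)) := by gcongr
      _ = gauss x a / 2 := by field_simp
      _ ≤ 1 * gauss x a := by linarith [gauss_pos x a]
  · intro h0
    have h1 := hG 1 one_pos
    rw [h0, gaussTransform_congr (Lp.coeFn_zero ℂ 2 halfLine)] at h1
    have h2 : gaussTransform (0 : ℝ → ℂ) 1 = 0 := by simp [gaussTransform]
    rw [h2] at h1
    -- The integrand is positive, so the Gaussian transform at `x = 1` is nonzero.
    have hpos : 0 < ∫ ξ in a..(a + 1), (gauss 1⁻¹ ξ - gauss 1⁻¹ (ξ + 1)) := by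
      refine intervalIntegral.intervalIntegral_pos_of_pos_on ((hcont _).intervalIntegrable _ _) ?_
        (by linarith)
      intro ξ hξ
      have := hlt 1⁻¹ ξ (by norm_num) (ha.trans hξ.1)
      linarith
    have h3 : 0 < gauss 1 a * ((2 * 1)⁻¹ *
        ∫ ξ in a..(a + 1), (gauss 1⁻¹ ξ - gauss 1⁻¹ (ξ + 1))) := by
      have := gauss_pos 1 a
      positivity
    exact h3.ne (by exact_mod_cast h1)

/-! ### Adding and removing zeros; comparison of minimality and completeness. -/

theorem analyticAt_completedMellin {a : ℝ} (ha : 0 < a) {f : K} (hf : f ∈ sonineSpace a) (s : ℂ) :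
    AnalyticAt ℂ (completedMellin f) s :=
  (differentiable_completedMellin ha hf).analyticAt s

theorem natCast_le_analyticOrderAt_completedMellin_iff {a : ℝ} (ha : 0 < a) {f : K}
    (hf : f ∈ sonineSpace a) (ρ : ℂ) (n : ℕ) :
    (n : ℕ∞) ≤ analyticOrderAt (completedMellin f) ρ ↔ ∀ i < n, mellinJet (ρ, i) f = 0 :=
  natCast_le_analyticOrderAt_iff_iteratedDeriv_eq_zero (analyticAt_completedMellin ha hf ρ)

/-- Lowering `a` makes room for one additional prescribed zero. -/
theorem exists_completedMellin_eq_cpow_sub_mul {a c : ℝ} (ha : 0 < a) (hc : 1 < c) {f : K}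
    (hf : f ∈ sonineSpace a) (hf0 : f ≠ 0) (w : ℂ) :
    ∃ g ∈ sonineSpace (a / c), g ≠ 0 ∧
      completedMellin g = (fun s : ℂ => (c : ℂ) ^ (s - 1) - (c : ℂ) ^ (w - 1)) * completedMellin f := by
  have hc0 := one_pos.trans hc
  have hac : 0 < a / c := div_pos ha hc0
  have hd := dilation_mem_sonineSpace hc ha hf
  have hf' := sonineSpace_anti (div_le_self ha.le hc.le) hf
  have hs := (sonineSpace (a / c)).smul_mem (-(c : ℂ) ^ (w - 1)) hf'
  have hM : completedMellin (dilation hc0 f + (-(c : ℂ) ^ (w - 1)) • f)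
      = (fun s : ℂ => (c : ℂ) ^ (s - 1) - (c : ℂ) ^ (w - 1)) * completedMellin f := by
    ext s
    rw [completedMellin_add hac hd hs, completedMellin_dilation, completedMellin_smul, Pi.mul_apply]
    ring
  refine ⟨_, Submodule.add_mem _ hd hs, fun h0 => hf0 ?_, hM⟩
  -- For `Re s > Re w` one has `|c^{s-1}| > |c^{w-1}|`, so the added factor has no zero there and
  -- `M(f)` would vanish on a half-plane.
  refine eq_zero_of_completedMellin_eq_zero ha hf fun s => ?_
  refine congrFun (eq_of_eqOn_halfPlane (differentiable_completedMellin ha hf)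
    (differentiable_const 0) (σ := w.re) fun s hs => ?_) s
  have h1 := congrFun hM s
  rw [h0, Pi.mul_apply] at h1
  have h2 : completedMellin (0 : K) s = 0 := by
    have := completedMellin_smul 0 (0 : K) s
    rwa [zero_smul, zero_mul] at this
  rw [h2] at h1
  refine (mul_eq_zero.1 h1.symm).resolve_left fun h => ?_
  have h3 := congrArg norm (sub_eq_zero.1 h)
  rw [norm_cpow_eq_rpow_re_of_pos hc0, norm_cpow_eq_rpow_re_of_pos hc0] at h3
  have h4 := (Real.rpow_lt_rpow_left_iff hc).2 (show (w - 1).re < (s - 1).re by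
    simpa using hs)
  exact h4.ne' h3

/-- Each prescribed zero consumes a piece of the interval from `a` down to `b`. Here `h` is a
product of factors `c^{s-1} - c^{w-1}` with varying `c`; keeping it explicit shows that the zeros of
`M(f)` survive. -/
theorem exists_completedMellin_eq_mul_of_count_le (T : Multiset ℂ) :
    ∀ {a b : ℝ}, 0 < b → b < a → ∀ {f : K}, f ∈ sonineSpace a → f ≠ 0 →
    ∃ g ∈ sonineSpace b, g ≠ 0 ∧ ∃ h : ℂ → ℂ, Differentiable ℂ h ∧
      completedMellin g = h * completedMellin f ∧ ∀ ρ, (T.count ρ : ℕ∞) ≤ analyticOrderAt h ρ := by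
  induction T using Multiset.induction with
  | empty =>
    intro a b _ hba f hf hf0
    exact ⟨f, sonineSpace_anti hba.le hf, hf0, 1, differentiable_const 1, (one_mul _).symm,
      fun ρ => by simp⟩
  | cons w T ih =>
    intro a b hb hba f hf hf0
    -- The zeros in `T` are added between `a` and `d`, the remaining zero `w` between `d` and `b` by
    -- the dilation factor `d / b`.
    obtain ⟨d, hbd, hda⟩ := exists_between hba
    have hd : 0 < d := hb.trans hbd
    obtain ⟨g, hg, hg0, h, hh, hgM, hT⟩ := ih hd hda hf hf0
    have hc : 1 < d / b := (one_lt_div hb).2 hbd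
    have hc0 : ((d / b : ℝ) : ℂ) ≠ 0 := by exact_mod_cast (one_pos.trans hc).ne'
    obtain ⟨k, hk, hk0, hkM⟩ := exists_completedMellin_eq_cpow_sub_mul hd hc hg hg0 w
    rw [div_div_cancel₀ hd.ne'] at hk
    have hdiff : Differentiable ℂ fun s : ℂ =>
        ((d / b : ℝ) : ℂ) ^ (s - 1) - ((d / b : ℝ) : ℂ) ^ (w - 1) := fun s =>
      (((differentiableAt_id.sub_const 1).const_cpow (Or.inl hc0)).sub_const _)
    refine ⟨k, hk, hk0, _, hdiff.mul hh, by rw [hkM, hgM, mul_assoc], fun ρ => ?_⟩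
    rw [analyticOrderAt_mul (hdiff.analyticAt ρ) (hh.analyticAt ρ), Multiset.count_cons,
      add_comm, Nat.cast_add]
    refine add_le_add ?_ (hT ρ)
    split_ifs with hρ
    · subst hρ
      rw [Nat.cast_one, Order.one_le_iff_ne_zero, (hdiff.analyticAt ρ).analyticOrderAt_ne_zero,
        sub_self]
    · simp

/-- Completeness in a Sonine space implies completeness, after omission of finitely many
evaluators, in the strictly smaller ones. -/
theorem isCompleteSystem_sdiff_of_lt {m : ℂ → ℕ} {a b : ℝ} (hb : 0 < b) (hba : b < a)
    (h : IsCompleteSystem (evaluators b (multisetIndex m))) {S : Set (ℂ × ℕ)} (hS : S.Finite) :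
    IsCompleteSystem (evaluators a (multisetIndex m \ S)) := by
  have ha := hb.trans hba
  rw [isCompleteSystem_evaluators_iff ha]
  rw [isCompleteSystem_evaluators_iff hb] at h
  intro f hf hz
  by_contra hf0
  set R : Finset ℂ := (hS.image Prod.fst).toFinset with hR
  obtain ⟨g, hg, hg0, u, hu, hM, hord⟩ := exists_completedMellin_eq_mul_of_count_le
    (∑ ρ ∈ R, Multiset.replicate (m ρ) ρ) hb hba hf hf0
  refine hg0 (h g hg ?_)
  rintro ⟨ρ, i⟩ hi
  have hi : i < m ρ := hi
  refine (natCast_le_analyticOrderAt_completedMellin_iff hb hg ρ (m ρ)).1 ?_ i hi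
  rw [hM, analyticOrderAt_mul (hu.analyticAt ρ) (analyticAt_completedMellin ha hf ρ)]
  by_cases hρ : ρ ∈ R
  · refine le_trans (le_trans ?_ (hord ρ)) le_self_add
    rw [Multiset.count_sum', Nat.cast_le]
    have := Finset.single_le_sum (f := fun x => (Multiset.replicate (m x) x).count ρ)
      (fun _ _ => Nat.zero_le _) hρ
    simpa using this
  · refine le_trans ?_ le_add_self
    refine (natCast_le_analyticOrderAt_completedMellin_iff ha hf ρ (m ρ)).2 fun j hj => ?_
    refine hz _ ⟨hj, fun hmem => hρ ?_⟩
    rw [hR, Set.Finite.mem_toFinset]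
    exact ⟨_, hmem, rfl⟩

/-- Dividing by `s - w` repeatedly lowers the order at `w` to any smaller value and changes no order
elsewhere. -/
theorem exists_sub_pow_mul_completedMellin_eq {a : ℝ} (ha : 0 < a) {f : K}
    (hf : f ∈ sonineSpace a) {w : ℂ} {N : ℕ} (hN : analyticOrderAt (completedMellin f) w = N) :
    ∀ i j : ℕ, i + j = N → ∃ g ∈ sonineSpace a, analyticOrderAt (completedMellin g) w = j ∧
      ∀ ρ ≠ w, analyticOrderAt (completedMellin g) ρ = analyticOrderAt (completedMellin f) ρ := by
  intro i
  induction i with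
  | zero =>
    intro j hj
    exact ⟨f, hf, by rw [hN, ← hj, zero_add], fun _ _ => rfl⟩
  | succ i ih =>
    intro j hj
    obtain ⟨g, hg, hgw, hgρ⟩ := ih (j + 1) (by omega)
    have h0 : completedMellin g w = 0 := by
      refine apply_eq_zero_of_analyticOrderAt_ne_zero ?_
      rw [hgw]
      exact_mod_cast j.succ_ne_zero
    obtain ⟨k, hk, hkM⟩ := exists_sub_mul_completedMellin_eq ha hg h0
    have e : ∀ ρ, analyticOrderAt (completedMellin g) ρ
        = analyticOrderAt (· - w) ρ + analyticOrderAt (completedMellin k) ρ := fun ρ => by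
      rw [← analyticOrderAt_mul (by fun_prop) (analyticAt_completedMellin ha hk ρ)]
      congr 1
      ext s
      exact (hkM s).symm
    refine ⟨k, hk, ?_, fun ρ hρ => ?_⟩
    · have := e w
      rw [hgw, analyticOrderAt_id_sub_const_self, Nat.cast_add, Nat.cast_one, add_comm] at this
      exact (WithTop.add_left_cancel ENat.one_ne_top this).symm
    · rw [← hgρ ρ hρ, e ρ, analyticOrderAt_id_sub_const_of_ne hρ, zero_add]

/-- If the evaluators are not minimal, then they are complete. -/
theorem isCompleteSystem_of_not_isMinimalSystem {m : ℂ → ℕ} {a : ℝ} (ha : 0 < a)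
    (h : ¬ IsMinimalSystem (evaluators a (multisetIndex m))) :
    IsCompleteSystem (evaluators a (multisetIndex m)) := by
  obtain ⟨⟨w, k⟩, hk, hp⟩ := exists_of_not_isMinimalSystem ha h
  have hk : k < m w := hk
  rw [isCompleteSystem_evaluators_iff ha]
  intro g hg hz
  by_contra hg0
  have hgρ : ∀ ρ, (m ρ : ℕ∞) ≤ analyticOrderAt (completedMellin g) ρ := fun ρ =>
    (natCast_le_analyticOrderAt_completedMellin_iff ha hg ρ _).2 fun i hi => hz (ρ, i) hi
  have htop : analyticOrderAt (completedMellin g) w ≠ ⊤ := by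
    intro ht
    refine hg0 (eq_zero_of_completedMellin_eq_zero ha hg fun s => congrFun
      (AnalyticOnNhd.eq_of_eventuallyEq (fun s _ => analyticAt_completedMellin ha hg s)
        analyticOnNhd_const (analyticOrderAt_eq_top.1 ht)) s)
  obtain ⟨N, hN⟩ := ENat.ne_top_iff_exists.1 htop
  have hmN : m w ≤ N := by
    have := hgρ w
    rw [← hN] at this
    exact_mod_cast this
  -- Starting from a nonzero `g` annihilated by all the evaluators, division produces for each `j ≤
  -- N` an element of exact order `j` at `w` that keeps the zeros required elsewhere.
  have hstep : ∀ j ≤ N, ∃ f ∈ sonineSpace a, (∀ ρ ≠ w, ∀ i < m ρ, mellinJet (ρ, i) f = 0) ∧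
      (∀ i < j, mellinJet (w, i) f = 0) ∧ mellinJet (w, j) f ≠ 0 := fun j hj => by
    obtain ⟨f, hf, hfw, hfρ⟩ := exists_sub_pow_mul_completedMellin_eq ha hg hN.symm (N - j) j
      (by omega)
    refine ⟨f, hf, fun ρ hρ => ?_, ?_⟩
    · refine (natCast_le_analyticOrderAt_completedMellin_iff ha hf ρ _).1 ?_
      rw [hfρ ρ hρ]
      exact hgρ ρ
    · exact (analyticOrderAt_eq_nat_iff_iteratedDeriv_eq_zero (analyticAt_completedMellin ha hf w)).1
        hfw
  -- Triangular elimination: elements of orders `k + 1, k + 2, …` are used in turn to cancel the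
  -- higher jets at `w` while keeping the `k`-th one nonzero.
  have hcomb : ∀ d, k + d ≤ N → ∃ f ∈ sonineSpace a,
      (∀ ρ ≠ w, ∀ i < m ρ, mellinJet (ρ, i) f = 0) ∧
      (∀ i ≤ k + d, i ≠ k → mellinJet (w, i) f = 0) ∧ mellinJet (w, k) f ≠ 0 := by
    intro d
    induction d with
    | zero =>
      intro hd
      obtain ⟨f, hf, h1, h2, h3⟩ := hstep k hd
      exact ⟨f, hf, h1, fun i hi hik => h2 i (lt_of_le_of_ne hi hik), h3⟩
    | succ d ih =>
      intro hd
      obtain ⟨f, hf, h1, h2, h3⟩ := ih (by omega)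
      obtain ⟨e, he, e1, e2, e3⟩ := hstep (k + d + 1) hd
      set c : ℂ := -(mellinJet (w, k + d + 1) f / mellinJet (w, k + d + 1) e) with hc
      have hj : ∀ q, mellinJet q (f + c • e) = mellinJet q f + c * mellinJet q e := fun q => by
        rw [mellinJet_add ha q hf ((sonineSpace a).smul_mem c he), mellinJet_smul ha q c he]
      refine ⟨f + c • e, Submodule.add_mem _ hf (Submodule.smul_mem _ c he), ?_, ?_, ?_⟩
      · intro ρ hρ i hi
        rw [hj, h1 ρ hρ i hi, e1 ρ hρ i hi, mul_zero, add_zero]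
      · intro i hi hik
        rcases Nat.lt_or_ge i (k + d + 1) with hlt | hge
        · rw [hj, h2 i (by omega) hik, e2 i hlt, mul_zero, add_zero]
        · obtain rfl : i = k + d + 1 := by omega
          rw [hj, hc, neg_mul, div_mul_cancel₀ _ e3, add_neg_cancel]
      · rw [hj, e2 k (by omega), mul_zero, add_zero]
        exact h3
  -- This choice of `d` makes `k + d` the last index `m w - 1`. The result is annihilated by every
  -- evaluator except the `k`-th at `w`, against the assumed dependence.
  obtain ⟨f, hf, h1, h2, h3⟩ := hcomb (m w - 1 - k) (by omega)
  refine h3 (hp f hf ?_)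
  rintro ⟨ρ, i⟩ hi hne
  have hi : i < m ρ := hi
  by_cases hρ : ρ = w
  · subst hρ
    exact h2 i (by omega) fun hik => hne (by rw [hik])
  · exact h1 ρ hρ i hi

/-- Any real strictly between `a₁` and `a` is a non-minimal parameter because `a₁` is a supremum,
hence a complete one. For `a₂` the infimum supplies the parameter directly. -/
theorem exists_isCompleteSystem_of_index_lt {m : ℂ → ℕ} {a : ℝ}
    (h : minimalityIndex m < ENNReal.ofReal a ∨ completenessIndex m < ENNReal.ofReal a) :
    ∃ b, 0 < b ∧ b < a ∧ IsCompleteSystem (evaluators b (multisetIndex m)) := by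
  rcases h with h | h
  · obtain ⟨x, hx, hxa⟩ := exists_between h
    have hxt : x ≠ ⊤ := hxa.ne_top
    have hx0 : 0 < x.toReal := ENNReal.toReal_pos (pos_of_gt hx).ne' hxt
    refine ⟨x.toReal, hx0, (ENNReal.lt_ofReal_iff_toReal_lt hxt).1 hxa,
      isCompleteSystem_of_not_isMinimalSystem hx0 fun hmin => hx.not_ge ?_⟩
    exact le_sSup ⟨x.toReal, hx0, hmin, (ENNReal.ofReal_toReal hxt).symm⟩
  · obtain ⟨_, ⟨b, hb, hc, rfl⟩, hlt⟩ := sInf_lt_iff.1 h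
    exact ⟨b, hb, (ENNReal.ofReal_lt_ofReal_iff_of_nonneg hb.le).1 hlt, hc⟩

end Sonine

/-- The evaluators `Z^b_{w,k}` exist in every `K_b`, and whenever `a(𝒵) < a < ∞`, where `a(𝒵)` is
either of the two (coinciding) indices of the multiset `𝒵`, the evaluators associated to `𝒵`
remain complete and not minimal in `K_a` after omitting any finitely many of them. -/
theorem mainTheorem7 (m : ℂ → ℕ) (hcount : {ρ : ℂ | m ρ ≠ 0}.Countable)
    (hne : {ρ : ℂ | m ρ ≠ 0}.Nonempty) (a : ℝ)
    (ha : Sonine.minimalityIndex m < ENNReal.ofReal a ∨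
      Sonine.completenessIndex m < ENNReal.ofReal a) :
    (∀ b : ℝ, 0 < b → ∀ (w : ℂ) (k : ℕ), Sonine.IsEvaluator b w k (Sonine.evaluator b w k)) ∧
    ∀ S : Set (ℂ × ℕ), S ⊆ Sonine.multisetIndex m → S.Finite →
      Sonine.IsCompleteSystem (Sonine.evaluators a (Sonine.multisetIndex m \ S)) ∧
      ¬ Sonine.IsMinimalSystem (Sonine.evaluators a (Sonine.multisetIndex m \ S)) := by
  refine ⟨fun b hb w k => Sonine.isEvaluator_evaluator hb w k, fun S _ hS => ?_⟩
  obtain ⟨b, hb, hba, hcb⟩ := Sonine.exists_isCompleteSystem_of_index_lt ha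
  have hcompl := Sonine.isCompleteSystem_sdiff_of_lt hb hba hcb hS
  refine ⟨hcompl, ?_⟩
  -- An empty family would be complete only in the zero space, and `K_a ≠ 0`.
  obtain ⟨p, hp⟩ : (Sonine.multisetIndex m \ S).Nonempty := by
    by_contra hempty
    rw [not_nonempty_iff_eq_empty] at hempty
    obtain ⟨f, hf, hf0⟩ := Sonine.exists_mem_sonineSpace_ne_zero (hb.trans hba)
    refine hf0 ((Sonine.isCompleteSystem_evaluators_iff (hb.trans hba) _).1 hcompl f hf ?_)
    rw [hempty]
    exact fun p hp => hp.elim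
  -- The set `S ∪ {p}` is still finite, so the family stays complete without `p`.
  refine Sonine.not_isMinimalSystem_of_isCompleteSystem hp ?_
  rw [sdiff_sdiff]
  exact Sonine.isCompleteSystem_sdiff_of_lt hb hba hcb (hS.union (finite_singleton p))
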